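/- An instance $(G,w,h)$ consists of a finite directed graph $G=(V,E)$, given by its list of edges, edge weights $w:E\to\mathbb R\cup\{+\infty\}$ and initial capacities $h:V\to\mathbb R\cup\{\pm\infty\}$; put $n=|V|$, $m=|E|$. The capacity of a directed path (possibly without edges) that starts at $u$ and traverses the edges $e_1,\dots,e_q$ is $\min\{h(u),w(e_1),\dots,w(e_q)\}$, and $d(v)$ is the maximum capacity of a path ending at $v$. Given thresholds $-\infty=\lambda_0<\lambda_1<\dots<\lambda_l<\lambda_{l+1}=+\infty$, the index $I(x)$ of $x\in\mathbb R\cup\{\pm\infty\}$ is the unique $i\in\{0,\dots,l\}$ with $\lambda_i\le x<\lambda_{i+1}$, where $I(+\infty)=l$. For $0\le i\le l$ let $$V_i=\{v\in V: I(d(v))=i\},\qquad E_i=\{(u,v)\in E: u,v\in V_i,\ w(u,v)\ge\lambda_i\},$$ and let $r=|E|-\sum_{i=0}^{l}|E_i|$ be the number of edges that belong to no $E_i$. There is a deterministic algorithm in the comparison-based model (a random access machine with words of $O(\log(n+m+l))$ bits, at unit cost per operation, on which weights, initial capacities and thresholds can only be compared and copied) and an absolute constant $C$ such that the following holds. For every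 instance with $G$ weakly connected, every integer $k\ge 1$, every $l$ with $1\le l\le\min\{k,m\}$, and all thresholds $\lambda_0<\dots<\lambda_{l+1}$ as above, the algorithm, given $(G,w,h)$ and the sorted thresholds, computes the levels $V_0,\dots,V_l$ (the index of the level of each vertex, and a list of the vertices of each level) in at most $C\,(m+r\log k)$ steps. -/

import Mathlib

namespace BottleneckSplit

/-! ### Instances: directed graphs with edge weights and initial capacities -/

/-- A directed graph with vertices `0, …, n - 1` and edges `0, …, m - 1` (edge `e` goes from `src e`
to `tgt e`), edge weights in `ℝ ∪ {+∞}`, and an initial capacity in `ℝ ∪ {±∞}` at every vertex.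
Loops and parallel edges are allowed, so simple directed graphs are a special case. -/
structure Instance where
  n : ℕ
  m : ℕ
  src : Fin m → Fin n
  tgt : Fin m → Fin n
  w : Fin m → EReal
  h : Fin n → EReal
  w_ne_bot : ∀ e, w e ≠ ⊥

namespace Instance

variable (G : Instance)

/-- The undirected graph obtained by forgetting the directions of the edges is connected. -/
def WeaklyConnected : Prop :=
  (SimpleGraph.fromRel fun u v : Fin G.n => ∃ e, G.src e = u ∧ G.tgt e = v).Connected

/-- The directed paths that end in a given vertex: the path with no edge, and a path
that ends in the source of an edge `e`, followed by `e`. -/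
inductive Path : Fin G.n → Type
  | single (v : Fin G.n) : Path v
  | snoc (e : Fin G.m) (p : Path (G.src e)) : Path (G.tgt e)

/-- The minimum of the initial capacity of the first vertex and of all the edge weights. -/
noncomputable def Path.capacity {G : Instance} : {v : Fin G.n} → G.Path v → EReal
  | _, .single v => G.h v
  | _, .snoc e p => min p.capacity (G.w e)

/-- `d v`: the maximum capacity of a path that ends in `v`. -/
noncomputable def d (v : Fin G.n) : EReal := ⨆ p : G.Path v, p.capacity

end Instance

/-! ### Levels -/

/-- `l + 2` thresholds `-∞ = lam 0 < lam 1 < ⋯ < lam l < lam (l + 1) = +∞`. -/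
structure IsThresholds {l : ℕ} (lam : Fin (l + 2) → EReal) : Prop where
  strictMono : StrictMono lam
  zero : lam 0 = ⊥
  last : lam (Fin.last (l + 1)) = ⊤

/-- The index of `x` is `i`: `lam i ≤ x < lam (i + 1)`, where `+∞` has the index `l`. -/
def HasIndex {l : ℕ} (lam : Fin (l + 2) → EReal) (x : EReal) (i : Fin (l + 1)) : Prop :=
  lam i.castSucc ≤ x ∧ (x < lam i.succ ∨ x = ⊤ ∧ i = Fin.last l)

/-- The `i`-th level `V_i`: the vertices `v` for which the index of `d v` is `i`. -/
def level (G : Instance) {l : ℕ} (lam : Fin (l + 2) → EReal) (i : Fin (l + 1)) :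
    Set (Fin G.n) :=
  {v | HasIndex lam (G.d v) i}

/-- The edge set `E_i` of the subinstance on `V_i`: the edges inside `V_i` of weight
at least `lam i`. -/
def levelEdges (G : Instance) {l : ℕ} (lam : Fin (l + 2) → EReal) (i : Fin (l + 1)) :
    Set (Fin G.m) :=
  {e | G.src e ∈ level G lam i ∧ G.tgt e ∈ level G lam i ∧ lam i.castSucc ≤ G.w e}

/-- `r`: the number of edges that are in none of the edge sets `E_0, …, E_l`. -/
noncomputable def lostEdges (G : Instance) {l : ℕ} (lam : Fin (l + 2) → EReal) : ℕ :=
  {e : Fin G.m | ∀ i, e ∉ levelEdges G lam i}.ncard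

/-! ### A comparison-based random access machine

Programs handle words (natural numbers) and keys (extended reals). Words can be added, subtracted,
halved, compared, and used as addresses. Keys can only be compared and copied.
A program is a finite term, so it names finitely many registers and arrays. -/

/-- The memory: word registers, word arrays, and key arrays. -/
structure Store where
  reg : ℕ → ℕ
  arr : ℕ → ℕ → ℕ
  key : ℕ → ℕ → EReal

/-- Word expressions; `get a i` is the content of the cell `i` of the word array `a`. -/
inductive WExpr
  | lit (c : ℕ)
  | reg (x : ℕ)
  | get (a : ℕ) (i : WExpr)
  | add (e f : WExpr)
  | sub (e f : WExpr)
  | half (e : WExpr)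

namespace WExpr

/-- The value of an expression (with truncated subtraction). -/
def eval (σ : Store) : WExpr → ℕ
  | lit c => c
  | reg x => σ.reg x
  | get a i => σ.arr a (i.eval σ)
  | add e f => e.eval σ + f.eval σ
  | sub e f => e.eval σ - f.eval σ
  | half e => e.eval σ / 2

/-- The cost of the evaluation: one step for each node of the expression. -/
def cost : WExpr → ℕ
  | lit _ => 1
  | reg _ => 1
  | get _ i => i.cost + 1
  | add e f => e.cost + f.cost + 1
  | sub e f => e.cost + f.cost + 1
  | half e => e.cost + 1

end WExpr

/-- Tests; `keyLe a i b j` compares the cell `i` of the key array `a` with the cell `j` of the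
key array `b`. -/
inductive Test
  | wordLe (e f : WExpr)
  | keyLe (a : ℕ) (i : WExpr) (b : ℕ) (j : WExpr)
  | neg (p : Test)
  | conj (p q : Test)

namespace Test

def Holds (σ : Store) : Test → Prop
  | wordLe e f => e.eval σ ≤ f.eval σ
  | keyLe a i b j => σ.key a (i.eval σ) ≤ σ.key b (j.eval σ)
  | neg p => ¬ p.Holds σ
  | conj p q => p.Holds σ ∧ q.Holds σ

def cost : Test → ℕ
  | wordLe e f => e.cost + f.cost + 1
  | keyLe _ i _ j => i.cost + j.cost + 1
  | neg p => p.cost + 1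
  | conj p q => p.cost + q.cost + 1

end Test

/-- Programs. -/
inductive Prog
  | skip
  | setReg (x : ℕ) (e : WExpr)
  | setArr (a : ℕ) (i e : WExpr)
  | copyKey (a : ℕ) (i : WExpr) (b : ℕ) (j : WExpr)
  | seq (P Q : Prog)
  | ite (b : Test) (P Q : Prog)
  | loop (b : Test) (P : Prog)

namespace Store

/-- `reg x := v`. -/
def setReg (σ : Store) (x v : ℕ) : Store :=
  { σ with reg := Function.update σ.reg x v }

/-- `arr a i := v`. -/
def setArr (σ : Store) (a i v : ℕ) : Store :=
  { σ with arr := Function.update σ.arr a (Function.update (σ.arr a) i v) }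

/-- `key a i := x`. -/
noncomputable def setKey (σ : Store) (a i : ℕ) (x : EReal) : Store :=
  { σ with key := Function.update σ.key a (Function.update (σ.key a) i x) }

end Store

/-- `Exec W P σ t τ`: the program `P`, started on the store `σ`, halts after exactly `t` steps with
the store `τ`, on a machine whose words are at most `W`. There is no rule for storing a larger
word or for writing to an address larger than `W`: a program that tries this has no run. -/
inductive Exec (W : ℕ) : Prog → Store → ℕ → Store → Prop
  | skip (σ : Store) : Exec W .skip σ 1 σ
  | setReg (σ : Store) (x : ℕ) (e : WExpr) (he : e.eval σ ≤ W) :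
      Exec W (.setReg x e) σ (e.cost + 1) (σ.setReg x (e.eval σ))
  | setArr (σ : Store) (a : ℕ) (i e : WExpr) (hi : i.eval σ ≤ W) (he : e.eval σ ≤ W) :
      Exec W (.setArr a i e) σ (i.cost + e.cost + 1) (σ.setArr a (i.eval σ) (e.eval σ))
  | copyKey (σ : Store) (a : ℕ) (i : WExpr) (b : ℕ) (j : WExpr) (hi : i.eval σ ≤ W) :
      Exec W (.copyKey a i b j) σ (i.cost + j.cost + 1)
        (σ.setKey a (i.eval σ) (σ.key b (j.eval σ)))
  | seq {P Q : Prog} {σ τ υ : Store} {s t : ℕ} (hP : Exec W P σ s τ) (hQ : Exec W Q τ t υ) :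
      Exec W (.seq P Q) σ (s + t) υ
  | iteTrue {b : Test} {P Q : Prog} {σ τ : Store} {t : ℕ} (hb : b.Holds σ)
      (hP : Exec W P σ t τ) : Exec W (.ite b P Q) σ (b.cost + t) τ
  | iteFalse {b : Test} {P Q : Prog} {σ τ : Store} {t : ℕ} (hb : ¬ b.Holds σ)
      (hQ : Exec W Q σ t τ) : Exec W (.ite b P Q) σ (b.cost + t) τ
  | loopStop {b : Test} {P : Prog} {σ : Store} (hb : ¬ b.Holds σ) :
      Exec W (.loop b P) σ b.cost σ
  | loopStep {b : Test} {P : Prog} {σ τ υ : Store} {s t : ℕ} (hb : b.Holds σ)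
      (hP : Exec W P σ s τ) (hloop : Exec W (.loop b P) τ t υ) :
      Exec W (.loop b P) σ (b.cost + s + t) υ

/-! ### Input and output of a split algorithm -/

/-- A finite sequence, padded with a default value. -/
def padded {α : Type} {N : ℕ} (dflt : α) (f : Fin N → α) (i : ℕ) : α :=
  if hi : i < N then f ⟨i, hi⟩ else dflt

/-- The input: `n`, `m`, `l` in the registers 0, 1, 2; the sources and targets of the edges
(in an arbitrary order) in the word arrays 0 and 1; the edge weights, the initial capacities and
the thresholds in the key arrays 0, 1 and 2. All other words are `0` and all other keys `-∞`. -/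
noncomputable def inputStore (G : Instance) {l : ℕ} (lam : Fin (l + 2) → EReal) : Store where
  reg
    | 0 => G.n
    | 1 => G.m
    | 2 => l
    | _ => 0
  arr
    | 0 => padded 0 fun e => (G.src e : ℕ)
    | 1 => padded 0 fun e => (G.tgt e : ℕ)
    | _ => fun _ => 0
  key
    | 0 => padded ⊥ G.w
    | 1 => padded ⊥ G.h
    | 2 => padded ⊥ lam
    | _ => fun _ => ⊥

/-- The output: the word array 2 holds the number of the level of each vertex; and for each `i`,
the word array 3 lists the vertices of `V_i`, without repetition, in the cells from
`arr 4 i` (inclusive) to `arr 5 i` (exclusive). -/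
structure IsSplit (G : Instance) {l : ℕ} (lam : Fin (l + 2) → EReal) (τ : Store) : Prop where
  label : ∀ (v : Fin G.n) (i : Fin (l + 1)), τ.arr 2 v = i ↔ v ∈ level G lam i
  list : ∀ i : Fin (l + 1),
    Set.BijOn (τ.arr 3) (Set.Ico (τ.arr 4 i) (τ.arr 5 i)) (Fin.val '' level G lam i)

end BottleneckSplit

namespace BottleneckSplit

/-! The levels are settled from the top down. A vertex belongs to level at least `i` if and only if
it is reached from a vertex with initial capacity at least `λ_i` by edges of weight at least `λ_i`.
So once the higher levels are known, a breadth-first search finds the next one, provided that the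
relevant capacities and weights are at hand when level `i` begins. For this purpose keys are kept in
buckets indexed by threshold. Locating a key by binary search costs about `s` steps, where `s` is
the bit length of `l`, so not every vertex and edge can afford it: only `O(m / s + r)` searches are
allowed.

Edges: a scanned edge whose weight reaches the current threshold is used at once, and an edge with a
settled target is dropped. Any other edge has weight index below the level of its source, so it is
lost, and the search is charged to `r`.

Vertices: a depth-first walk through the underlying undirected graph visits all vertices in at most
`4m + 1` entries, and consecutive entries are equal or adjacent. It is cut into `O(m / s + 1)`
blocks of at most `s` entries. A block is a single item, stored in the bucket of its largest
unsettled key, so that finding this key and locating it both cost `O(s)`. After a level is complete,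
the items of its bucket move to lower buckets. Each move uses up one of the distinct levels that
occur in the item (`credit_succ_le`). A block contains at most one level more than it has level
changes (`card_image_Ico_le`), and all changes along the walk number at most `4r`, because an edge
between two levels is lost and is crossed a bounded number of times (`run_walk`, `sum_hchange_le`).

Correctness rests on `Search.complete`: the settled set contains all sources of capacity at least
`λ_i` and is closed under edges of weight at least `λ_i`. The running time is controlled by
`potential`, whose decrease is established in `run_processLevel`. The total `O(m + s r)` of
`run_split` gives the claim, since `2 ^ s ≤ 2 l ≤ 2 k` and `r ≤ m`. -/

/-! ### A program logic with running times -/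

/-- The program `P`, started on `σ`, halts, and the running time and the final store satisfy `Q`. -/
def Run (W : ℕ) (P : Prog) (σ : Store) (Q : ℕ → Store → Prop) : Prop :=
  ∃ t τ, Exec W P σ t τ ∧ Q t τ

theorem Run.mono {W : ℕ} {P : Prog} {σ : Store} {Q R : ℕ → Store → Prop}
    (h : Run W P σ Q) (hQR : ∀ t τ, Q t τ → R t τ) : Run W P σ R := by
  obtain ⟨t, τ, he, hq⟩ := h
  exact ⟨t, τ, he, hQR t τ hq⟩

theorem run_skip {W : ℕ} {σ : Store} {Q : ℕ → Store → Prop} :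
    Run W .skip σ Q ↔ Q 1 σ := by
  constructor
  · rintro ⟨t, τ, he, hq⟩
    cases he
    exact hq
  · exact fun h => ⟨_, _, .skip σ, h⟩

theorem run_setReg {W : ℕ} {σ : Store} {x : ℕ} {e : WExpr} {Q : ℕ → Store → Prop} :
    Run W (.setReg x e) σ Q ↔ e.eval σ ≤ W ∧ Q (e.cost + 1) (σ.setReg x (e.eval σ)) := by
  constructor
  · rintro ⟨t, τ, he, hq⟩
    cases he
    exact ⟨by assumption, hq⟩
  · exact fun h => ⟨_, _, .setReg σ x e h.1, h.2⟩

theorem run_setArr {W : ℕ} {σ : Store} {a : ℕ} {i e : WExpr} {Q : ℕ → Store → Prop} :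
    Run W (.setArr a i e) σ Q ↔ i.eval σ ≤ W ∧ e.eval σ ≤ W ∧
      Q (i.cost + e.cost + 1) (σ.setArr a (i.eval σ) (e.eval σ)) := by
  constructor
  · rintro ⟨t, τ, he, hq⟩
    cases he
    exact ⟨by assumption, by assumption, hq⟩
  · exact fun h => ⟨_, _, .setArr σ a i e h.1 h.2.1, h.2.2⟩

theorem run_copyKey {W : ℕ} {σ : Store} {a b : ℕ} {i j : WExpr} {Q : ℕ → Store → Prop} :
    Run W (.copyKey a i b j) σ Q ↔ i.eval σ ≤ W ∧
      Q (i.cost + j.cost + 1) (σ.setKey a (i.eval σ) (σ.key b (j.eval σ))) := by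
  constructor
  · rintro ⟨t, τ, he, hq⟩
    cases he
    exact ⟨by assumption, hq⟩
  · exact fun h => ⟨_, _, .copyKey σ a i b j h.1, h.2⟩

theorem run_seq {W : ℕ} {σ : Store} {P P' : Prog} {Q : ℕ → Store → Prop} :
    Run W (.seq P P') σ Q ↔ Run W P σ fun s τ => Run W P' τ fun t υ => Q (s + t) υ := by
  constructor
  · rintro ⟨t, τ, he, hq⟩
    cases he with
    | seq h1 h2 => exact ⟨_, _, h1, _, _, h2, hq⟩
  · rintro ⟨s, τ, h1, t, υ, h2, hq⟩
    exact ⟨_, _, .seq h1 h2, hq⟩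

theorem run_ite {W : ℕ} {σ : Store} {b : Test} {P P' : Prog} {Q : ℕ → Store → Prop} :
    Run W (.ite b P P') σ Q ↔ (b.Holds σ → Run W P σ fun t τ => Q (b.cost + t) τ) ∧
      (¬ b.Holds σ → Run W P' σ fun t τ => Q (b.cost + t) τ) := by
  constructor
  · rintro ⟨t, τ, he, hq⟩
    cases he with
    | iteTrue hb hP => exact ⟨fun _ => ⟨_, _, hP, hq⟩, fun h => absurd hb h⟩
    | iteFalse hb hP => exact ⟨fun h => absurd h hb, fun _ => ⟨_, _, hP, hq⟩⟩
  · rintro ⟨h1, h2⟩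
    by_cases hb : b.Holds σ
    · obtain ⟨t, τ, he, hq⟩ := h1 hb
      exact ⟨_, _, .iteTrue hb he, hq⟩
    · obtain ⟨t, τ, he, hq⟩ := h2 hb
      exact ⟨_, _, .iteFalse hb he, hq⟩

theorem Test.cost_pos (b : Test) : 1 ≤ b.cost := by
  cases b <;> simp [Test.cost]

/-- The rule for loops: `I N σ` is an invariant in which `N` bounds the remaining running time, up to
the cost of the last test. -/
theorem run_loop {W : ℕ} {b : Test} {P : Prog} (I : ℕ → Store → Prop)
    (step : ∀ N σ, I N σ → b.Holds σ →
      Run W P σ fun t τ => ∃ N', I N' τ ∧ b.cost + t + N' ≤ N)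
    {N : ℕ} {σ : Store} (hI : I N σ) :
    Run W (.loop b P) σ fun t τ => ¬ b.Holds τ ∧ ∃ N', I N' τ ∧ t + N' ≤ N + b.cost := by
  induction N using Nat.strong_induction_on generalizing σ with
  | _ N ih =>
    by_cases hb : b.Holds σ
    · obtain ⟨t, τ, he, N', hI', hle⟩ := step N σ hI hb
      -- Every test costs at least one step, so `N' < N` and the induction applies.
      have := b.cost_pos
      obtain ⟨t', υ, he', hb', N'', hI'', hle'⟩ := ih N' (by omega) hI'
      exact ⟨_, _, .loopStep hb he he', hb', N'', hI'', by omega⟩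
    · exact ⟨_, _, .loopStop hb, hb, N, hI, by omega⟩

infixr:60 " ;; " => Prog.seq

section
variable (σ : Store) (x v a i : ℕ) (k : EReal)

@[simp] theorem Store.setReg_reg : (σ.setReg x v).reg = Function.update σ.reg x v := rfl
@[simp] theorem Store.setReg_arr : (σ.setReg x v).arr = σ.arr := rfl
@[simp] theorem Store.setReg_key : (σ.setReg x v).key = σ.key := rfl
@[simp] theorem Store.setArr_reg : (σ.setArr a i v).reg = σ.reg := rfl
@[simp] theorem Store.setArr_arr : (σ.setArr a i v).arr =
    Function.update σ.arr a (Function.update (σ.arr a) i v) := rfl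
@[simp] theorem Store.setArr_key : (σ.setArr a i v).key = σ.key := rfl
@[simp] theorem Store.setKey_reg : (σ.setKey a i k).reg = σ.reg := rfl
@[simp] theorem Store.setKey_arr : (σ.setKey a i k).arr = σ.arr := rfl
@[simp] theorem Store.setKey_key : (σ.setKey a i k).key =
    Function.update σ.key a (Function.update (σ.key a) i k) := rfl

end

/-! ### Families of linked lists -/

/-- The cell `p` heads the linked list `L` in the array `nxt`; the element `x` is stored as the
pointer `x + 1`, and the pointer `0` ends the list. -/
def Chain (nxt : ℕ → ℕ) : ℕ → List ℕ → Prop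
  | p, [] => p = 0
  | p, x :: L => p = x + 1 ∧ Chain nxt (nxt x) L

theorem Chain.update {nxt : ℕ → ℕ} {y z : ℕ} :
    ∀ {L : List ℕ} {p : ℕ}, Chain nxt p L → y ∉ L → Chain (Function.update nxt y z) p L
  | [], _, h, _ => h
  | x :: L, p, h, hy => by
    have hxy : x ≠ y := fun e => hy (by simp [e])
    refine ⟨h.1, ?_⟩
    rw [Function.update_of_ne hxy]
    exact h.2.update fun e => hy (List.mem_cons_of_mem _ e)

theorem Chain.eq_nil {nxt : ℕ → ℕ} {L : List ℕ} (h : Chain nxt 0 L) : L = [] := by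
  cases L with
  | nil => rfl
  | cons x L => exact absurd h.1 (by omega)

theorem Chain.eq_cons {nxt : ℕ → ℕ} {L : List ℕ} {p : ℕ} (h : Chain nxt p L) (hp : 1 ≤ p) :
    ∃ L', L = (p - 1) :: L' ∧ Chain nxt (nxt (p - 1)) L' := by
  cases L with
  | nil => exact absurd h (by change p ≠ 0; omega)
  | cons x L =>
    obtain ⟨h1, h2⟩ := h
    obtain rfl : x = p - 1 := by omega
    exact ⟨L, rfl, h2⟩

theorem Chain.le {nxt : ℕ → ℕ} {L : List ℕ} {p M : ℕ} (h : Chain nxt p L) (hL : ∀ x ∈ L, x < M) :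
    p ≤ M := by
  cases L with
  | nil =>
    have : p = 0 := h
    omega
  | cons x L =>
    have h1 := h.1
    have := hL x (by simp)
    omega

/-- `head j` heads the list `L j`, for every `j`. -/
def Chains (nxt head : ℕ → ℕ) (L : ℕ → List ℕ) : Prop :=
  ∀ j, Chain nxt (head j) (L j)

/-- All lists share the array `nxt`. The cell of `x` may be overwritten only because `x` is in none
of them. -/
theorem Chains.push {nxt head : ℕ → ℕ} {L : ℕ → List ℕ} (h : Chains nxt head L) {x : ℕ}
    (hx : ∀ j, x ∉ L j) (j : ℕ) :
    Chains (Function.update nxt x (head j)) (Function.update head j (x + 1))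
      (Function.update L j (x :: L j)) := by
  intro i
  by_cases hij : i = j
  · subst hij
    simp only [Function.update_self]
    refine ⟨rfl, ?_⟩
    rw [Function.update_self]
    exact (h i).update (hx i)
  · simp only [Function.update_of_ne hij]
    exact (h i).update (hx i)

theorem Chains.pop {nxt head : ℕ → ℕ} {L : ℕ → List ℕ} (h : Chains nxt head L) {j : ℕ}
    {L' : List ℕ} (hL' : Chain nxt (nxt (head j - 1)) L') :
    Chains nxt (Function.update head j (nxt (head j - 1))) (Function.update L j L') := by
  intro i
  by_cases hij : i = j
  · subst hij
    simpa only [Function.update_self] using hL'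
  · simpa only [Function.update_of_ne hij] using h i

/-- The total weight of the elements of the lists `L 0, …, L (n - 1)`. -/
def weight (n : ℕ) (φ : ℕ → ℕ → ℕ) (L : ℕ → List ℕ) : ℕ :=
  ∑ j ∈ Finset.range n, ((L j).map (φ j)).sum

theorem weight_nil (n : ℕ) (φ : ℕ → ℕ → ℕ) : weight n φ (fun _ => []) = 0 := by
  simp [weight]

theorem weight_update {n : ℕ} (φ : ℕ → ℕ → ℕ) (L : ℕ → List ℕ) {j : ℕ} (hj : j < n)
    (M : List ℕ) :
    weight n φ (Function.update L j M) + ((L j).map (φ j)).sum =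
      weight n φ L + (M.map (φ j)).sum := by
  have hj' : j ∈ Finset.range n := Finset.mem_range.2 hj
  unfold weight
  rw [← Finset.add_sum_erase _ _ hj', ← Finset.add_sum_erase _ (fun j => ((L j).map (φ j)).sum) hj']
  have : ∑ i ∈ (Finset.range n).erase j, ((Function.update L j M i).map (φ i)).sum =
      ∑ i ∈ (Finset.range n).erase j, ((L i).map (φ i)).sum := by
    refine Finset.sum_congr rfl fun i hi => ?_
    rw [Function.update_of_ne (Finset.ne_of_mem_erase hi)]
  rw [this, Function.update_self]
  omega

theorem weight_push {n : ℕ} (φ : ℕ → ℕ → ℕ) (L : ℕ → List ℕ) {j : ℕ} (hj : j < n) (x : ℕ) :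
    weight n φ (Function.update L j (x :: L j)) = weight n φ L + φ j x := by
  have := weight_update φ L hj (x :: L j)
  simp only [List.map_cons, List.sum_cons] at this
  omega

theorem weight_pop {n : ℕ} (φ : ℕ → ℕ → ℕ) {L : ℕ → List ℕ} {j : ℕ} (hj : j < n) {x : ℕ}
    {M : List ℕ} (hL : L j = x :: M) :
    weight n φ (Function.update L j M) + φ j x = weight n φ L := by
  have := weight_update φ L hj M
  rw [hL] at this
  simp only [List.map_cons, List.sum_cons] at this
  omega

/-! ### Stacks -/

/-- The cells `0, …, L.length - 1` of the array `f` hold the stack `L`, whose top is the head. -/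
def IsStack (f : ℕ → ℕ) : List ℕ → Prop
  | [] => True
  | x :: L => f L.length = x ∧ IsStack f L

theorem IsStack.congr {f g : ℕ → ℕ} : ∀ {L : List ℕ}, IsStack f L →
    (∀ i < L.length, g i = f i) → IsStack g L
  | [], _, _ => trivial
  | x :: L, h, hg => by
    refine ⟨(hg _ (by simp)).trans h.1, h.2.congr fun i hi => hg i ?_⟩
    simp only [List.length_cons]
    omega

theorem IsStack.push {f : ℕ → ℕ} {L : List ℕ} (h : IsStack f L) (x : ℕ) :
    IsStack (Function.update f L.length x) (x :: L) := by
  refine ⟨by simp, h.congr fun i hi => ?_⟩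
  rw [Function.update_of_ne hi.ne]

theorem IsStack.mem_iff {f : ℕ → ℕ} {y : ℕ} : ∀ {L : List ℕ}, IsStack f L →
    (y ∈ L ↔ ∃ i < L.length, f i = y)
  | [], _ => by simp
  | x :: L, h => by
    rw [List.mem_cons, h.2.mem_iff]
    constructor
    · rintro (rfl | ⟨i, hi, hy⟩)
      · exact ⟨L.length, by simp, h.1⟩
      · exact ⟨i, by simp; omega, hy⟩
    · rintro ⟨i, hi, hy⟩
      rcases Nat.lt_succ_iff_lt_or_eq.1 (by simpa using hi) with h' | h'
      · exact .inr ⟨i, h', hy⟩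
      · subst h'
        exact .inl (hy.symm.trans h.1)

/-! ### Changes along a sequence -/

/-- The number of pairs of consecutive elements on which `c` differs. -/
def changes (c : ℕ → ℕ) : List ℕ → ℕ
  | x :: y :: L => (if c x = c y then 0 else 1) + changes c (y :: L)
  | _ => 0

/-- The number of `i` with `a ≤ i` and `i + 1 < b` for which `c i` and `c (i + 1)` differ. -/
def changesOn (c : ℕ → ℕ) (a b : ℕ) : ℕ :=
  ((Finset.Ico a (b - 1)).filter fun i => c i ≠ c (i + 1)).card

/-- Only an inequality, since a change between `b - 1` and `b` is counted on neither part. It allows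
the changes inside disjoint blocks to be summed. -/
theorem changesOn_add_le (c : ℕ → ℕ) {a b d : ℕ} (hab : a ≤ b) (hbd : b ≤ d) :
    changesOn c a b + changesOn c b d ≤ changesOn c a d := by
  unfold changesOn
  rw [← Finset.card_union_of_disjoint]
  · refine Finset.card_le_card fun i hi => ?_
    simp only [Finset.mem_union, Finset.mem_filter, Finset.mem_Ico] at hi ⊢
    omega
  · rw [Finset.disjoint_left]
    intro i hi hi'
    simp only [Finset.mem_filter, Finset.mem_Ico] at hi hi'
    omega

/-- Every value except the one at `a` makes its first appearance right after a change. Applied to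
levels, this bounds the number of distinct levels in a block. -/
theorem card_image_Ico_le (c : ℕ → ℕ) (a b : ℕ) :
    ((Finset.Ico a b).image c).card ≤ changesOn c a b + 1 := by
  induction b with
  | zero => simp
  | succ b ih =>
    by_cases hab : a ≤ b
    · rw [← Finset.insert_Ico_right_eq_Ico_add_one hab, Finset.image_insert]
      by_cases hc : a < b ∧ c (b - 1) = c b
      · rw [Finset.insert_eq_of_mem]
        · have := changesOn_add_le c hab (Nat.le_succ b)
          simp only [Nat.succ_eq_add_one] at this
          omega
        · exact Finset.mem_image.2 ⟨b - 1, Finset.mem_Ico.2 (by omega), hc.2⟩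
      · refine (Finset.card_insert_le _ _).trans ?_
        by_cases hab' : a = b
        · subst hab'
          simp
        · have hlt : a < b := by omega
          have hne : c (b - 1) ≠ c b := fun h => hc ⟨hlt, h⟩
          have : changesOn c a b + 1 ≤ changesOn c a (b + 1) := by
            unfold changesOn
            rw [← Finset.card_insert_of_notMem (a := b - 1) (by simp)]
            refine Finset.card_le_card fun i hi => ?_
            simp only [Finset.mem_insert, Finset.mem_filter, Finset.mem_Ico] at hi ⊢
            rcases hi with rfl | hi
            · refine ⟨by omega, ?_⟩
              rwa [Nat.sub_add_cancel (by omega)]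
            · exact ⟨by omega, hi.2⟩
          omega
    · rw [Finset.Ico_eq_empty (by omega)]
      simp

/-- The array runs through the list from its end to its head, but the number of changes does not
depend on the direction. -/
theorem IsStack.changesOn_eq {f c : ℕ → ℕ} : ∀ {L : List ℕ}, IsStack f L →
    changesOn (fun i => c (f i)) 0 L.length = changes c L
  | [], _ => by simp [changesOn, changes]
  | [x], _ => by simp [changesOn, changes]
  | x :: y :: L, h => by
    have ih := h.2.changesOn_eq (c := c)
    have hx := h.1
    have hy := h.2.1
    simp only [changes, ← ih]
    simp only [List.length_cons] at hx ⊢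
    unfold changesOn
    have : Finset.Ico 0 (L.length + 1 + 1 - 1) = insert L.length (Finset.Ico 0 (L.length + 1 - 1)) := by
      ext i
      simp
      omega
    rw [this, Finset.filter_insert]
    simp only [hx, hy]
    by_cases hc : c x = c y
    · simp [hc]
    · rw [if_pos (fun h => hc h.symm), Finset.card_insert_of_notMem (by simp), if_neg hc]
      omega

/-! ### Indices and levels -/

/-- The largest `j ≤ l` with `lam j ≤ x`. -/
noncomputable def idx {l : ℕ} (lam : Fin (l + 2) → EReal) (x : EReal) : ℕ :=
  open Classical in Nat.findGreatest (fun j => padded ⊥ lam j ≤ x) l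

section Index

variable {l : ℕ} {lam : Fin (l + 2) → EReal}

theorem idx_le (x : EReal) : idx lam x ≤ l := Nat.findGreatest_le l

theorem IsThresholds.padded_mono (h : IsThresholds lam) {i j : ℕ} (hij : i ≤ j) (hj : j ≤ l) :
    padded ⊥ lam i ≤ padded ⊥ lam j := by
  unfold padded
  rw [dif_pos (by omega), dif_pos (by omega)]
  exact h.strictMono.monotone (by simpa using hij)

theorem IsThresholds.padded_zero (h : IsThresholds lam) : padded ⊥ lam 0 = ⊥ := by
  unfold padded
  rw [dif_pos (by omega)]
  exact h.zero

/-- An adjunction that turns every comparison with a threshold into a comparison of natural numbers.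
The threshold `λ_0 = -∞` guarantees that the greatest index exists. -/
theorem IsThresholds.padded_le_iff (h : IsThresholds lam) {i : ℕ} (hi : i ≤ l) {x : EReal} :
    padded ⊥ lam i ≤ x ↔ i ≤ idx lam x := by
  classical
  constructor
  · intro hx
    exact Nat.le_findGreatest hi hx
  · intro hx
    have h0 : padded ⊥ lam (idx lam x) ≤ x := by
      unfold idx
      refine Nat.findGreatest_spec (P := fun j => padded ⊥ lam j ≤ x) (Nat.zero_le l) ?_
      rw [h.padded_zero]
      exact bot_le
    exact (h.padded_mono hx (idx_le x)).trans h0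

theorem IsThresholds.idx_mono (h : IsThresholds lam) {x y : EReal} (hxy : x ≤ y) :
    idx lam x ≤ idx lam y :=
  (h.padded_le_iff (idx_le x)).1 (((h.padded_le_iff (idx_le x)).2 le_rfl).trans hxy)

theorem IsThresholds.hasIndex_iff (h : IsThresholds lam) {x : EReal} {i : Fin (l + 1)} :
    HasIndex lam x i ↔ idx lam x = i := by
  have hi : (i : ℕ) ≤ l := by omega
  have h1 : lam i.castSucc = padded ⊥ lam i := by
    unfold padded
    rw [dif_pos (by omega)]
    rfl
  have h2 : lam i.succ = padded ⊥ lam (i + 1) := by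
    unfold padded
    rw [dif_pos (by omega)]
    rfl
  unfold HasIndex
  rw [h1, h.padded_le_iff hi]
  -- The last index is separate: its upper threshold is `+∞`, and `x = +∞` itself is admitted there.
  by_cases hil : (i : ℕ) = l
  · have hi' : i = Fin.last l := Fin.ext hil
    have h3 : lam i.succ = ⊤ := by rw [hi', Fin.succ_last, h.last]
    have h4 : x < lam i.succ ∨ x = ⊤ ∧ i = Fin.last l := by
      rw [h3]
      rcases eq_or_ne x ⊤ with hx | hx
      · exact .inr ⟨hx, hi'⟩
      · exact .inl (lt_top_iff_ne_top.2 hx)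
    have := idx_le (lam := lam) x
    constructor
    · intro h'
      omega
    · intro h'
      exact ⟨by omega, h4⟩
  · have h3 : x < lam i.succ ↔ ¬ (i : ℕ) + 1 ≤ idx lam x := by
      rw [h2, ← h.padded_le_iff (by omega), not_le]
    have h4 : ¬ (x = ⊤ ∧ i = Fin.last l) := fun h' => hil (by rw [h'.2]; rfl)
    rw [h3]
    constructor
    · rintro ⟨h5, h6 | h6⟩
      · omega
      · exact absurd h6 h4
    · intro h'
      exact ⟨by omega, .inl (by omega)⟩

end Index

/-! ### Optimal capacities -/

namespace Instance

variable (G : Instance)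

theorem Path.capacity_mem {G : Instance} {v : Fin G.n} (p : G.Path v) :
    p.capacity ∈ Set.range G.h ∪ Set.range G.w := by
  induction p with
  | single v => exact .inl ⟨v, rfl⟩
  | snoc e p ih =>
    simp only [Path.capacity]
    rcases min_choice p.capacity (G.w e) with h | h <;> rw [h]
    · exact ih
    · exact .inr ⟨e, rfl⟩

/-- Capacities take values among the finitely many values of `h` and `w`, so the supremum is
attained. -/
theorem exists_capacity_eq (v : Fin G.n) : ∃ p : G.Path v, p.capacity = G.d v := by
  have hfin : (Set.range fun p : G.Path v => p.capacity).Finite :=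
    ((Set.finite_range G.h).union (Set.finite_range G.w)).subset
      (Set.range_subset_iff.2 fun p => p.capacity_mem)
  have hne : (Set.range fun p : G.Path v => p.capacity).Nonempty := ⟨_, .single v, rfl⟩
  exact hne.csSup_mem hfin

theorem h_le_d (v : Fin G.n) : G.h v ≤ G.d v :=
  le_iSup (fun p : G.Path v => p.capacity) (.single v)

theorem min_le_d (e : Fin G.m) : min (G.d (G.src e)) (G.w e) ≤ G.d (G.tgt e) := by
  obtain ⟨p, hp⟩ := G.exists_capacity_eq (G.src e)
  rw [← hp]
  exact le_iSup (fun p : G.Path (G.tgt e) => p.capacity) (.snoc e p)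

/-- Induction along an optimal path: if its capacity is at least `x`, then so are its initial
capacity and all of its weights. -/
theorem mem_of_le_d {S : Set (Fin G.n)} {x : EReal} (hh : ∀ v, x ≤ G.h v → v ∈ S)
    (hw : ∀ e, G.src e ∈ S → x ≤ G.w e → G.tgt e ∈ S) {v : Fin G.n} (hv : x ≤ G.d v) :
    v ∈ S := by
  obtain ⟨p, hp⟩ := G.exists_capacity_eq v
  rw [← hp] at hv
  clear hp
  induction p with
  | single v => exact hh v hv
  | snoc e p ih =>
    simp only [Path.capacity, le_min_iff] at hv
    exact hw e (ih hv.1) hv.2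

theorem WeaklyConnected.mem_of_closed {G : Instance} (h : G.WeaklyConnected) {S : Set (Fin G.n)}
    {u : Fin G.n} (hu : u ∈ S) (hS : ∀ e, G.src e ∈ S ↔ G.tgt e ∈ S) (v : Fin G.n) : v ∈ S := by
  obtain ⟨p⟩ := h.preconnected u v
  induction p with
  | nil => exact hu
  | cons hadj p ih =>
    refine ih ?_
    rw [SimpleGraph.fromRel_adj] at hadj
    rcases hadj.2 with ⟨e, he1, he2⟩ | ⟨e, he1, he2⟩
    · rw [← he2, ← hS, he1]
      exact hu
    · rw [← he1, hS, he2]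
      exact hu

/-- The source of an edge, as a number. -/
def srcN (e : ℕ) : ℕ := padded 0 (fun e => (G.src e : ℕ)) e

/-- The target of an edge, as a number. -/
def tgtN (e : ℕ) : ℕ := padded 0 (fun e => (G.tgt e : ℕ)) e

/-- The number of the level of a vertex. -/
noncomputable def lv {l : ℕ} (lam : Fin (l + 2) → EReal) (v : ℕ) : ℕ :=
  idx lam (padded ⊥ G.d v)

/-- The index of the weight of an edge. -/
noncomputable def wi {l : ℕ} (lam : Fin (l + 2) → EReal) (e : ℕ) : ℕ :=
  idx lam (padded ⊥ G.w e)

/-- The index of the initial capacity of a vertex. -/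
noncomputable def hi {l : ℕ} (lam : Fin (l + 2) → EReal) (v : ℕ) : ℕ :=
  idx lam (padded ⊥ G.h v)

/-- The edge is in none of the level edge sets. -/
def Lost {l : ℕ} (lam : Fin (l + 2) → EReal) (e : ℕ) : Prop :=
  ¬ (G.lv lam (G.srcN e) = G.lv lam (G.tgtN e) ∧ G.lv lam (G.srcN e) ≤ G.wi lam e)

theorem padded_coe {α : Type} {N : ℕ} (x : α) (f : Fin N → α) (i : Fin N) : padded x f i = f i := by
  simp [padded]

@[simp] theorem srcN_coe (e : Fin G.m) : G.srcN e = G.src e := padded_coe _ _ e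

@[simp] theorem tgtN_coe (e : Fin G.m) : G.tgtN e = G.tgt e := padded_coe _ _ e

theorem srcN_lt {e : ℕ} (he : e < G.m) : G.srcN e < G.n := by
  rw [← Fin.val_mk he, srcN_coe]
  exact (G.src _).2

theorem tgtN_lt {e : ℕ} (he : e < G.m) : G.tgtN e < G.n := by
  rw [← Fin.val_mk he, tgtN_coe]
  exact (G.tgt _).2

variable {l : ℕ} (lam : Fin (l + 2) → EReal)

theorem lv_le (v : ℕ) : G.lv lam v ≤ l := idx_le _

theorem wi_le (e : ℕ) : G.wi lam e ≤ l := idx_le _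

variable {lam}

theorem mem_level_iff (hlam : IsThresholds lam) {v : Fin G.n} {i : Fin (l + 1)} :
    v ∈ level G lam i ↔ G.lv lam v = i := by
  unfold lv
  rw [padded_coe]
  exact hlam.hasIndex_iff

theorem hi_le_lv (hlam : IsThresholds lam) {v : ℕ} (hv : v < G.n) : G.hi lam v ≤ G.lv lam v := by
  unfold hi lv
  rw [← Fin.val_mk hv, padded_coe, padded_coe]
  exact hlam.idx_mono (G.h_le_d _)

theorem min_le_lv (hlam : IsThresholds lam) {e : ℕ} (he : e < G.m) :
    min (G.lv lam (G.srcN e)) (G.wi lam e) ≤ G.lv lam (G.tgtN e) := by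
  unfold wi lv
  rw [← Fin.val_mk he, srcN_coe, tgtN_coe, padded_coe, padded_coe, padded_coe]
  rw [← hlam.padded_le_iff (min_le_of_left_le (idx_le _))]
  refine le_trans (le_min ?_ ?_) (G.min_le_d _)
  · exact (hlam.padded_le_iff (min_le_of_left_le (idx_le _))).2 (min_le_left _ _)
  · exact (hlam.padded_le_iff (min_le_of_left_le (idx_le _))).2 (min_le_right _ _)

/-- The reachability principle in terms of indices. It is applied with `S` the set of settled
vertices and `i` the current level. -/
theorem of_le_lv (hlam : IsThresholds lam) {S : ℕ → Prop} {i : ℕ} (hil : i ≤ l)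
    (hh : ∀ v < G.n, i ≤ G.hi lam v → S v)
    (hw : ∀ e < G.m, S (G.srcN e) → i ≤ G.wi lam e → S (G.tgtN e)) {v : ℕ} (hvn : v < G.n)
    (hv : i ≤ G.lv lam v) : S v := by
  have hv' : padded ⊥ lam i ≤ G.d ⟨v, hvn⟩ := by
    rw [hlam.padded_le_iff hil]
    unfold lv at hv
    rw [← Fin.val_mk hvn, padded_coe] at hv
    exact hv
  refine G.mem_of_le_d (S := {v : Fin G.n | S v}) (x := padded ⊥ lam i) ?_ ?_ hv'
  · intro v hv
    refine hh v v.2 ?_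
    unfold hi
    rwa [padded_coe, ← hlam.padded_le_iff hil]
  · intro e he hwe
    have := hw e e.2
    rw [srcN_coe, tgtN_coe] at this
    refine this he ?_
    unfold wi
    rwa [padded_coe, ← hlam.padded_le_iff hil]

theorem lostEdges_eq (hlam : IsThresholds lam) :
    lostEdges G lam = open Classical in ∑ e ∈ Finset.range G.m, if G.Lost lam e then 1 else 0 := by
  classical
  have hset : {e : Fin G.m | ∀ i, e ∉ levelEdges G lam i} =
      ((Finset.univ.filter fun e : Fin G.m => G.Lost lam e : Finset (Fin G.m)) : Set _) := by
    ext e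
    simp only [Set.mem_ofPred_eq, Finset.coe_filter, Finset.mem_univ, true_and]
    unfold Lost
    rw [srcN_coe, tgtN_coe]
    have hw : ∀ i : Fin (l + 1), lam i.castSucc ≤ G.w e ↔ (i : ℕ) ≤ G.wi lam e := by
      intro i
      unfold wi
      rw [padded_coe, ← hlam.padded_le_iff (by omega)]
      unfold padded
      rw [dif_pos (by omega)]
      rfl
    simp only [levelEdges, Set.mem_ofPred_eq, G.mem_level_iff hlam, hw]
    constructor
    · rintro h ⟨h1, h2⟩
      -- Only the level of the source can be the index of an edge set that contains `e`.
      exact h ⟨G.lv lam (G.src e), Nat.lt_succ_of_le (G.lv_le lam _)⟩ ⟨rfl, h1.symm, h2⟩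
    · rintro h i ⟨h1, h2, h3⟩
      exact h ⟨h1.trans h2.symm, h1 ▸ h3⟩
  unfold lostEdges
  rw [hset, Set.ncard_coe_finset, Finset.card_filter, Finset.sum_range]

end Instance

/-! ### Frames -/

/-- The stores agree outside of the word arrays `A`, the key arrays `K` and the registers `R`. -/
structure Frame (A K R : List ℕ) (σ τ : Store) : Prop where
  arr : ∀ a ∉ A, τ.arr a = σ.arr a
  key : ∀ a ∉ K, τ.key a = σ.key a
  reg : ∀ x ∉ R, τ.reg x = σ.reg x

namespace Frame

variable {A K R A' K' R' : List ℕ} {σ τ υ : Store}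

theorem refl (σ : Store) : Frame A K R σ σ :=
  ⟨fun _ _ => rfl, fun _ _ => rfl, fun _ _ => rfl⟩

theorem trans (h : Frame A K R σ τ) (h' : Frame A' K' R' τ υ) (hA : A' ⊆ A) (hK : K' ⊆ K)
    (hR : R' ⊆ R) : Frame A K R σ υ :=
  ⟨fun a ha => (h'.arr a fun i => ha (hA i)).trans (h.arr a ha),
    fun a ha => (h'.key a fun i => ha (hK i)).trans (h.key a ha),
    fun a ha => (h'.reg a fun i => ha (hR i)).trans (h.reg a ha)⟩

theorem setReg (h : Frame A K R σ τ) {x : ℕ} (hx : x ∈ R) (v : ℕ) :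
    Frame A K R σ (τ.setReg x v) := by
  refine ⟨h.arr, h.key, fun y hy => ?_⟩
  rw [Store.setReg_reg, Function.update_of_ne (fun e : y = x => hy (by rwa [e])), h.reg y hy]

theorem setArr (h : Frame A K R σ τ) {a : ℕ} (ha : a ∈ A) (i v : ℕ) :
    Frame A K R σ (τ.setArr a i v) := by
  refine ⟨fun b hb => ?_, h.key, h.reg⟩
  rw [Store.setArr_arr, Function.update_of_ne (fun e : b = a => hb (by rwa [e])), h.arr b hb]

theorem setKey (h : Frame A K R σ τ) {a : ℕ} (ha : a ∈ K) (i : ℕ) (v : EReal) :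
    Frame A K R σ (τ.setKey a i v) := by
  refine ⟨h.arr, fun b hb => ?_, h.reg⟩
  rw [Store.setKey_key, Function.update_of_ne (fun e : b = a => hb (by rwa [e])), h.key b hb]

end Frame

attribute [simp] run_skip run_setReg run_setArr run_copyKey run_seq run_ite WExpr.eval WExpr.cost
  Test.Holds Test.cost

/-! ### The bit length of the number of thresholds -/

/-- Register 3 becomes the bit length of the register 2. -/
def bitLength : Prog :=
  .setReg 10 (.reg 2) ;;
  .loop (.wordLe (.lit 1) (.reg 10))
    (.setReg 10 (.half (.reg 10)) ;; .setReg 3 (.add (.reg 3) (.lit 1)))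

/-- Shows that the bit length itself fits into a word, and later that it is at most `m`. -/
theorem two_mul_two_pow_le {s l : ℕ} (h : 2 ^ s ≤ 2 * l) : s ≤ l := by
  have : s < 2 ^ s := Nat.lt_two_pow_self
  cases s with
  | zero => omega
  | succ s =>
    have : s < 2 ^ s := Nat.lt_two_pow_self
    rw [pow_succ] at h
    omega

theorem run_bitLength {W : ℕ} {σ : Store} (h2 : 1 ≤ σ.reg 2) (h3 : σ.reg 3 = 0)
    (hW : σ.reg 2 ≤ W) :
    Run W bitLength σ fun t τ => Frame [] [] [3, 10] σ τ ∧ σ.reg 2 < 2 ^ τ.reg 3 ∧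
      2 ^ τ.reg 3 ≤ 2 * σ.reg 2 ∧ t ≤ 20 * σ.reg 2 + 5 := by
  simp only [bitLength, run_seq, run_setReg]
  refine ⟨by simpa using hW, ?_⟩
  -- After `c` halvings register 10 holds the quotient of `l` by `2 ^ c`, which the first two
  -- inequalities express. The loop ends when this quotient is 0, that is, when `l < 2 ^ c`.
  refine (run_loop (fun N τ => Frame [] [] [3, 10] σ τ ∧ 2 ^ τ.reg 3 * τ.reg 10 ≤ σ.reg 2 ∧
    σ.reg 2 < 2 ^ τ.reg 3 * (τ.reg 10 + 1) ∧ 2 ^ τ.reg 3 ≤ 2 * σ.reg 2 ∧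
    N = 20 * τ.reg 10) ?_ (N := 20 * σ.reg 2) ?_).mono ?_
  · rintro N τ ⟨hF, h1, h2, h4, rfl⟩ hb
    simp at hb
    have hpow : 2 ^ (τ.reg 3 + 1) = 2 * 2 ^ τ.reg 3 := by rw [pow_succ, mul_comm]
    have hlow : 2 ^ τ.reg 3 ≤ σ.reg 2 := le_trans (Nat.le_mul_of_pos_right _ hb) h1
    have h2' : 2 ^ (τ.reg 3 + 1) ≤ 2 * σ.reg 2 := by omega
    have hs := two_mul_two_pow_le h2'
    have h10 : τ.reg 10 ≤ σ.reg 2 := le_trans (Nat.le_mul_of_pos_left _ (by positivity)) h1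
    simp
    refine ⟨by omega, by omega, ⟨(hF.setReg (by simp) _).setReg (by simp) _, ?_, ?_, by omega⟩,
      by omega⟩
    · rw [hpow, mul_comm 2, mul_assoc]
      exact le_trans (Nat.mul_le_mul_left _ (by omega)) h1
    · rw [hpow, mul_comm 2, mul_assoc]
      exact lt_of_lt_of_le h2 (Nat.mul_le_mul_left _ (by omega))
  · refine ⟨(Frame.refl σ).setReg (by simp) _, ?_⟩
    simp [h3]
    omega
  · rintro t τ ⟨hb, N', ⟨hF, h1, h2, h4, rfl⟩, ht⟩
    simp at hb ht ⊢
    rw [hb] at h2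
    refine ⟨hF, by simpa using h2, h4, by omega⟩

/-! ### Adjacency lists -/

/-- Builds the linked lists of the half-edges of every vertex (next: array 6, heads: array 7, the other
ends: array 8) and of the edges that leave every vertex (next: array 18, heads: array 17). The edge
`e` also becomes an item with the single slot `e`. -/
def buildLists : Prog :=
  .setReg 10 (.lit 0) ;;
  .loop (.wordLe (.add (.reg 10) (.lit 1)) (.reg 1))
    (.setArr 6 (.add (.reg 10) (.reg 10)) (.get 7 (.get 0 (.reg 10))) ;;
    .setArr 7 (.get 0 (.reg 10)) (.add (.add (.reg 10) (.reg 10)) (.lit 1)) ;;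
    .setArr 8 (.add (.reg 10) (.reg 10)) (.get 1 (.reg 10)) ;;
    .setArr 6 (.add (.add (.reg 10) (.reg 10)) (.lit 1)) (.get 7 (.get 1 (.reg 10))) ;;
    .setArr 7 (.get 1 (.reg 10)) (.add (.add (.reg 10) (.reg 10)) (.lit 2)) ;;
    .setArr 8 (.add (.add (.reg 10) (.reg 10)) (.lit 1)) (.get 0 (.reg 10)) ;;
    .setArr 18 (.reg 10) (.get 17 (.get 0 (.reg 10))) ;;
    .setArr 17 (.get 0 (.reg 10)) (.add (.reg 10) (.lit 1)) ;;
    .setArr 11 (.reg 10) (.get 1 (.reg 10)) ;;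
    .copyKey 3 (.reg 10) 0 (.reg 10) ;;
    .setArr 12 (.reg 10) (.reg 10) ;;
    .setArr 13 (.reg 10) (.add (.reg 10) (.lit 1)) ;;
    .setReg 10 (.add (.reg 10) (.lit 1)))

/-! ### Half-edges. -/

namespace Instance

variable (G : Instance)

/-- The start of a half-edge: `2 * e` is the edge `e`, and `2 * e + 1` is its reverse. -/
def hsrc (h : ℕ) : ℕ := if h % 2 = 0 then G.srcN (h / 2) else G.tgtN (h / 2)

/-- The end of a half-edge. -/
def htgt (h : ℕ) : ℕ := if h % 2 = 0 then G.tgtN (h / 2) else G.srcN (h / 2)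

variable {G}

theorem hsrc_even (e : ℕ) : G.hsrc (e + e) = G.srcN e := by
  unfold hsrc
  rw [if_pos (by omega)]
  congr 1
  omega

theorem hsrc_odd (e : ℕ) : G.hsrc (e + e + 1) = G.tgtN e := by
  unfold hsrc
  rw [if_neg (by omega)]
  congr 1
  omega

theorem htgt_even (e : ℕ) : G.htgt (e + e) = G.tgtN e := by
  unfold htgt
  rw [if_pos (by omega)]
  congr 1
  omega

theorem htgt_odd (e : ℕ) : G.htgt (e + e + 1) = G.srcN e := by
  unfold htgt
  rw [if_neg (by omega)]
  congr 1
  omega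

theorem hsrc_lt {h : ℕ} (hh : h < 2 * G.m) : G.hsrc h < G.n := by
  unfold hsrc
  split
  · exact G.srcN_lt (by omega)
  · exact G.tgtN_lt (by omega)

theorem htgt_lt {h : ℕ} (hh : h < 2 * G.m) : G.htgt h < G.n := by
  unfold htgt
  split
  · exact G.tgtN_lt (by omega)
  · exact G.srcN_lt (by omega)

end Instance

/-! ### Fibres of a map as families of lists. -/

/-- `L j` lists the `x < N` with `f x = j`, each of them once. -/
structure Fibers (n N : ℕ) (f : ℕ → ℕ) (L : ℕ → List ℕ) : Prop where
  mem_iff : ∀ j x, x ∈ L j ↔ x < N ∧ f x = j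
  nodup : ∀ j, (L j).Nodup
  weight_eq : ∀ φ, weight n φ L = ∑ x ∈ Finset.range N, φ (f x) x

theorem Fibers.nil (n : ℕ) (f : ℕ → ℕ) : Fibers n 0 f fun _ => [] :=
  ⟨by simp, by simp, by simp [weight_nil]⟩

theorem Fibers.push {n N : ℕ} {f : ℕ → ℕ} {L : ℕ → List ℕ} (h : Fibers n N f L) (hN : f N < n) :
    Fibers n (N + 1) f (Function.update L (f N) (N :: L (f N))) := by
  constructor
  · intro j x
    by_cases hj : j = f N
    · subst hj
      simp only [Function.update_self, List.mem_cons, h.mem_iff]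
      constructor
      · rintro (rfl | ⟨h1, h2⟩)
        · exact ⟨by omega, rfl⟩
        · exact ⟨by omega, h2⟩
      · rintro ⟨h1, h2⟩
        by_cases hx : x = N
        · exact .inl hx
        · exact .inr ⟨by omega, h2⟩
    · rw [Function.update_of_ne hj, h.mem_iff]
      constructor
      · rintro ⟨h1, h2⟩
        exact ⟨by omega, h2⟩
      · rintro ⟨h1, h2⟩
        have : x ≠ N := fun e => hj (by rw [← h2, e])
        exact ⟨by omega, h2⟩
  · intro j
    by_cases hj : j = f N
    · subst hj
      rw [Function.update_self, List.nodup_cons]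
      refine ⟨fun hmem => ?_, h.nodup _⟩
      have := ((h.mem_iff _ _).1 hmem).1
      omega
    · rw [Function.update_of_ne hj]
      exact h.nodup j
  · intro φ
    rw [weight_push φ L hN, h.weight_eq, Finset.sum_range_succ]

/-- The linked lists and the edge items are complete for the edges `e < k`. -/
structure ListsBuilt (G : Instance) (k : ℕ) (σ : Store) : Prop where
  half : ∃ L, Chains (σ.arr 6) (σ.arr 7) L ∧ Fibers G.n (2 * k) G.hsrc L
  out : ∃ L, Chains (σ.arr 18) (σ.arr 17) L ∧ Fibers G.n k G.srcN L
  other : ∀ h < 2 * k, σ.arr 8 h = G.htgt h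
  vert : ∀ e < k, σ.arr 11 e = G.tgtN e
  lo : ∀ e < k, σ.arr 12 e = e
  hi : ∀ e < k, σ.arr 13 e = e + 1
  key : ∀ e < k, σ.key 3 e = padded ⊥ G.w e

/-- The input data that the program never overwrites. -/
structure Input (G : Instance) {l : ℕ} (lam : Fin (l + 2) → EReal) (σ : Store) : Prop where
  reg0 : σ.reg 0 = G.n
  reg1 : σ.reg 1 = G.m
  reg2 : σ.reg 2 = l
  arr0 : σ.arr 0 = G.srcN
  arr1 : σ.arr 1 = G.tgtN
  key0 : σ.key 0 = padded ⊥ G.w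
  key1 : σ.key 1 = padded ⊥ G.h
  key2 : σ.key 2 = padded ⊥ lam

theorem input_inputStore (G : Instance) {l : ℕ} (lam : Fin (l + 2) → EReal) :
    Input G lam (inputStore G lam) :=
  ⟨rfl, rfl, rfl, rfl, rfl, rfl, rfl, rfl⟩

theorem Input.frame {G : Instance} {l : ℕ} {lam : Fin (l + 2) → EReal} {σ τ : Store}
    {A K R : List ℕ} (h : Input G lam σ) (hF : Frame A K R σ τ) (hA : ∀ a ∈ A, 2 ≤ a)
    (hK : ∀ a ∈ K, 3 ≤ a) (hR : ∀ a ∈ R, 3 ≤ a) : Input G lam τ := by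
  constructor
  · rw [hF.reg 0 fun h => by simpa using hR _ h, h.reg0]
  · rw [hF.reg 1 fun h => by simpa using hR _ h, h.reg1]
  · rw [hF.reg 2 fun h => by simpa using hR _ h, h.reg2]
  · rw [hF.arr 0 fun h => by simpa using hA _ h, h.arr0]
  · rw [hF.arr 1 fun h => by simpa using hA _ h, h.arr1]
  · rw [hF.key 0 fun h => by simpa using hK _ h, h.key0]
  · rw [hF.key 1 fun h => by simpa using hK _ h, h.key1]
  · rw [hF.key 2 fun h => by simpa using hK _ h, h.key2]

theorem run_buildLists {G : Instance} {l : ℕ} {lam : Fin (l + 2) → EReal} {W : ℕ} {σ : Store}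
    (hσ : Input G lam σ) (h7 : σ.arr 7 = fun _ => 0) (h17 : σ.arr 17 = fun _ => 0)
    (hW : G.n + 2 * G.m + 2 ≤ W) :
    Run W buildLists σ fun t τ => Frame [6, 7, 8, 11, 12, 13, 17, 18] [3] [10] σ τ ∧
      ListsBuilt G G.m τ ∧ t ≤ 100 * G.m + 10 := by
  simp only [buildLists, run_seq (P := .setReg _ _), run_setReg]
  refine ⟨by simp, ?_⟩
  refine (run_loop (fun N τ => Frame [6, 7, 8, 11, 12, 13, 17, 18] [3] [10] σ τ ∧
    ListsBuilt G (τ.reg 10) τ ∧ τ.reg 10 ≤ G.m ∧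
    N + 100 * τ.reg 10 = 100 * G.m) ?_ (N := 100 * G.m) ?_).mono ?_
  · rintro N τ ⟨hF, hB, hm, hN⟩ hb
    have hτ : Input G lam τ := hσ.frame hF (by simp) (by simp) (by simp)
    simp [hτ.reg1] at hb
    have hs := G.srcN_lt hb
    have ht := G.tgtN_lt hb
    obtain ⟨L, hL, hLf⟩ := hB.half
    obtain ⟨O, hO, hOf⟩ := hB.out
    generalize hk : τ.reg 10 = k at *
    have p1 := hL.push (x := k + k) (fun j hj => by
      have := ((hLf.mem_iff _ _).1 hj).1
      omega) (G.srcN k)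
    have f1 := hLf.push (by rw [← two_mul] at *; exact Instance.hsrc_lt (by omega))
    rw [two_mul, Instance.hsrc_even] at f1
    -- This push starts from the lists after the first push, so a loop, whose two half-edges start
    -- at the same vertex, needs no special treatment.
    have p2 := p1.push (x := k + k + 1) (fun j hj => by
      have := ((f1.mem_iff _ _).1 hj).1
      omega) (G.tgtN k)
    have f2 := f1.push (Instance.hsrc_lt (by omega))
    rw [Instance.hsrc_odd] at f2
    have p3 := hO.push (x := k) (fun j hj => by
      have := ((hOf.mem_iff _ _).1 hj).1
      omega) (G.srcN k)
    have f3 := hOf.push hs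
    have b1 := (hL (G.srcN k)).le (M := 2 * k) fun x hx => ((hLf.mem_iff _ _).1 hx).1
    have b2 := (p1 (G.tgtN k)).le (M := k + k + 1) fun x hx => ((f1.mem_iff _ _).1 hx).1
    have b3 := (hO (G.srcN k)).le (M := k) fun x hx => ((hOf.mem_iff _ _).1 hx).1
    simp [hk, hτ.arr0, hτ.arr1]
    and_intros
    any_goals omega
    refine ⟨N - 100, ⟨?_, ?_, by omega, by omega⟩, by omega⟩
    · repeat' first
        | exact hF
        | refine Frame.setReg ?_ (by simp) _
        | refine Frame.setArr ?_ (by simp) _ _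
        | refine Frame.setKey ?_ (by simp) _ _
    · constructor
      · refine ⟨_, by simpa using p2, ?_⟩
        have : 2 * (k + 1) = k + k + 1 + 1 := by omega
        rw [this]
        exact f2
      · exact ⟨_, by simpa using p3, f3⟩
      · intro h hh
        simp [Function.update_apply]
        by_cases h1 : h = k + k + 1
        · rw [if_pos h1, h1, Instance.htgt_odd]
        · by_cases h2 : h = k + k
          · rw [if_neg h1, if_pos h2, h2, Instance.htgt_even]
          · rw [if_neg h1, if_neg h2]
            exact hB.other h (by omega)
      · intro e he
        by_cases h1 : e = k
        · simp [h1]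
        · simp [h1, hB.vert e (by omega)]
      · intro e he
        by_cases h1 : e = k
        · simp [h1]
        · simp [h1, hB.lo e (by omega)]
      · intro e he
        by_cases h1 : e = k
        · simp [h1]
        · simp [h1, hB.hi e (by omega)]
      · intro e he
        by_cases h1 : e = k
        · simp [h1, hτ.key0]
        · simp [h1, hB.key e (by omega)]
  · refine ⟨(Frame.refl σ).setReg (by simp) _, ?_, by simp, by simp⟩
    have hnil : ∀ g : ℕ → ℕ, Chains g (fun _ => 0) fun _ => [] := fun g j => rfl
    constructor
    · exact ⟨_, by simpa [h7] using hnil _, by simpa using Fibers.nil _ _⟩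
    · exact ⟨_, by simpa [h17] using hnil _, by simpa using Fibers.nil _ _⟩
    all_goals simp
  · rintro t τ ⟨hb, N', ⟨hF, hB, hm, hN⟩, ht⟩
    have hτ : Input G lam τ := hσ.frame hF (by simp) (by simp) (by simp)
    simp [hτ.reg1] at hb ht ⊢
    obtain h : τ.reg 10 = G.m := by omega
    rw [h] at hB
    exact ⟨hF, hB, by omega⟩

/-! ### A walk through all vertices -/

/-- Depth-first search from the vertex 0 along the half-edges. In each step the vertex on the top of
the stack is appended, with its initial capacity, to the slots. -/
def walk : Prog :=
  .setReg 4 (.reg 1) ;;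
  .setArr 10 (.lit 0) (.lit 0) ;;
  .setReg 13 (.lit 1) ;;
  .setArr 9 (.lit 0) (.lit 1) ;;
  .loop (.wordLe (.lit 1) (.reg 13))
    (.setReg 14 (.get 10 (.sub (.reg 13) (.lit 1))) ;;
    .setArr 11 (.reg 4) (.reg 14) ;;
    .copyKey 3 (.reg 4) 1 (.reg 14) ;;
    .setReg 4 (.add (.reg 4) (.lit 1)) ;;
    .setReg 15 (.get 7 (.reg 14)) ;;
    .ite (.wordLe (.lit 1) (.reg 15))
      (.setArr 7 (.reg 14) (.get 6 (.sub (.reg 15) (.lit 1))) ;;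
      .setReg 16 (.get 8 (.sub (.reg 15) (.lit 1))) ;;
      .ite (.wordLe (.get 9 (.reg 16)) (.lit 0))
        (.setArr 9 (.reg 16) (.lit 1) ;;
        .setArr 10 (.reg 13) (.reg 16) ;;
        .setReg 13 (.add (.reg 13) (.lit 1)))
        .skip)
      (.setReg 13 (.sub (.reg 13) (.lit 1))))

/-- The weight of a half-edge that counts the changes of `c`. -/
def hchange (G : Instance) (c : ℕ → ℕ) (h : ℕ) : ℕ :=
  if c (G.hsrc h) = c (G.htgt h) then 0 else 1

/-- The invariant of the depth-first search; `L v` lists the half-edges at `v` that are still to be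
explored, `S` is the stack, and `E` is the reversed list of the vertices appended so far. -/
structure WalkInv (G : Instance) (c : ℕ → ℕ) (σ τ : Store) (L : ℕ → List ℕ) (S E : List ℕ) :
    Prop where
  frame : Frame [7, 9, 10, 11] [3] [4, 13, 14, 15, 16] σ τ
  edgeVert : ∀ e < G.m, τ.arr 11 e = σ.arr 11 e
  edgeKey : ∀ e < G.m, τ.key 3 e = σ.key 3 e
  chains : Chains (τ.arr 6) (τ.arr 7) L
  mem_list : ∀ v, ∀ h ∈ L v, h < 2 * G.m ∧ G.hsrc h = v
  stack : IsStack (τ.arr 10) S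
  height : τ.reg 13 = S.length
  walk : IsStack (fun i => τ.arr 11 (G.m + i)) E
  length : τ.reg 4 = G.m + E.length
  key : ∀ i < E.length, τ.key 3 (G.m + i) = padded ⊥ G.h (τ.arr 11 (G.m + i))
  mem_stack : ∀ v ∈ S, v < G.n ∧ τ.arr 9 v ≠ 0
  mem_walk : ∀ v ∈ E, v < G.n
  explored : ∀ h < 2 * G.m, h ∈ L (G.hsrc h) ∨ τ.arr 9 (G.hsrc h) ≠ 0 ∧ τ.arr 9 (G.htgt h) ≠ 0
  done : ∀ v, τ.arr 9 v ≠ 0 → v ∈ S ∨ L v = []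
  appended : ∀ v, τ.arr 9 v ≠ 0 → v ∈ E ∨ v ∈ S.take 1
  root : τ.arr 9 0 ≠ 0
  changes_le : changes c (S.take 1 ++ E) + changes c S + 2 * weight G.n (fun _ h => hchange G c h) L
    ≤ 2 * ∑ h ∈ Finset.range (2 * G.m), hchange G c h

/-- The slots of the walk. -/
structure WalkBuilt (G : Instance) (c : ℕ → ℕ) (τ : Store) : Prop where
  le : G.m ≤ τ.reg 4
  length_le : τ.reg 4 ≤ 5 * G.m + 1
  vert_lt : ∀ i, G.m ≤ i → i < τ.reg 4 → τ.arr 11 i < G.n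
  key : ∀ i, G.m ≤ i → i < τ.reg 4 → τ.key 3 i = padded ⊥ G.h (τ.arr 11 i)
  exists_vert : ∀ v < G.n, ∃ i, G.m ≤ i ∧ i < τ.reg 4 ∧ τ.arr 11 i = v
  changes_le : changesOn (fun i => c (τ.arr 11 i)) G.m (τ.reg 4) ≤
    2 * ∑ h ∈ Finset.range (2 * G.m), hchange G c h

theorem changesOn_shift (c : ℕ → ℕ) (m k : ℕ) :
    changesOn c m (m + k) = changesOn (fun i => c (m + i)) 0 k := by
  unfold changesOn
  refine Eq.trans ?_ (Finset.card_map (addLeftEmbedding m))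
  congr 1
  ext i
  simp only [Finset.mem_filter, Finset.mem_Ico, Finset.mem_map, addLeftEmbedding_apply]
  constructor
  · intro ⟨h1, h2⟩
    refine ⟨i - m, ⟨by omega, ?_⟩, by omega⟩
    rwa [← add_assoc, Nat.add_sub_cancel' h1.1]
  · rintro ⟨j, ⟨h1, h2⟩, rfl⟩
    exact ⟨by omega, h2⟩

/-- When the stack is empty, every visited vertex has exhausted its half-edges. The visited set is
then closed under edges in both directions, so by weak connectivity it is everything. -/
theorem WalkInv.built {G : Instance} {c : ℕ → ℕ} {σ τ : Store} {L : ℕ → List ℕ} {E : List ℕ}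
    (h : WalkInv G c σ τ L [] E) (hG : G.WeaklyConnected) (hle : E.length ≤ 4 * G.m + 1) :
    WalkBuilt G c τ := by
  have hlen := h.length
  have hmem := fun v => h.walk.mem_iff (y := v)
  have hvis : ∀ v : Fin G.n, τ.arr 9 v ≠ 0 := by
    have hn : 0 < G.n := by
      obtain ⟨v⟩ := hG.nonempty
      exact v.pos
    have step : ∀ k < 2 * G.m, τ.arr 9 (G.hsrc k) ≠ 0 → τ.arr 9 (G.htgt k) ≠ 0 := by
      intro k hk hv
      have h1 := h.done _ hv
      have h2 := h.explored k hk
      simp only [List.not_mem_nil, false_or] at h1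
      rw [h1, List.mem_nil_iff, false_or] at h2
      exact h2.2
    refine hG.mem_of_closed (S := {v : Fin G.n | τ.arr 9 v ≠ 0}) (u := ⟨0, hn⟩) h.root ?_
    intro e
    have h1 := step (e + e) (by omega)
    have h2 := step (e + e + 1) (by omega)
    rw [Instance.hsrc_even, Instance.htgt_even, G.srcN_coe, G.tgtN_coe] at h1
    rw [Instance.hsrc_odd, Instance.htgt_odd, G.srcN_coe, G.tgtN_coe] at h2
    exact ⟨h1, h2⟩
  constructor
  · omega
  · omega
  · intro i h1 h2
    refine h.mem_walk _ ((hmem _).2 ⟨i - G.m, by omega, ?_⟩)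
    rw [Nat.add_sub_cancel' h1]
  · intro i h1 h2
    have := h.key (i - G.m) (by omega)
    rwa [Nat.add_sub_cancel' h1] at this
  · intro v hv
    have h1 := h.appended v (hvis ⟨v, hv⟩)
    simp only [List.take_nil, List.not_mem_nil, or_false] at h1
    obtain ⟨i, hi, hiv⟩ := (hmem v).1 h1
    exact ⟨G.m + i, by omega, by omega, hiv⟩
  · have h1 := h.changes_le
    simp only [List.take_nil, List.nil_append] at h1
    rw [hlen, changesOn_shift, h.walk.changesOn_eq]
    omega

theorem changes_cons_self (c : ℕ → ℕ) (x : ℕ) (L : List ℕ) :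
    changes c (x :: x :: L) = changes c (x :: L) := by
  simp [changes]

/-! ### The moves of the depth-first search. -/

section WalkSteps

variable {G : Instance} {c : ℕ → ℕ} {σ τ : Store} {L : ℕ → List ℕ} {S E : List ℕ} {x : ℕ}

/-- The bound `changes_le` counts the walk as if the top of the stack were already appended, so
appending it adds no change. -/
theorem WalkInv.append (h : WalkInv G c σ τ L (x :: S) E) (hk : τ.key 1 = padded ⊥ G.h) (q : ℕ) :
    WalkInv G c σ (((((τ.setReg 14 x).setArr 11 (G.m + E.length) x).setKey 3 (G.m + E.length)
      (τ.key 1 x)).setReg 4 (G.m + E.length + 1)).setReg 15 q) L (x :: S) (x :: E) := by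
  have hc := h.changes_le
  constructor
  · repeat' first
      | exact h.frame
      | refine Frame.setReg ?_ (by simp) _
      | refine Frame.setArr ?_ (by simp) _ _
      | refine Frame.setKey ?_ (by simp) _ _
  · intro e he
    simp [h.edgeVert e he, show e ≠ G.m + E.length by omega]
  · intro e he
    simp [h.edgeKey e he, show e ≠ G.m + E.length by omega]
  · simpa using h.chains
  · exact h.mem_list
  · simpa using h.stack
  · simpa using h.height
  · refine (h.walk.push x).congr fun i hi => ?_
    simp [Function.update_apply]
  · simp
    omega
  · intro i hi
    simp only [List.length_cons] at hi
    by_cases hiE : i = E.length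
    · simp [hiE, hk]
    · simpa [hiE] using h.key i (by omega)
  · simpa using h.mem_stack
  · intro v hv
    rcases List.mem_cons.1 hv with rfl | hv
    · exact (h.mem_stack v (by simp)).1
    · exact h.mem_walk v hv
  · simpa using h.explored
  · simpa using h.done
  · intro v hv
    rcases h.appended v (by simpa using hv) with h1 | h1
    · exact .inl (List.mem_cons_of_mem _ h1)
    · exact .inr h1
  · simpa using h.root
  · simpa [changes_cons_self] using hc

theorem WalkInv.explore (h : WalkInv G c σ τ L (x :: S) E) {k : ℕ} {L' : List ℕ}
    (hk : L x = k :: L') (hv : τ.arr 9 (G.htgt k) ≠ 0) (q : ℕ) :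
    WalkInv G c σ ((τ.setArr 7 x (τ.arr 6 k)).setReg 16 q) (Function.update L x L') (x :: S) E := by
  have hx := h.mem_stack x (by simp)
  have hc := h.changes_le
  have hw := weight_pop (fun _ h => hchange G c h) hx.1 hk
  have hch := h.chains x
  rw [hk] at hch
  constructor
  · exact (h.frame.setArr (by simp) _ _).setReg (by simp) _
  · simpa using h.edgeVert
  · simpa using h.edgeKey
  · have := h.chains.pop (j := x) (L' := L') (by
      rw [hch.1]
      exact hch.2)
    rw [hch.1] at this
    simpa using this
  · intro v j hj
    by_cases hvx : v = x
    · subst hvx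
      rw [Function.update_self] at hj
      exact h.mem_list v j (by rw [hk]; exact List.mem_cons_of_mem _ hj)
    · rw [Function.update_of_ne hvx] at hj
      exact h.mem_list v j hj
  · simpa using h.stack
  · simpa using h.height
  · simpa using h.walk
  · simpa using h.length
  · simpa using h.key
  · simpa using h.mem_stack
  · exact h.mem_walk
  · intro j hj
    rcases h.explored j hj with h1 | h1
    · by_cases hvx : G.hsrc j = x
      · rw [hvx, hk] at h1
        rcases List.mem_cons.1 h1 with rfl | h1
        · right
          simpa [hvx] using ⟨hx.2, hv⟩
        · left
          rwa [hvx, Function.update_self]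
      · left
        rwa [Function.update_of_ne hvx]
    · right
      simpa using h1
  · intro v hvis
    rcases h.done v (by simpa using hvis) with h1 | h1
    · exact .inl h1
    · right
      have hvx : v ≠ x := fun e => by simp [← e, h1] at hk
      rwa [Function.update_of_ne hvx]
  · simpa using h.appended
  · simpa using h.root
  · omega

/-- The walk must end in `x`, the old top: this has just been appended, and the edge to the new
vertex then accounts for the next possible change. -/
theorem WalkInv.discover (h : WalkInv G c σ τ L (x :: S) (x :: E)) {k : ℕ} {L' : List ℕ}
    (hk : L x = k :: L') (hv : τ.arr 9 (G.htgt k) = 0) :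
    WalkInv G c σ (((((τ.setArr 7 x (τ.arr 6 k)).setReg 16 (G.htgt k)).setArr 9 (G.htgt k) 1).setArr
      10 (S.length + 1) (G.htgt k)).setReg 13 (S.length + 1 + 1)) (Function.update L x L')
      (G.htgt k :: x :: S) (x :: E) := by
  have hx := h.mem_stack x (by simp)
  have hkx := h.mem_list x k (by simp [hk])
  have hvis : ∀ {v}, τ.arr 9 v ≠ 0 → Function.update (τ.arr 9) (G.htgt k) 1 v ≠ 0 := by
    intro v hv'
    rwa [Function.update_of_ne fun e => hv' (by rw [e, hv])]
  have hvis' : ∀ {v}, v ≠ G.htgt k → Function.update (τ.arr 9) (G.htgt k) 1 v ≠ 0 →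
      τ.arr 9 v ≠ 0 := by
    intro v hvt hv'
    rwa [Function.update_of_ne hvt] at hv'
  have hc := h.changes_le
  have hw := weight_pop (fun _ h => hchange G c h) hx.1 hk
  have hch := h.chains x
  rw [hk] at hch
  constructor
  · repeat' first
      | exact h.frame
      | refine Frame.setReg ?_ (by simp) _
      | refine Frame.setArr ?_ (by simp) _ _
  · simpa using h.edgeVert
  · simpa using h.edgeKey
  · have := h.chains.pop (j := x) (L' := L') (by
      rw [hch.1]
      exact hch.2)
    rw [hch.1] at this
    simpa using this
  · intro v j hj
    by_cases hvx : v = x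
    · subst hvx
      rw [Function.update_self] at hj
      exact h.mem_list v j (by rw [hk]; exact List.mem_cons_of_mem _ hj)
    · rw [Function.update_of_ne hvx] at hj
      exact h.mem_list v j hj
  · simpa using h.stack.push (G.htgt k)
  · simp
  · simpa using h.walk
  · simpa using h.length
  · simpa using h.key
  · intro v hvm
    simp only [Store.setReg_arr, Store.setArr_arr]
    rcases List.mem_cons.1 hvm with rfl | hvm
    · exact ⟨Instance.htgt_lt hkx.1, by simp⟩
    · have := h.mem_stack v hvm
      exact ⟨this.1, by simpa using hvis this.2⟩
  · exact h.mem_walk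
  · intro j hj
    simp only [Store.setReg_arr, Store.setArr_arr]
    rcases h.explored j hj with h1 | h1
    · by_cases hvx : G.hsrc j = x
      · rw [hvx, hk] at h1
        rcases List.mem_cons.1 h1 with rfl | h1
        · right
          rw [hvx]
          exact ⟨by simpa using hvis hx.2, by simp⟩
        · left
          rwa [hvx, Function.update_self]
      · left
        rwa [Function.update_of_ne hvx]
    · right
      exact ⟨by simpa using hvis h1.1, by simpa using hvis h1.2⟩
  · intro v hv'
    by_cases hvt : v = G.htgt k
    · simp [hvt]
    · rcases h.done v (hvis' hvt (by simpa using hv')) with h1 | h1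
      · exact .inl (List.mem_cons_of_mem _ h1)
      · right
        have hvx : v ≠ x := fun e => by simp [← e, h1] at hk
        rwa [Function.update_of_ne hvx]
  · intro v hv'
    by_cases hvt : v = G.htgt k
    · simp [hvt]
    · rcases h.appended v (hvis' hvt (by simpa using hv')) with h1 | h1
      · exact .inl h1
      · simp only [List.take_succ_cons, List.take_zero, List.mem_singleton] at h1
        simp [h1]
  · simpa using hvis h.root
  -- The weight of the half-edge pays twice: for the move to the new vertex, and, through `changes c
  -- S`, for the later return.
  · have h1 : hchange G c k = if c (G.htgt k) = c x then 0 else 1 := by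
      unfold hchange
      rw [hkx.2]
      simp only [eq_comm]
    simp only [List.take_succ_cons, List.take_zero, List.singleton_append, changes] at hc ⊢
    rw [← h1]
    simp only [if_true] at hc
    omega

theorem WalkInv.pop (h : WalkInv G c σ τ L (x :: S) (x :: E)) (hx : τ.arr 7 x = 0) :
    WalkInv G c σ (τ.setReg 13 S.length) L S (x :: E) := by
  have hc := h.changes_le
  have hL : L x = [] := by
    have := h.chains x
    rw [hx] at this
    exact this.eq_nil
  constructor
  · exact h.frame.setReg (by simp) _
  · simpa using h.edgeVert
  · simpa using h.edgeKey
  · simpa using h.chains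
  · exact h.mem_list
  · simpa using h.stack.2
  · simp
  · simpa using h.walk
  · simpa using h.length
  · simpa using h.key
  · exact fun v hv => h.mem_stack v (List.mem_cons_of_mem _ hv)
  · exact h.mem_walk
  · exact h.explored
  · intro v hvis
    rcases h.done v hvis with h1 | h1
    · rcases List.mem_cons.1 h1 with rfl | h1
      · exact .inr hL
      · exact .inl h1
    · exact .inr h1
  · intro v hvis
    rcases h.appended v hvis with h1 | h1
    · exact .inl h1
    · simp only [List.take_succ_cons, List.take_zero, List.mem_singleton] at h1
      simp [h1]
  · exact h.root
  -- The return to the vertex below the top was prepaid in `changes c S`.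
  · cases S with
    | nil =>
      simp [changes] at hc ⊢
      omega
    | cons y S =>
      simp only [List.take_succ_cons, List.take_zero, List.singleton_append, changes] at hc ⊢
      simp only [if_true, eq_comm (a := c x) (b := c y)] at hc
      omega

end WalkSteps

/-- The colouring `c` does not occur in the program. This permits the choice of the still unknown
levels as colours. -/
theorem run_walk {G : Instance} {l : ℕ} {lam : Fin (l + 2) → EReal} {W : ℕ} {σ : Store}
    (hσ : Input G lam σ) (hG : G.WeaklyConnected) (hB : ListsBuilt G G.m σ)
    (h9 : σ.arr 9 = fun _ => 0) (hW : G.n + 5 * G.m + 2 ≤ W) (c : ℕ → ℕ) :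
    Run W walk σ fun t τ => Frame [7, 9, 10, 11] [3] [4, 13, 14, 15, 16] σ τ ∧
      (∀ e < G.m, τ.arr 11 e = σ.arr 11 e) ∧ (∀ e < G.m, τ.key 3 e = σ.key 3 e) ∧
      WalkBuilt G c τ ∧ t ≤ 240 * G.m + 80 := by
  obtain ⟨L₀, hL₀, hf₀⟩ := hB.half
  have hn : 0 < G.n := by
    obtain ⟨v⟩ := hG.nonempty
    exact v.pos
  simp [walk, hσ.reg1]
  and_intros
  any_goals omega
  -- Each iteration appends one vertex. It lowers twice the number of unexplored half-edges plus the
  -- height of the stack by at least 1: a discovery by `2 - 1`, a half-edge to a visited vertex by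
  -- 2, a removal from the stack by 1. This quantity starts at `2 * (2 * m) + 1`.
  refine (run_loop (fun N τ => ∃ L S E, WalkInv G c σ τ L S E ∧
    E.length + 2 * weight G.n (fun _ _ => 1) L + S.length ≤ 4 * G.m + 1 ∧
    N = 60 * (2 * weight G.n (fun _ _ => 1) L + S.length)) ?_
    (N := 60 * (4 * G.m + 1)) ?_).mono ?_
  · rintro N τ ⟨L, S, E, hI, hle, rfl⟩ hb
    have hτ : Input G lam τ := hσ.frame hI.frame (by simp) (by simp) (by simp)
    simp [hI.height] at hb
    obtain ⟨x, S, rfl⟩ : ∃ x S', S = x :: S' := by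
      cases S with
      | nil => simp at hb
      | cons x S => exact ⟨x, S, rfl⟩
    have htop : τ.arr 10 S.length = x := hI.stack.1
    have hx := (hI.mem_stack x (by simp)).1
    have hreg4 := hI.length
    have h7 : τ.arr 7 x ≤ 2 * G.m := (hI.chains x).le fun h hh => (hI.mem_list x h hh).1
    simp only [List.length_cons] at hle
    have hA := hI.append hτ.key1 (τ.arr 7 x)
    simp [hI.height, htop, hreg4]
    and_intros
    any_goals omega
    · intro hp
      obtain ⟨L', hL', hc'⟩ := (hI.chains x).eq_cons hp
      generalize hh : τ.arr 7 x - 1 = h at *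
      have hw := weight_pop (fun _ _ => 1) hx hL'
      have hm := hI.mem_list x h (by simp [hL'])
      have h8 : τ.arr 8 h = G.htgt h := by
        rw [hI.frame.arr 8 (by simp), hB.other h hm.1]
      have h6 : τ.arr 6 h ≤ 2 * G.m :=
        hc'.le fun j hj => (hI.mem_list x j (by rw [hL']; exact List.mem_cons_of_mem _ hj)).1
      have ht := Instance.htgt_lt hm.1
      simp [h8]
      and_intros
      any_goals omega
      · intro hv
        and_intros
        any_goals omega
        refine ⟨_, _, ⟨_, by simpa [hI.height] using hA.discover hL' (by simpa using hv), ?_⟩, ?_⟩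
        · simp only [List.length_cons]
          omega
        · simp only [List.length_cons]
          omega
      · intro hv
        refine ⟨_, _, ⟨_, by simpa using hA.explore hL' (by simpa using hv) _, ?_⟩, ?_⟩
        · simp only [List.length_cons]
          omega
        · simp only [List.length_cons]
          omega
    · intro hp
      and_intros
      any_goals omega
      refine ⟨_, _, ⟨_, by simpa using hA.pop (by simpa using hp), ?_⟩, ?_⟩
      · simp only [List.length_cons]
        omega
      · omega
  · refine ⟨L₀, [0], [], ?_, ?_, ?_⟩
    · constructor
      · repeat' first
          | exact Frame.refl σ
          | refine Frame.setReg ?_ (by simp) _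
          | refine Frame.setArr ?_ (by simp) _ _
      · simp
      · simp
      · simpa using hL₀
      · exact fun v h hh => (hf₀.mem_iff _ _).1 hh
      · simp [IsStack]
      · simp
      · simp [IsStack]
      · simp
      · simp
      · simp [hn]
      · simp
      · exact fun h hh => .inl ((hf₀.mem_iff _ _).2 ⟨hh, rfl⟩)
      · intro v hv
        simp [h9, Function.update_apply] at hv
        simp [hv]
      · intro v hv
        simp [h9, Function.update_apply] at hv
        simp [hv]
      · simp
      · simp [hf₀.weight_eq, changes]
    · simp [hf₀.weight_eq]
      omega
    · simp [hf₀.weight_eq]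
      omega
  · rintro t τ ⟨hb, N', ⟨L, S, E, hI, hle, rfl⟩, ht⟩
    simp [hI.height] at hb
    subst hb
    simp at ht
    exact ⟨hI.frame, hI.edgeVert, hI.edgeKey, hI.built hG (by omega), by omega⟩

/-! ### Blocks of the walk -/

/-- Cuts the slots of the walk into blocks of length `reg 3`; the block `x` becomes the item `x` with
the slots from `arr 12 x` to `arr 13 x`. -/
def cutBlocks : Prog :=
  .setReg 11 (.reg 1) ;;
  .setReg 5 (.reg 1) ;;
  .loop (.wordLe (.add (.reg 11) (.lit 1)) (.reg 4))
    (.setArr 12 (.reg 5) (.reg 11) ;;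
    .setReg 11 (.add (.reg 11) (.reg 3)) ;;
    .setArr 13 (.reg 5) (.sub (.reg 4) (.sub (.reg 4) (.reg 11))) ;;
    .setReg 5 (.add (.reg 5) (.lit 1)))

/-- The items `m ≤ x < k` are consecutive blocks of the slots from `m` to `T`, of length at most
`s`. -/
structure Blocks (m s T k : ℕ) (lo hi : ℕ → ℕ) : Prop where
  le_lo : ∀ x, m ≤ x → x < k → m ≤ lo x
  lo_le : ∀ x, m ≤ x → x < k → lo x ≤ hi x
  hi_le : ∀ x, m ≤ x → x < k → hi x ≤ lo x + s
  hi_le_top : ∀ x, m ≤ x → x < k → hi x ≤ T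
  hi_le_lo : ∀ x y, m ≤ x → x < y → y < k → hi x ≤ lo y

theorem run_cutBlocks {m s T W : ℕ} {σ : Store} (h1 : σ.reg 1 = m) (h3 : σ.reg 3 = s)
    (h4 : σ.reg 4 = T) (hs : 1 ≤ s) (hm : m ≤ T) (hW : T + s + 1 ≤ W) :
    Run W cutBlocks σ fun t τ => Frame [12, 13] [] [5, 11] σ τ ∧ m ≤ τ.reg 5 ∧
      τ.reg 5 ≤ T ∧ (τ.reg 5 - m) * s ≤ T - m + s ∧
      (∀ x < m, τ.arr 12 x = σ.arr 12 x) ∧ (∀ x < m, τ.arr 13 x = σ.arr 13 x) ∧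
      Blocks m s T (τ.reg 5) (τ.arr 12) (τ.arr 13) ∧
      (∀ i, m ≤ i → i < T → ∃ x, m ≤ x ∧ x < τ.reg 5 ∧ τ.arr 12 x ≤ i ∧ i < τ.arr 13 x) ∧
      t ≤ 40 * (T - m) + 20 := by
  simp [cutBlocks, h1]
  refine ⟨by omega, ?_⟩
  -- Register 11 advances by exactly `s` per block, so it can overshoot `T` by at most `s`. The
  -- double truncated subtraction in the program stores the minimum of `T` and register 11 as the
  -- end of the block.
  refine (run_loop (fun N τ => Frame [12, 13] [] [5, 11] σ τ ∧ m ≤ τ.reg 5 ∧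
      τ.reg 5 ≤ τ.reg 11 ∧ (τ.reg 5 ≤ T) ∧ τ.reg 11 = m + (τ.reg 5 - m) * s ∧ τ.reg 11 ≤ T + s ∧
      (∀ x < m, τ.arr 12 x = σ.arr 12 x) ∧ (∀ x < m, τ.arr 13 x = σ.arr 13 x) ∧
      Blocks m s T (τ.reg 5) (τ.arr 12) (τ.arr 13) ∧
      (∀ x, m ≤ x → x < τ.reg 5 → τ.arr 13 x ≤ τ.reg 11) ∧
      (∀ i, m ≤ i → i < T → i < τ.reg 11 →
        ∃ x, m ≤ x ∧ x < τ.reg 5 ∧ τ.arr 12 x ≤ i ∧ i < τ.arr 13 x) ∧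
      N = 40 * (T - τ.reg 11)) ?_ (N := 40 * (T - m)) ?_).mono ?_
  · rintro N τ ⟨hF, i1, i2, i3, i4, i5, i6, i7, i8, i9, i10, rfl⟩ hb
    have hr3 : τ.reg 3 = s := by rw [hF.reg 3 (by simp), h3]
    have hr4 : τ.reg 4 = T := by rw [hF.reg 4 (by simp), h4]
    simp [hr4] at hb
    simp [hr3, hr4]
    generalize τ.reg 5 = y at *
    generalize τ.reg 11 = p at *
    refine ⟨by omega, by omega, by omega, by omega, by omega, by omega, ⟨?_, by omega, by omega,
      by omega, ?_, by omega, ?_, ?_, ?_, ?_, ?_⟩, by omega⟩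
    · repeat' first
        | exact hF
        | refine Frame.setReg ?_ (by simp) _
        | refine Frame.setArr ?_ (by simp) _ _
    · rw [show y + 1 - m = y - m + 1 by omega, Nat.succ_mul]
      omega
    · intro x hx
      rw [Function.update_of_ne (by omega), i6 x hx]
    · intro x hx
      rw [Function.update_of_ne (by omega), i7 x hx]
    · have key : ∀ x, m ≤ x → x < y + 1 → x = y ∨ x ≠ y ∧ x < y := by omega
      constructor
      · intro x h h'
        rcases key x h h' with rfl | ⟨e, h'⟩
        · simp
          omega
        · simpa [e] using i8.le_lo x h h'
      · intro x h h'
        rcases key x h h' with rfl | ⟨e, h'⟩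
        · simp
          omega
        · simpa [e] using i8.lo_le x h h'
      · intro x h h'
        rcases key x h h' with rfl | ⟨e, h'⟩
        · simp
          omega
        · simpa [e] using i8.hi_le x h h'
      · intro x h h'
        rcases key x h h' with rfl | ⟨e, h'⟩
        · simp
        · simpa [e] using i8.hi_le_top x h h'
      · intro x z h h' h''
        have e : x ≠ y := by omega
        rcases key z (by omega) h'' with rfl | ⟨e', h''⟩
        · simpa [e] using i9 x h h'
        · simpa [e, e'] using i8.hi_le_lo x z h h' h''
    · intro x h h'
      by_cases e : x = y
      · simp [e]
        omega
      · have := i9 x h (by omega)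
        simp [e]
        omega
    · intro i h h' h''
      by_cases hi : i < p
      · obtain ⟨x, hx⟩ := i10 i h h' hi
        have e : x ≠ y := by omega
        exact ⟨x, by omega, by omega, by simpa [e] using hx.2.2.1, by simpa [e] using hx.2.2.2⟩
      · refine ⟨y, by omega, by omega, ?_, ?_⟩
        · simp
          omega
        · simp
          omega
  · refine ⟨?_, ?_⟩
    · exact ((Frame.refl σ).setReg (by simp) _).setReg (by simp) _
    · simp
      refine ⟨hm, by omega, ?_, ?_, ?_⟩
      · constructor <;> intros <;> omega
      · intros
        omega
      · intros
        omega
  · rintro t τ ⟨hb, N', ⟨hF, i1, i2, i3, i4, i5, i6, i7, i8, i9, i10, rfl⟩, ht⟩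
    have hr4 : τ.reg 4 = T := by rw [hF.reg 4 (by simp), h4]
    simp [hr4] at hb ht
    refine ⟨hF, i1, i3, by omega, i6, i7, i8, fun i h h' => i10 i h h' (by omega), by omega⟩

/-! ### Insertion of an item into a bucket -/

/-- Register 22 becomes `b + 1`, where `b` is a slot of the item `reg 20` with the largest key among
the slots with unsettled vertices, and `0` if there is no such slot. -/
def findBest : Prog :=
  .setReg 21 (.get 12 (.reg 20)) ;;
  .setReg 22 (.lit 0) ;;
  .loop (.wordLe (.add (.reg 21) (.lit 1)) (.get 13 (.reg 20)))
    (.ite (.conj (.wordLe (.get 16 (.get 11 (.reg 21))) (.lit 0))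
        (.neg (.conj (.wordLe (.lit 1) (.reg 22))
          (.neg (.keyLe 3 (.sub (.reg 22) (.lit 1)) 3 (.reg 21))))))
      (.setReg 22 (.add (.reg 21) (.lit 1)))
      .skip ;;
    .setReg 21 (.add (.reg 21) (.lit 1)))

theorem run_findBest {s W : ℕ} {σ : Store} (hs : 1 ≤ s)
    (hlen : σ.arr 13 (σ.reg 20) ≤ σ.arr 12 (σ.reg 20) + s)
    (hlo : σ.arr 12 (σ.reg 20) ≤ σ.arr 13 (σ.reg 20)) (hW : σ.arr 13 (σ.reg 20) + 1 ≤ W) :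
    Run W findBest σ fun t τ => Frame [] [] [21, 22] σ τ ∧ t ≤ 50 * s ∧
      (τ.reg 22 = 0 ∧ (∀ i, σ.arr 12 (σ.reg 20) ≤ i → i < σ.arr 13 (σ.reg 20) →
          σ.arr 16 (σ.arr 11 i) ≠ 0) ∨
        1 ≤ τ.reg 22 ∧ σ.arr 12 (σ.reg 20) ≤ τ.reg 22 - 1 ∧
          τ.reg 22 - 1 < σ.arr 13 (σ.reg 20) ∧ σ.arr 16 (σ.arr 11 (τ.reg 22 - 1)) = 0 ∧
          ∀ i, σ.arr 12 (σ.reg 20) ≤ i → i < σ.arr 13 (σ.reg 20) → σ.arr 16 (σ.arr 11 i) = 0 →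
            σ.key 3 i ≤ σ.key 3 (τ.reg 22 - 1)) := by
  generalize ha : σ.arr 12 (σ.reg 20) = a at *
  generalize hb : σ.arr 13 (σ.reg 20) = b at *
  simp [findBest, ha]
  refine ⟨by omega, ?_⟩
  refine (run_loop (fun N τ => Frame [] [] [21, 22] σ τ ∧ a ≤ τ.reg 21 ∧ τ.reg 21 ≤ b ∧
      (τ.reg 22 = 0 ∧ (∀ i, a ≤ i → i < τ.reg 21 → σ.arr 16 (σ.arr 11 i) ≠ 0) ∨
        1 ≤ τ.reg 22 ∧ a ≤ τ.reg 22 - 1 ∧ τ.reg 22 - 1 < τ.reg 21 ∧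
          σ.arr 16 (σ.arr 11 (τ.reg 22 - 1)) = 0 ∧
          ∀ i, a ≤ i → i < τ.reg 21 → σ.arr 16 (σ.arr 11 i) = 0 →
            σ.key 3 i ≤ σ.key 3 (τ.reg 22 - 1)) ∧ N = 35 * (b - τ.reg 21))
      ?_ (N := 35 * (b - a)) ?_).mono ?_
  · rintro N τ ⟨hF, i1, i2, i3, rfl⟩ hcond
    have e11 : τ.arr 11 = σ.arr 11 := hF.arr 11 (by simp)
    have e13 : τ.arr 13 = σ.arr 13 := hF.arr 13 (by simp)
    have e16 : τ.arr 16 = σ.arr 16 := hF.arr 16 (by simp)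
    have e3 : τ.key 3 = σ.key 3 := hF.key 3 (by simp)
    have e20 : τ.reg 20 = σ.reg 20 := hF.reg 20 (by simp)
    simp [e13, e20, hb] at hcond
    simp [e11, e16, e3]
    generalize τ.reg 21 = p at *
    generalize τ.reg 22 = q at *
    have hF' : ∀ v, Frame [] [] [21, 22] σ (τ.setReg 21 v) := fun v => hF.setReg (by simp) _
    refine ⟨fun hu hq => ⟨by omega, ⟨?_, by omega, by omega, ?_⟩, by omega⟩,
      fun hu => ⟨by omega, ⟨hF' _, by omega, by omega, ?_⟩, by omega⟩⟩
    · exact (hF.setReg (by simp) _).setReg (by simp) _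
    · refine ⟨i1, hu, fun i h1 h2 h3 => ?_⟩
      by_cases hip : i = p
      · rw [hip]
      · rcases i3 with ⟨h4, h5⟩ | ⟨h4, h5, h6, h7, h8⟩
        · exact absurd h3 (h5 i h1 (by omega))
        · exact (h8 i h1 (by omega) h3).trans (hq h4)
    · rcases i3 with ⟨h4, h5⟩ | ⟨h4, h5, h6, h7, h8⟩
      · left
        refine ⟨h4, fun i h1 h2 => ?_⟩
        by_cases hip : i = p
        · rw [hip]
          intro h0
          have := (hu h0).1
          omega
        · exact h5 i h1 (by omega)
      · right
        refine ⟨h4, h5, by omega, h7, fun i h1 h2 h3 => ?_⟩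
        by_cases hip : i = p
        · rw [hip] at h3 ⊢
          exact (hu h3).2.le
        · exact h8 i h1 (by omega) h3
  · refine ⟨((Frame.refl σ).setReg (by simp) _).setReg (by simp) _, ?_⟩
    simp [hlo]
    intros
    omega
  · rintro t τ ⟨hcond, N', ⟨hF, i1, i2, i3, rfl⟩, ht⟩
    have e13 : τ.arr 13 = σ.arr 13 := hF.arr 13 (by simp)
    have e20 : τ.reg 20 = σ.reg 20 := hF.reg 20 (by simp)
    simp [e13, e20, hb] at hcond
    simp at ht
    have : τ.reg 21 = b := by omega
    rw [this] at i3
    refine ⟨hF, by omega, i3⟩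

/-- Register 23 becomes the index of the key of the slot `reg 22 - 1`. -/
def locate : Prog :=
  .setReg 23 (.lit 0) ;;
  .setReg 24 (.add (.reg 2) (.lit 1)) ;;
  .loop (.wordLe (.add (.reg 23) (.lit 2)) (.reg 24))
    (.setReg 25 (.half (.add (.reg 23) (.reg 24))) ;;
    .ite (.keyLe 2 (.reg 25) 3 (.sub (.reg 22) (.lit 1)))
      (.setReg 23 (.reg 25))
      (.setReg 24 (.reg 25)))

theorem run_locate {s l W : ℕ} {lam : Fin (l + 2) → EReal} (hlam : IsThresholds lam) {σ : Store}
    (hs : 1 ≤ s) (hl : l < 2 ^ s) (h2 : σ.reg 2 = l) (hk : σ.key 2 = padded ⊥ lam)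
    (hW : l + 1 ≤ W) :
    Run W locate σ fun t τ => Frame [] [] [23, 24, 25] σ τ ∧ t ≤ 40 * s ∧
      τ.reg 23 = idx lam (σ.key 3 (σ.reg 22 - 1)) := by
  generalize hx : σ.key 3 (σ.reg 22 - 1) = x at *
  simp [locate, h2]
  refine ⟨by omega, ?_⟩
  -- The interval from register 23 to register 24 contains the index and has length at most `2 ^ q`.
  -- Since `l + 1 ≤ 2 ^ s`, there are at most `s` halvings.
  refine (run_loop (fun N τ => Frame [] [] [23, 24, 25] σ τ ∧ ∃ q, τ.reg 24 ≤ τ.reg 23 + 2 ^ q ∧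
      τ.reg 23 ≤ idx lam x ∧ idx lam x < τ.reg 24 ∧ τ.reg 24 ≤ l + 1 ∧ N = 20 * q)
      ?_ (N := 20 * s) ?_).mono ?_
  · rintro N τ ⟨hF, q, i1, i2, i3, i4, rfl⟩ hcond
    have e2 : τ.key 2 = σ.key 2 := hF.key 2 (by simp)
    have e3 : τ.key 3 = σ.key 3 := hF.key 3 (by simp)
    have e22 : τ.reg 22 = σ.reg 22 := hF.reg 22 (by simp)
    simp at hcond
    obtain ⟨q, rfl⟩ : ∃ q', q = q' + 1 := by
      cases q with
      | zero =>
        simp at i1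
        omega
      | succ q => exact ⟨q, rfl⟩
    rw [pow_succ] at i1
    simp [e2, e3, e22, hx, hk]
    generalize τ.reg 23 = a at *
    generalize τ.reg 24 = b at *
    have hmid : padded ⊥ lam ((a + b) / 2) ≤ x ↔ (a + b) / 2 ≤ idx lam x :=
      hlam.padded_le_iff (by omega)
    refine ⟨by omega, fun h => ⟨by omega, q, ⟨?_, by omega, hmid.1 h, by omega, by omega⟩,
      by omega⟩, fun h => ⟨by omega, q, ⟨?_, by omega, by omega, ?_, by omega⟩, by omega⟩⟩
    · exact (hF.setReg (by simp) _).setReg (by simp) _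
    · exact (hF.setReg (by simp) _).setReg (by simp) _
    · rw [← not_le, ← hmid, not_le]
      exact h
  · refine ⟨((Frame.refl σ).setReg (by simp) _).setReg (by simp) _, s, ?_⟩
    have := idx_le (lam := lam) x
    simp
    omega
  · rintro t τ ⟨hcond, N', ⟨hF, q, i1, i2, i3, i4, rfl⟩, ht⟩
    simp at hcond ht
    exact ⟨hF, by omega, by omega⟩

/-- Inserts the item `reg 20` into the bucket of the index of its largest unsettled key. -/
def insertItem : Prog :=
  findBest ;;
  .ite (.wordLe (.lit 1) (.reg 22))
    (locate ;;
    .setArr 14 (.reg 20) (.get 15 (.reg 23)) ;;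
    .setArr 15 (.reg 23) (.add (.reg 20) (.lit 1)))
    .skip

/-- An item has at most `s` slots and the binary search takes at most `s` rounds. This balance is
the reason for blocks of length `s`. -/
theorem run_insertItem {s l W M : ℕ} {lam : Fin (l + 2) → EReal} (hlam : IsThresholds lam)
    {σ : Store} {B : ℕ → List ℕ} (hs : 1 ≤ s) (hl : l < 2 ^ s) (h2 : σ.reg 2 = l)
    (hk : σ.key 2 = padded ⊥ lam) (hlen : σ.arr 13 (σ.reg 20) ≤ σ.arr 12 (σ.reg 20) + s)
    (hlo : σ.arr 12 (σ.reg 20) ≤ σ.arr 13 (σ.reg 20)) (hW : σ.arr 13 (σ.reg 20) + 1 ≤ W)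
    (hlW : l + 1 ≤ W) (hM : M ≤ W) (hx : σ.reg 20 < M) (hB : Chains (σ.arr 14) (σ.arr 15) B)
    (hBM : ∀ j, ∀ y ∈ B j, y < M) (hxB : ∀ j, σ.reg 20 ∉ B j) :
    Run W insertItem σ fun t τ => Frame [14, 15] [] [21, 22, 23, 24, 25] σ τ ∧ t ≤ 110 * s ∧
      ((∀ i, σ.arr 12 (σ.reg 20) ≤ i → i < σ.arr 13 (σ.reg 20) → σ.arr 16 (σ.arr 11 i) ≠ 0) ∧
          Chains (τ.arr 14) (τ.arr 15) B ∨
        ∃ b, σ.arr 12 (σ.reg 20) ≤ b ∧ b < σ.arr 13 (σ.reg 20) ∧ σ.arr 16 (σ.arr 11 b) = 0 ∧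
          (∀ i, σ.arr 12 (σ.reg 20) ≤ i → i < σ.arr 13 (σ.reg 20) → σ.arr 16 (σ.arr 11 i) = 0 →
            idx lam (σ.key 3 i) ≤ idx lam (σ.key 3 b)) ∧
          Chains (τ.arr 14) (τ.arr 15) (Function.update B (idx lam (σ.key 3 b))
            (σ.reg 20 :: B (idx lam (σ.key 3 b))))) := by
  rw [insertItem, run_seq]
  refine (run_findBest hs hlen hlo hW).mono ?_
  rintro t τ ⟨hF, ht, hbest⟩
  have e14 : τ.arr 14 = σ.arr 14 := hF.arr 14 (by simp)
  have e15 : τ.arr 15 = σ.arr 15 := hF.arr 15 (by simp)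
  have e3 : τ.key 3 = σ.key 3 := hF.key 3 (by simp)
  have e20 : τ.reg 20 = σ.reg 20 := hF.reg 20 (by simp)
  rw [run_ite]
  constructor
  · intro hcond
    simp at hcond
    rcases hbest with ⟨h0, -⟩ | ⟨h0, h1, h3, h4, h5⟩
    · omega
    rw [run_seq]
    refine (run_locate hlam hs hl (by rw [hF.reg 2 (by simp), h2])
      (by rw [hF.key 2 (by simp), hk]) hlW).mono ?_
    rintro t' υ ⟨hF', ht', h23⟩
    rw [e3] at h23
    have f14 : υ.arr 14 = σ.arr 14 := by rw [hF'.arr 14 (by simp), e14]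
    have f15 : υ.arr 15 = σ.arr 15 := by rw [hF'.arr 15 (by simp), e15]
    have f20 : υ.reg 20 = σ.reg 20 := by rw [hF'.reg 20 (by simp), e20]
    have f22 : υ.reg 22 = τ.reg 22 := hF'.reg 22 (by simp)
    have hbd : ∀ j, σ.arr 15 j ≤ M := fun j => (hB j).le (hBM j)
    have := idx_le (lam := lam) (σ.key 3 (τ.reg 22 - 1))
    have := hbd (idx lam (σ.key 3 (τ.reg 22 - 1)))
    simp [f15, f20, h23]
    and_intros
    any_goals omega
    · repeat' first
        | refine Frame.setReg ?_ (by simp) _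
        | refine Frame.setArr ?_ (by simp) _ _
      exact ((Frame.refl σ).trans hF (by simp) (by simp) (by simp)).trans hF' (by simp) (by simp)
        (by simp)
    · right
      refine ⟨τ.reg 22 - 1, h1, h3, h4, fun i h h' h'' => hlam.idx_mono (h5 i h h' h''), ?_⟩
      simpa [f14] using hB.push hxB _
  · intro hcond
    simp at hcond
    rcases hbest with ⟨h0, h1⟩ | ⟨h0, h1, h3, h4, h5⟩
    · simp
      refine ⟨?_, by omega, .inl ⟨h1, by rwa [e14, e15]⟩⟩
      exact (Frame.refl (A := [14, 15]) (K := []) (R := [21, 22, 23, 24, 25]) σ).trans hF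
        (by simp) (by simp) (by simp)
    · omega

/-! ### The data that stay fixed after the preprocessing -/

/-- The items with their slots, and the lists of the edges that leave the vertices. -/
structure Layout where
  s : ℕ
  T : ℕ
  N : ℕ
  vert : ℕ → ℕ
  lo : ℕ → ℕ
  hi : ℕ → ℕ
  key : ℕ → EReal
  out : ℕ → List ℕ

/-- The slot `k` belongs to the item `x`. -/
def Layout.IsSlot (Λ : Layout) (x k : ℕ) : Prop := Λ.lo x ≤ k ∧ k < Λ.hi x

/-- Items `e < m` stand for edges, and the other items are blocks of vertices that cover all
vertices. -/
structure Layout.Valid (Λ : Layout) (G : Instance) {l : ℕ} (lam : Fin (l + 2) → EReal) : Prop where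
  one_le_s : 1 ≤ Λ.s
  lt_pow : l < 2 ^ Λ.s
  m_le : G.m ≤ Λ.N
  lo_le : ∀ x < Λ.N, Λ.lo x ≤ Λ.hi x
  hi_le : ∀ x < Λ.N, Λ.hi x ≤ Λ.lo x + Λ.s
  hi_le_top : ∀ x < Λ.N, Λ.hi x ≤ Λ.T
  vert_lt : ∀ x < Λ.N, ∀ k, Λ.IsSlot x k → Λ.vert k < G.n
  edge_lo : ∀ e < G.m, Λ.lo e = e
  edge_hi : ∀ e < G.m, Λ.hi e = e + 1
  edge_vert : ∀ e < G.m, Λ.vert e = G.tgtN e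
  edge_key : ∀ e < G.m, Λ.key e = padded ⊥ G.w e
  block_key : ∀ x < Λ.N, G.m ≤ x → ∀ k, Λ.IsSlot x k → Λ.key k = padded ⊥ G.h (Λ.vert k)
  cover : ∀ v < G.n, ∃ x < Λ.N, G.m ≤ x ∧ ∃ k, Λ.IsSlot x k ∧ Λ.vert k = v
  out : Fibers G.n G.m G.srcN Λ.out

/-- The store holds the input and the layout. -/
structure Ready (Λ : Layout) (G : Instance) {l : ℕ} (lam : Fin (l + 2) → EReal) (σ : Store) :
    Prop where
  input : Input G lam σ
  vert : σ.arr 11 = Λ.vert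
  lo : σ.arr 12 = Λ.lo
  hi : σ.arr 13 = Λ.hi
  key : σ.key 3 = Λ.key
  out : Chains (σ.arr 18) (σ.arr 17) Λ.out

section

variable {Λ : Layout} {G : Instance} {l : ℕ} {lam : Fin (l + 2) → EReal} {σ τ υ : Store}

theorem Ready.frame (h : Ready Λ G lam σ) {A R : List ℕ} (hF : Frame A [] R σ τ)
    (hA : ∀ a ∈ A, a ∈ [2, 3, 4, 5, 14, 15, 16]) (hR : ∀ a ∈ R, 3 ≤ a) : Ready Λ G lam τ := by
  refine ⟨h.input.frame hF ?_ (by simp) hR, ?_, ?_, ?_, ?_, ?_⟩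
  · intro a ha
    have := hA a ha
    simp at this
    omega
  · rw [hF.arr 11 fun h => by simpa using hA _ h, h.vert]
  · rw [hF.arr 12 fun h => by simpa using hA _ h, h.lo]
  · rw [hF.arr 13 fun h => by simpa using hA _ h, h.hi]
  · rw [hF.key 3 (by simp), h.key]
  · rw [hF.arr 18 fun h => by simpa using hA _ h, hF.arr 17 fun h => by simpa using hA _ h]
    exact h.out

/-! ### Settled vertices -/

/-- The cells `0, …, reg 6 - 1` of the array 3 list the vertices that are settled so far; these are
all the vertices above level `i` and some vertices of level `i`. -/
structure Queue (G : Instance) {l : ℕ} (lam : Fin (l + 2) → EReal) (i : ℕ) (σ : Store) : Prop where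
  inj : ∀ j < σ.reg 6, ∀ k < σ.reg 6, σ.arr 3 j = σ.arr 3 k → j = k
  lt : ∀ j < σ.reg 6, σ.arr 3 j < G.n
  settled_iff : ∀ v, σ.arr 16 v ≠ 0 ↔ ∃ j < σ.reg 6, σ.arr 3 j = v
  label : ∀ v, σ.arr 16 v ≠ 0 → σ.arr 2 v = G.lv lam v
  le_lv : ∀ v, σ.arr 16 v ≠ 0 → i ≤ G.lv lam v
  above : ∀ v < G.n, i < G.lv lam v → σ.arr 16 v ≠ 0

theorem Queue.congr {i : ℕ} (h : Queue G lam i σ) (h2 : τ.arr 2 = σ.arr 2) (h3 : τ.arr 3 = σ.arr 3)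
    (h16 : τ.arr 16 = σ.arr 16) (h6 : τ.reg 6 = σ.reg 6) : Queue G lam i τ := by
  constructor
  · rw [h6, h3]
    exact h.inj
  · rw [h6, h3]
    exact h.lt
  · rw [h6, h3, h16]
    exact h.settled_iff
  · rw [h16, h2]
    exact h.label
  · rw [h16]
    exact h.le_lv
  · rw [h16]
    exact h.above

theorem Queue.length_le {i : ℕ} (h : Queue G lam i σ) : σ.reg 6 ≤ G.n := by
  have := Finset.card_le_card_of_injOn (s := Finset.range (σ.reg 6)) (t := Finset.range G.n)
    (σ.arr 3) (fun j hj => by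
      have := h.lt j (by simpa using hj)
      simpa using this)
    (fun j hj k hk => h.inj j (by simpa using hj) k (by simpa using hk))
  simpa using this

theorem Queue.length_lt {i v : ℕ} (h : Queue G lam i σ) (hv : v < G.n) (hu : σ.arr 16 v = 0) :
    σ.reg 6 < G.n := by
  have := Finset.card_le_card_of_injOn (s := Finset.range (σ.reg 6)) (t := (Finset.range G.n).erase v)
    (σ.arr 3) (fun j hj => by
      have hj' : j < σ.reg 6 := by simpa using hj
      have := h.lt j hj'
      have hne : σ.arr 3 j ≠ v := fun e => (h.settled_iff v).2 ⟨j, hj', e⟩ hu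
      simpa [hne] using this)
    (fun j hj k hk => h.inj j (by simpa using hj) k (by simpa using hk))
  rw [Finset.card_erase_of_mem (by simpa using hv)] at this
  simp at this
  omega

/-- More vertices are settled in `τ` than in `σ`. -/
structure Grow (σ τ : Store) : Prop where
  settled : ∀ v, σ.arr 16 v ≠ 0 → τ.arr 16 v ≠ 0
  length_le : σ.reg 6 ≤ τ.reg 6
  queue : ∀ j < σ.reg 6, τ.arr 3 j = σ.arr 3 j

theorem Grow.of_eq (h3 : τ.arr 3 = σ.arr 3) (h16 : τ.arr 16 = σ.arr 16) (h6 : τ.reg 6 = σ.reg 6) :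
    Grow σ τ := by
  refine ⟨?_, h6.ge, ?_⟩
  · rw [h16]
    exact fun _ h => h
  · rw [h3]
    exact fun _ _ => rfl

theorem Grow.trans (h : Grow σ τ) (h' : Grow τ υ) : Grow σ υ :=
  ⟨fun v hv => h'.settled v (h.settled v hv), h.length_le.trans h'.length_le, fun j hj =>
    (h'.queue j (hj.trans_le h.length_le)).trans (h.queue j hj)⟩

/-- Settles the vertex `e` on the current level `reg 8`. -/
def settle (e : WExpr) : Prog :=
  .setReg 26 e ;;
  .setArr 16 (.reg 26) (.lit 1) ;;
  .setArr 2 (.reg 26) (.reg 8) ;;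
  .setArr 3 (.reg 6) (.reg 26) ;;
  .setReg 6 (.add (.reg 6) (.lit 1))

/-- All vertices above level `i` are settled already, so an unsettled vertex of level at least `i`
has level exactly `i`, and the label written is correct. -/
theorem run_settle {i W : ℕ} {e : WExpr} (h : Queue G lam i σ) (h8 : σ.reg 8 = i)
    (hv : e.eval σ < G.n) (hu : σ.arr 16 (e.eval σ) = 0) (hi : i ≤ G.lv lam (e.eval σ))
    (hn : G.n ≤ W) (hl : l ≤ W) (h1 : 1 ≤ W) :
    Run W (settle e) σ fun t τ => t ≤ e.cost + 20 ∧ Frame [2, 3, 16] [] [6, 26] σ τ ∧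
      Queue G lam i τ ∧ τ.arr 16 (e.eval σ) ≠ 0 ∧ Grow σ τ := by
  have hlt := h.length_lt hv hu
  have hlv : G.lv lam (e.eval σ) = i := by
    refine le_antisymm ?_ hi
    by_contra hcon
    exact h.above _ hv (by omega) hu
  have hil := G.lv_le lam (e.eval σ)
  generalize he : e.eval σ = v at *
  simp [settle, he, h8]
  refine ⟨by omega, by omega, by omega, by omega, by omega, by omega, by omega, ?_, ?_, ?_⟩
  · repeat' first
      | exact Frame.refl σ
      | refine Frame.setReg ?_ (by simp) _
      | refine Frame.setArr ?_ (by simp) _ _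
  · have hnew : ∀ j < σ.reg 6, σ.arr 3 j ≠ v := fun j hj e => (h.settled_iff v).2 ⟨j, hj, e⟩ hu
    constructor
    · intro j hj k hk
      simp at hj hk
      rcases Nat.lt_or_eq_of_le hj with hj' | rfl <;>
        rcases Nat.lt_or_eq_of_le hk with hk' | rfl
      · simpa [hj'.ne, hk'.ne] using h.inj j hj' k hk'
      · simpa [hj'.ne] using hnew j hj'
      · simpa [hk'.ne] using fun e => (hnew k hk' e.symm).elim
      · simp
    · intro j hj
      simp at hj
      rcases Nat.lt_or_eq_of_le hj with hj' | rfl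
      · simpa [hj'.ne] using h.lt j hj'
      · simpa using hv
    · intro w
      simp
      by_cases hw : w = v
      · simp [hw]
        exact ⟨σ.reg 6, by omega, by simp⟩
      · have := h.settled_iff w
        simp [hw, this]
        constructor
        · rintro ⟨j, hj, hjw⟩
          exact ⟨j, by omega, by simpa [hj.ne] using hjw⟩
        · rintro ⟨j, hj, hjw⟩
          rcases Nat.lt_or_eq_of_le hj with hj' | rfl
          · exact ⟨j, hj', by simpa [hj'.ne] using hjw⟩
          · simp at hjw
            exact absurd hjw.symm hw
    · intro w
      by_cases hw : w = v
      · simp [hw, hlv]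
      · simpa [hw] using h.label w
    · intro w
      by_cases hw : w = v
      · simp [hw, hlv]
      · simpa [hw] using h.le_lv w
    · intro w
      by_cases hw : w = v
      · simp [hw]
      · simpa [hw] using h.above w
  · constructor
    · intro w
      by_cases hw : w = v
      · simp [hw]
      · simp [hw]
    · simp
    · intro j hj
      simp [hj.ne]

/-! ### Buckets -/

/-- The items `x ∈ D` are live: as long as an item has a slot with an unsettled vertex, it is in one of
the buckets `B j`, and `j` is at least the index of the key of the slot. -/
structure Buckets (Λ : Layout) (G : Instance) {l : ℕ} (lam : Fin (l + 2) → EReal) (D : Set ℕ)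
    (B : ℕ → List ℕ) (σ : Store) : Prop where
  chains : Chains (σ.arr 14) (σ.arr 15) B
  mem : ∀ j, ∀ x ∈ B j, x ∈ D
  lt : ∀ x ∈ D, x < Λ.N
  nodup : ∀ j, (B j).Nodup
  disjoint : ∀ j j' x, x ∈ B j → x ∈ B j' → j = j'
  live : ∀ x ∈ D, ∀ k, Λ.IsSlot x k → σ.arr 16 (Λ.vert k) = 0 →
    ∃ j, x ∈ B j ∧ idx lam (Λ.key k) ≤ j
  sound : ∀ x ∈ D, ∀ k, Λ.IsSlot x k → idx lam (Λ.key k) ≤ G.lv lam (Λ.vert k)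

/-- Buckets are lazy: settling vertices only weakens the requirement `live`, so no item has to be
moved. -/
theorem Buckets.grow {D : Set ℕ} {B : ℕ → List ℕ} (h : Buckets Λ G lam D B σ)
    (h14 : τ.arr 14 = σ.arr 14) (h15 : τ.arr 15 = σ.arr 15)
    (hs : ∀ v, σ.arr 16 v ≠ 0 → τ.arr 16 v ≠ 0) : Buckets Λ G lam D B τ := by
  refine ⟨by rw [h14, h15]; exact h.chains, h.mem, h.lt, h.nodup, h.disjoint, ?_, h.sound⟩
  intro x hx k hk hu
  refine h.live x hx k hk ?_
  by_contra hne
  exact hs _ hne hu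

/-- The bucket is that of the largest unsettled key, which dominates the indices of all unsettled
slots. An item without unsettled slots goes nowhere, and `live` is vacuous for it. -/
theorem run_insert {W : ℕ} (hΛ : Λ.Valid G lam) (hlam : IsThresholds lam) (hσ : Ready Λ G lam σ)
    {D : Set ℕ} {B : ℕ → List ℕ} (hB : Buckets Λ G lam D B σ) {x : ℕ} (h20 : σ.reg 20 = x)
    (hx : x < Λ.N) (hxD : x ∉ D)
    (hsound : ∀ k, Λ.IsSlot x k → idx lam (Λ.key k) ≤ G.lv lam (Λ.vert k))
    (hW : Λ.N + Λ.T + l + 1 ≤ W) :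
    Run W insertItem σ fun t τ => Frame [14, 15] [] [21, 22, 23, 24, 25] σ τ ∧ t ≤ 110 * Λ.s ∧
      ∃ B', Buckets Λ G lam (insert x D) B' τ ∧ (B' = B ∨ ∃ b, Λ.IsSlot x b ∧
        σ.arr 16 (Λ.vert b) = 0 ∧ B' = Function.update B (idx lam (Λ.key b))
          (x :: B (idx lam (Λ.key b)))) := by
  subst h20
  have h1 := hΛ.hi_le_top _ hx
  have hxB : ∀ j, σ.reg 20 ∉ B j := fun j h => hxD (hB.mem j _ h)
  have hold : ∀ y k, y ∈ insert (σ.reg 20) D → y ≠ σ.reg 20 → Λ.IsSlot y k →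
      σ.arr 16 (Λ.vert k) = 0 → ∃ j, y ∈ B j ∧ idx lam (Λ.key k) ≤ j := by
    intro y k hy hne hk hu
    exact hB.live y (Set.mem_of_mem_insert_of_ne hy hne) k hk hu
  have hsound' : ∀ y ∈ insert (σ.reg 20) D, ∀ k, Λ.IsSlot y k →
      idx lam (Λ.key k) ≤ G.lv lam (Λ.vert k) := by
    rintro y (rfl | hy) k hk
    · exact hsound k hk
    · exact hB.sound y hy k hk
  have hlt : ∀ y ∈ insert (σ.reg 20) D, y < Λ.N := by
    rintro y (rfl | hy)
    · exact hx
    · exact hB.lt y hy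
  refine (run_insertItem (s := Λ.s) (M := Λ.N) hlam hΛ.one_le_s hΛ.lt_pow hσ.input.reg2
    hσ.input.key2 ?_ ?_ ?_ (by omega) (by omega) hx hB.chains
    (fun j y hy => hB.lt y (hB.mem j y hy)) hxB).mono ?_
  · rw [hσ.hi, hσ.lo]
    exact hΛ.hi_le _ hx
  · rw [hσ.hi, hσ.lo]
    exact hΛ.lo_le _ hx
  · rw [hσ.hi]
    omega
  rintro t τ ⟨hF, ht, h⟩
  have e16 : τ.arr 16 = σ.arr 16 := hF.arr 16 (by simp)
  rw [hσ.hi, hσ.lo, hσ.vert, hσ.key] at h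
  refine ⟨hF, ht, ?_⟩
  rcases h with ⟨hall, hc⟩ | ⟨b, hb1, hb2, hu, hmax, hc⟩
  · refine ⟨B, ⟨hc, fun j y hy => Set.mem_insert_of_mem _ (hB.mem j y hy), hlt, hB.nodup,
      hB.disjoint, ?_, hsound'⟩, .inl rfl⟩
    intro y hy k hk hu
    rw [e16] at hu
    by_cases hne : y = σ.reg 20
    · subst hne
      exact absurd hu (hall k hk.1 hk.2)
    · exact hold y k hy hne hk hu
  · generalize hj : idx lam (Λ.key b) = j at *
    refine ⟨_, ⟨hc, ?_, hlt, ?_, ?_, ?_, hsound'⟩, .inr ⟨b, ⟨hb1, hb2⟩, hu, by rw [hj]⟩⟩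
    · intro j' y hy
      by_cases hjj : j' = j
      · subst hjj
        rw [Function.update_self] at hy
        rcases List.mem_cons.1 hy with rfl | hy
        · exact Set.mem_insert _ _
        · exact Set.mem_insert_of_mem _ (hB.mem _ _ hy)
      · rw [Function.update_of_ne hjj] at hy
        exact Set.mem_insert_of_mem _ (hB.mem _ _ hy)
    · intro j'
      by_cases hjj : j' = j
      · subst hjj
        rw [Function.update_self]
        exact List.nodup_cons.2 ⟨hxB _, hB.nodup _⟩
      · rw [Function.update_of_ne hjj]
        exact hB.nodup _
    · intro j₁ j₂ y h₁ h₂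
      have key : ∀ j', y ∈ Function.update B j (σ.reg 20 :: B j) j' →
          (y = σ.reg 20 ∧ j' = j) ∨ y ∈ B j' := by
        intro j' hy
        by_cases hjj : j' = j
        · subst hjj
          rw [Function.update_self] at hy
          rcases List.mem_cons.1 hy with rfl | hy
          · exact .inl ⟨rfl, rfl⟩
          · exact .inr hy
        · rw [Function.update_of_ne hjj] at hy
          exact .inr hy
      rcases key _ h₁ with ⟨h3, h4⟩ | g₁ <;> rcases key _ h₂ with ⟨h5, h6⟩ | g₂
      · exact h4.trans h6.symm
      · exact absurd (h3 ▸ g₂) (hxB _)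
      · exact absurd (h5 ▸ g₁) (hxB _)
      · exact hB.disjoint _ _ _ g₁ g₂
    · intro y hy k hk hu'
      rw [e16] at hu'
      by_cases hne : y = σ.reg 20
      · subst hne
        exact ⟨j, by simp, hmax k hk.1 hk.2 hu'⟩
      · obtain ⟨j', h1, h2⟩ := hold y k hy hne hk hu'
        refine ⟨j', ?_, h2⟩
        by_cases hjj : j' = j
        · subst hjj
          rw [Function.update_self]
          exact List.mem_cons_of_mem _ h1
        · rwa [Function.update_of_ne hjj]

end

section

variable {Λ : Layout} {G : Instance} {l : ℕ} {lam : Fin (l + 2) → EReal} {σ τ υ : Store}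

/-! ### Scanning the items of a bucket -/

/-- Settles the vertices of the slots of the item `reg 28 - 1` whose keys are at least the threshold
of the current level. -/
def scanItem : Prog :=
  .setReg 21 (.get 12 (.sub (.reg 28) (.lit 1))) ;;
  .loop (.wordLe (.add (.reg 21) (.lit 1)) (.get 13 (.sub (.reg 28) (.lit 1))))
    (.ite (.conj (.wordLe (.get 16 (.get 11 (.reg 21))) (.lit 0)) (.keyLe 2 (.reg 8) 3 (.reg 21)))
      (settle (.get 11 (.reg 21)))
      .skip ;;
    .setReg 21 (.add (.reg 21) (.lit 1)))

theorem Grow.refl (σ : Store) : Grow σ σ := .of_eq rfl rfl rfl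

/-- By `hsound`, a key that reaches `λ_i` certifies that its vertex has level at least `i`, as
settling requires. -/
theorem run_scanItem {i W x : ℕ} (hΛ : Λ.Valid G lam) (hlam : IsThresholds lam)
    (hσ : Ready Λ G lam σ) (hQ : Queue G lam i σ) (h8 : σ.reg 8 = i) (hi : i ≤ l)
    (h28 : σ.reg 28 = x + 1) (hx : x < Λ.N)
    (hsound : ∀ k, Λ.IsSlot x k → idx lam (Λ.key k) ≤ G.lv lam (Λ.vert k))
    (hW : Λ.T + G.n + l + 1 ≤ W) :
    Run W scanItem σ fun t τ => Frame [2, 3, 16] [] [6, 21, 26] σ τ ∧ t ≤ 80 * Λ.s ∧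
      Queue G lam i τ ∧ Grow σ τ ∧
      ∀ k, Λ.IsSlot x k → i ≤ idx lam (Λ.key k) → τ.arr 16 (Λ.vert k) ≠ 0 := by
  have hs := hΛ.one_le_s
  have b1 := hΛ.lo_le x hx
  have b2 := hΛ.hi_le x hx
  have b3 := hΛ.hi_le_top x hx
  simp [scanItem, h28, hσ.lo]
  refine ⟨by omega, ?_⟩
  refine (run_loop (fun N τ => Frame [2, 3, 16] [] [6, 21, 26] σ τ ∧ Queue G lam i τ ∧ Grow σ τ ∧
    Λ.lo x ≤ τ.reg 21 ∧ τ.reg 21 ≤ Λ.hi x ∧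
    (∀ k, Λ.lo x ≤ k → k < τ.reg 21 → i ≤ idx lam (Λ.key k) → τ.arr 16 (Λ.vert k) ≠ 0) ∧
    N = 60 * (Λ.hi x - τ.reg 21)) ?_ (N := 60 * (Λ.hi x - Λ.lo x)) ?_).mono ?_
  · rintro N τ ⟨hF, hQτ, hG, i1, i2, i3, rfl⟩ hcond
    have hτ := hσ.frame hF (by simp) (by simp)
    have e28 : τ.reg 28 = x + 1 := by rw [hF.reg 28 (by simp), h28]
    have e8 : τ.reg 8 = i := by rw [hF.reg 8 (by simp), h8]
    simp [e28, hτ.hi] at hcond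
    have hslot : Λ.IsSlot x (τ.reg 21) := ⟨i1, by omega⟩
    have hv := hΛ.vert_lt x hx _ hslot
    have hkey : padded ⊥ lam i ≤ Λ.key (τ.reg 21) ↔ i ≤ idx lam (Λ.key (τ.reg 21)) :=
      hlam.padded_le_iff hi
    rw [run_seq, run_ite]
    simp only [Test.Holds, WExpr.eval, hτ.vert, hτ.key, hτ.input.key2, e8, hkey, Test.cost,
      WExpr.cost]
    constructor
    · rintro ⟨hu, hik⟩
      refine (run_settle hQτ e8 (e := .get 11 (.reg 21)) ?_ ?_ ?_ (W := W) (by omega) (by omega)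
        (by omega)).mono ?_
      · simpa [hτ.vert] using hv
      · simpa [hτ.vert] using hu
      · simpa [hτ.vert] using hik.trans (hsound _ hslot)
      · rintro t υ ⟨ht, hF', hQυ, hset, hG'⟩
        simp [hτ.vert] at ht hset
        have f21 : υ.reg 21 = τ.reg 21 := hF'.reg 21 (by simp)
        simp [f21]
        refine ⟨by omega, ⟨?_, ?_, ?_, by omega, by omega, ?_⟩, by omega⟩
        · exact (hF.trans hF' (by simp) (by simp) (by simp)).setReg (by simp) _
        · exact hQυ.congr rfl rfl rfl (by simp)
        · exact (hG.trans hG').trans (.of_eq rfl rfl (by simp))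
        · intro k h1 h2 h3
          rcases Nat.lt_or_eq_of_le h2 with h4 | rfl
          · exact hG'.settled _ (i3 k h1 h4 h3)
          · exact hset
    · intro hneg
      simp
      refine ⟨by omega, ⟨?_, ?_, ?_, by omega, by omega, ?_⟩, by omega⟩
      · exact hF.setReg (by simp) _
      · exact hQτ.congr rfl rfl rfl (by simp)
      · exact hG.trans (.of_eq rfl rfl (by simp))
      · intro k h1 h2 h3
        rcases Nat.lt_or_eq_of_le h2 with h4 | rfl
        · exact i3 k h1 h4 h3
        · exact fun h => hneg ⟨h.le, h3⟩
  · refine ⟨(Frame.refl σ).setReg (by simp) _, hQ.congr rfl rfl rfl (by simp),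
      .of_eq rfl rfl (by simp), by simp, by simpa using b1, ?_, by simp⟩
    intro k h1 h2
    simp at h2
    omega
  · rintro t τ ⟨hcond, N', ⟨hF, hQτ, hG, i1, i2, i3, rfl⟩, ht⟩
    have hτ := hσ.frame hF (by simp) (by simp)
    have e28 : τ.reg 28 = x + 1 := by rw [hF.reg 28 (by simp), h28]
    simp [e28, hτ.hi] at hcond ht
    exact ⟨hF, by omega, hQτ, hG, fun k hk h3 => i3 k hk.1 (by have := hk.2; omega) h3⟩

/-- Scans the items of the bucket of the current level. -/
def scanBucket : Prog :=
  .setReg 28 (.get 15 (.reg 8)) ;;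
  .loop (.wordLe (.lit 1) (.reg 28))
    (scanItem ;; .setReg 28 (.get 14 (.sub (.reg 28) (.lit 1))))

/-- The bucket is read without being emptied: its items stay live until the level is complete and
`reinsert` moves them. -/
theorem run_scanBucket {i W : ℕ} {D : Set ℕ} {B : ℕ → List ℕ} (hΛ : Λ.Valid G lam)
    (hlam : IsThresholds lam) (hσ : Ready Λ G lam σ) (hQ : Queue G lam i σ) (h8 : σ.reg 8 = i)
    (hi : i ≤ l) (hB : Buckets Λ G lam D B σ) (hW : Λ.N + Λ.T + G.n + l + 1 ≤ W) :
    Run W scanBucket σ fun t τ => Frame [2, 3, 16] [] [6, 21, 26, 28] σ τ ∧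
      t ≤ 100 * Λ.s * (B i).length + 10 ∧ Queue G lam i τ ∧ Grow σ τ ∧ Buckets Λ G lam D B τ ∧
      ∀ x ∈ B i, ∀ k, Λ.IsSlot x k → i ≤ idx lam (Λ.key k) → τ.arr 16 (Λ.vert k) ≠ 0 := by
  have hs := hΛ.one_le_s
  have hbd : ∀ (L : List ℕ) (p : ℕ), Chain (σ.arr 14) p L → (∀ x ∈ L, x ∈ B i) → p ≤ Λ.N :=
    fun L p hc hL => hc.le fun x hx => hB.lt x (hB.mem _ x (hL x hx))
  have := hbd _ _ (hB.chains i) fun x hx => hx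
  simp [scanBucket, h8]
  refine ⟨by omega, ?_⟩
  refine (run_loop (fun N τ => ∃ R, Frame [2, 3, 16] [] [6, 21, 26, 28] σ τ ∧ Queue G lam i τ ∧
    Grow σ τ ∧ Chain (σ.arr 14) (τ.reg 28) R ∧ (∀ x ∈ R, x ∈ B i) ∧
    (∀ x ∈ B i, x ∈ R ∨ ∀ k, Λ.IsSlot x k → i ≤ idx lam (Λ.key k) → τ.arr 16 (Λ.vert k) ≠ 0) ∧
    N = 100 * Λ.s * R.length) ?_ (N := 100 * Λ.s * (B i).length) ?_).mono ?_
  · rintro N τ ⟨R, hF, hQτ, hG, hc, i1, i2, rfl⟩ hcond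
    simp at hcond
    obtain ⟨R, rfl, hc'⟩ := hc.eq_cons hcond
    generalize hx : τ.reg 28 - 1 = x at *
    have hxB := i1 x (by simp)
    have hxD := hB.mem _ _ hxB
    have := hbd R _ hc' fun y hy => i1 y (List.mem_cons_of_mem _ hy)
    rw [run_seq]
    refine (run_scanItem hΛ hlam (hσ.frame hF (by simp) (by simp)) hQτ
      (by rw [hF.reg 8 (by simp), h8]) hi (x := x) (by omega) (hB.lt x hxD) (hB.sound x hxD)
      (by omega)).mono ?_
    rintro t υ ⟨hF', ht, hQυ, hG', hset⟩
    have e28 : υ.reg 28 = τ.reg 28 := hF'.reg 28 (by simp)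
    have e14 : υ.arr 14 = σ.arr 14 := by rw [hF'.arr 14 (by simp), hF.arr 14 (by simp)]
    simp [e28, hx, e14]
    refine ⟨by omega, R, ⟨?_, ?_, ?_, hc', ?_, ?_⟩, ?_⟩
    · exact (hF.trans hF' (by simp) (by simp) (by simp)).setReg (by simp) _
    · exact hQυ.congr rfl rfl rfl (by simp)
    · exact (hG.trans hG').trans (.of_eq rfl rfl (by simp))
    · exact fun y hy => i1 y (List.mem_cons_of_mem _ hy)
    · intro y hy
      rcases i2 y hy with h1 | h1
      · rcases List.mem_cons.1 h1 with rfl | h1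
        · exact .inr hset
        · exact .inl h1
      · exact .inr fun k h2 h3 => hG'.settled _ (h1 k h2 h3)
    · rw [mul_add]
      omega
  · refine ⟨B i, (Frame.refl σ).setReg (by simp) _, hQ.congr rfl rfl rfl (by simp),
      .of_eq rfl rfl (by simp), by simpa using hB.chains i, fun x hx => hx, fun x hx => .inl hx,
      rfl⟩
  · rintro t τ ⟨hcond, N', ⟨R, hF, hQτ, hG, hc, i1, i2, rfl⟩, ht⟩
    simp at hcond ht
    rw [hcond] at hc
    obtain rfl := hc.eq_nil
    refine ⟨hF, by omega, hQτ, hG, hB.grow (hF.arr 14 (by simp)) (hF.arr 15 (by simp)) hG.settled,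
      fun x hx => ?_⟩
    simpa using i2 x hx

/-! ### Breadth-first search on a level -/

/-- The credit of an item in a bucket: 1 more than the number of levels below the bucket to which
vertices of the item belong. -/
noncomputable def credit (Λ : Layout) (G : Instance) {l : ℕ} (lam : Fin (l + 2) → EReal)
    (j x : ℕ) : ℕ :=
  1 + (((Finset.Ico (Λ.lo x) (Λ.hi x)).image fun k => G.lv lam (Λ.vert k)).filter (· < j)).card

/-- 1 for lost edges, and 0 for the other edges. -/
noncomputable def lostCount (G : Instance) {l : ℕ} (lam : Fin (l + 2) → EReal) (e : ℕ) : ℕ :=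
  open Classical in if G.Lost lam e then 1 else 0

/-- The item of an edge has a single slot, hence at most one level. -/
theorem credit_edge_le (hΛ : Λ.Valid G lam) {e : ℕ} (he : e < G.m) (j : ℕ) :
    credit Λ G lam j e ≤ 2 := by
  unfold credit
  rw [hΛ.edge_lo e he, hΛ.edge_hi e he]
  have h1 := Finset.card_filter_le ((Finset.Ico e (e + 1)).image fun k => G.lv lam (Λ.vert k))
    (· < j)
  have h2 := Finset.card_image_le (s := Finset.Ico e (e + 1)) (f := fun k => G.lv lam (Λ.vert k))
  simp only [Nat.card_Ico] at h2
  omega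

/-- The invariant of the search on the level `i`. The edges that leave the vertices in `Z` are
scanned, except for those in `R`. -/
structure Search (Λ : Layout) (G : Instance) {l : ℕ} (lam : Fin (l + 2) → EReal) (i : ℕ)
    (Z D : Set ℕ) (B : ℕ → List ℕ) (R : List ℕ) (σ : Store) : Prop where
  ready : Ready Λ G lam σ
  queue : Queue G lam i σ
  level : σ.reg 8 = i
  buckets : Buckets Λ G lam D B σ
  le : ∀ j, ∀ x ∈ B j, j ≤ i
  done : ∀ x ∈ B i, ∀ k, Λ.IsSlot x k → i ≤ idx lam (Λ.key k) → σ.arr 16 (Λ.vert k) ≠ 0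
  pos_le : σ.reg 7 ≤ σ.reg 6
  scanned : ∀ u, u ∈ Z ↔ ∃ j < σ.reg 7, σ.arr 3 j = u
  src_mem : ∀ e ∈ D, e < G.m → G.srcN e ∈ Z
  blocks : ∀ x < Λ.N, G.m ≤ x → x ∈ D
  edges : ∀ e < G.m, G.srcN e ∈ Z → e ∈ R ∨ σ.arr 16 (G.tgtN e) ≠ 0 ∨ e ∈ D

/-- A slot of a live item that is unsettled and has key index at least `i` would lie in a bucket `j
≥ i`. No bucket above `i` is occupied, and bucket `i` has been scanned. This covers initial
capacities through the blocks and postponed edges through their items. The remaining edges out of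
settled vertices have settled targets, so reachability finishes the argument. -/
theorem Search.complete {i : ℕ} {Z D : Set ℕ} {B : ℕ → List ℕ} (h : Search Λ G lam i Z D B [] σ)
    (hΛ : Λ.Valid G lam) (hlam : IsThresholds lam) (hi : i ≤ l) (hpos : σ.reg 6 ≤ σ.reg 7) {v : ℕ}
    (hv : v < G.n) (hiv : i ≤ G.lv lam v) : σ.arr 16 v ≠ 0 := by
  have hlive : ∀ x ∈ D, ∀ k, Λ.IsSlot x k → i ≤ idx lam (Λ.key k) →
      σ.arr 16 (Λ.vert k) ≠ 0 := by
    intro x hx k hk hik hu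
    obtain ⟨j, hj, hij⟩ := h.buckets.live x hx k hk hu
    obtain rfl : j = i := le_antisymm (h.le j x hj) (hik.trans hij)
    exact h.done x hj k hk hik hu
  refine G.of_le_lv hlam (S := fun v => σ.arr 16 v ≠ 0) hi ?_ ?_ hv hiv
  · intro v hv hiv
    obtain ⟨x, hx, hmx, k, hk, rfl⟩ := hΛ.cover v hv
    refine hlive x (h.blocks x hx hmx) k hk ?_
    rwa [hΛ.block_key x hx hmx k hk]
  · intro e he hse hie
    have hZ : G.srcN e ∈ Z := by
      obtain ⟨j, hj, hje⟩ := (h.queue.settled_iff _).1 hse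
      exact (h.scanned _).2 ⟨j, by omega, hje⟩
    rcases h.edges e he hZ with h1 | h1 | h1
    · simp at h1
    · exact h1
    · rw [← hΛ.edge_vert e he]
      refine hlive e h1 e ⟨(hΛ.edge_lo e he).le, by rw [hΛ.edge_hi e he]; omega⟩ ?_
      rwa [hΛ.edge_key e he]

/-- Scans the list `reg 28` of edges: the target of an edge is settled if the weight is at least the
threshold of the current level, and otherwise the edge is inserted into a bucket. -/
def scanEdges : Prog :=
  .loop (.wordLe (.lit 1) (.reg 28))
    (.setReg 20 (.sub (.reg 28) (.lit 1)) ;;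
    .setReg 28 (.get 18 (.reg 20)) ;;
    .ite (.wordLe (.get 16 (.get 1 (.reg 20))) (.lit 0))
      (.ite (.keyLe 2 (.reg 8) 0 (.reg 20)) (settle (.get 1 (.reg 20))) insertItem)
      .skip)

/-- The cost of scanning an edge. -/
noncomputable def edgeCost (Λ : Layout) (G : Instance) {l : ℕ} (lam : Fin (l + 2) → EReal)
    (e : ℕ) : ℕ :=
  60 + 110 * Λ.s * lostCount G lam e

/-- Common to the three outcomes for an edge: its target is settled now, was settled before, or the
edge becomes a live item. -/
theorem Search.advance {i e : ℕ} {Z D D' : Set ℕ} {B B' : ℕ → List ℕ} {R : List ℕ}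
    (h : Search Λ G lam i Z D B (e :: R) σ) (hr : Ready Λ G lam τ) (hq : Queue G lam i τ)
    (h8 : τ.reg 8 = i) (hb : Buckets Λ G lam D' B' τ) (hle : ∀ j, ∀ x ∈ B' j, j ≤ i)
    (hBi : B' i = B i) (hG : Grow σ τ) (h7 : τ.reg 7 = σ.reg 7) (hD : D ⊆ D')
    (hsrc : ∀ e ∈ D', e < G.m → G.srcN e ∈ Z) (he : τ.arr 16 (G.tgtN e) ≠ 0 ∨ e ∈ D') :
    Search Λ G lam i Z D' B' R τ := by
  refine ⟨hr, hq, h8, hb, hle, ?_, ?_, ?_, hsrc, fun x hx hm => hD (h.blocks x hx hm), ?_⟩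
  · rw [hBi]
    exact fun x hx k hk hik => hG.settled _ (h.done x hx k hk hik)
  · rw [h7]
    exact h.pos_le.trans hG.length_le
  · intro u
    rw [h.scanned, h7]
    refine exists_congr fun j => and_congr_right fun hj => ?_
    rw [hG.queue j (hj.trans_le h.pos_le)]
  · intro e' he' hs
    rcases h.edges e' he' hs with h1 | h1 | h1
    · rcases List.mem_cons.1 h1 with rfl | h1
      · exact .inr he
      · exact .inl h1
    · exact .inr (.inl (hG.settled _ h1))
    · exact .inr (.inr (hD h1))

/-- Only lost edges are ever inserted. Each costs `O(s)` and brings at most 2 units of credit into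
the buckets. -/
theorem run_scanEdges {i W : ℕ} {Z D : Set ℕ} {B : ℕ → List ℕ} {R : List ℕ} (hΛ : Λ.Valid G lam)
    (hlam : IsThresholds lam) (hi : i ≤ l) (h : Search Λ G lam i Z D B R σ)
    (hc : Chain (σ.arr 18) (σ.reg 28) R) (hnd : R.Nodup)
    (hR : ∀ e ∈ R, e < G.m ∧ G.srcN e ∈ Z ∧ e ∉ D) (hW : Λ.N + Λ.T + G.n + l + 1 ≤ W) :
    Run W scanEdges σ fun t τ =>
      Frame [2, 3, 14, 15, 16] [] [6, 20, 21, 22, 23, 24, 25, 26, 28] σ τ ∧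
      t ≤ (R.map (edgeCost Λ G lam)).sum + 3 ∧ Grow σ τ ∧
      ∃ D' B', Search Λ G lam i Z D' B' [] τ ∧ B' i = B i ∧
        weight (l + 1) (credit Λ G lam) B' ≤
          weight (l + 1) (credit Λ G lam) B + 2 * (R.map (lostCount G lam)).sum := by
  refine (run_loop (fun N τ => ∃ R' D' B',
    Frame [2, 3, 14, 15, 16] [] [6, 20, 21, 22, 23, 24, 25, 26, 28] σ τ ∧ Grow σ τ ∧
    Search Λ G lam i Z D' B' R' τ ∧ Chain (σ.arr 18) (τ.reg 28) R' ∧ R'.Nodup ∧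
    (∀ e ∈ R', e < G.m ∧ G.srcN e ∈ Z ∧ e ∉ D') ∧ B' i = B i ∧
    weight (l + 1) (credit Λ G lam) B' + 2 * (R'.map (lostCount G lam)).sum ≤
          weight (l + 1) (credit Λ G lam) B + 2 * (R.map (lostCount G lam)).sum ∧
    N = (R'.map (edgeCost Λ G lam)).sum) ?_ (N := (R.map (edgeCost Λ G lam)).sum) ?_).mono ?_
  · rintro N τ ⟨R', D', B', hF, hG, hS, hc, hnd, hR, hBi, hw, rfl⟩ hcond
    simp at hcond
    obtain ⟨R', rfl, hc'⟩ := hc.eq_cons hcond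
    generalize hx : τ.reg 28 - 1 = e at *
    obtain ⟨hem, hse, heD⟩ := hR e (by simp)
    have hR' : ∀ y ∈ R', y ≠ e ∧ y < G.m ∧ G.srcN y ∈ Z ∧ y ∉ D' := fun y hy =>
      ⟨fun h => (List.nodup_cons.1 hnd).1 (h ▸ hy), hR y (List.mem_cons_of_mem _ hy)⟩
    have hnd' := (List.nodup_cons.1 hnd).2
    have hhead : σ.arr 18 e ≤ G.m := hc'.le fun y hy => (hR' y hy).2.1
    have hmN := hΛ.m_le
    have e18 : τ.arr 18 = σ.arr 18 := hF.arr 18 (by simp)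
    have hlv : i ≤ G.lv lam (G.srcN e) := by
      obtain ⟨j, hj, hje⟩ := (hS.scanned _).1 hse
      have := hS.pos_le
      exact hS.queue.le_lv _ ((hS.queue.settled_iff _).2 ⟨j, by omega, hje⟩)
    have hmin := G.min_le_lv hlam hem
    have hkey : padded ⊥ lam i ≤ padded ⊥ G.w e ↔ i ≤ G.wi lam e := hlam.padded_le_iff hi
    simp only [List.map_cons, List.sum_cons] at hw ⊢
    rw [run_seq, run_setReg, run_seq, run_setReg]
    simp only [WExpr.eval, WExpr.cost, hx, Store.setReg_reg, Store.setReg_arr, e18,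
      Function.update_self]
    refine ⟨by omega, by omega, ?_⟩
    generalize hσ' : (τ.setReg 20 e).setReg 28 (σ.arr 18 e) = σ'
    have hF' : Frame [] [] [20, 28] τ σ' := by
      rw [← hσ']
      exact ((Frame.refl τ).setReg (by simp) _).setReg (by simp) _
    have hr' : Ready Λ G lam σ' := hS.ready.frame hF' (by simp) (by simp)
    have e16 : σ'.arr 16 = τ.arr 16 := hF'.arr 16 (by simp)
    have e3 : σ'.arr 3 = τ.arr 3 := hF'.arr 3 (by simp)
    have e6 : σ'.reg 6 = τ.reg 6 := hF'.reg 6 (by simp)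
    have e7 : σ'.reg 7 = τ.reg 7 := hF'.reg 7 (by simp)
    have e8 : σ'.reg 8 = i := (hF'.reg 8 (by simp)).trans hS.level
    have e20 : σ'.reg 20 = e := by simp [← hσ']
    have e28 : σ'.reg 28 = σ.arr 18 e := by simp [← hσ']
    have hq' : Queue G lam i σ' := hS.queue.congr (hF'.arr 2 (by simp)) e3 e16 e6
    have hG' : Grow τ σ' := .of_eq e3 e16 e6
    have hb' : Buckets Λ G lam D' B' σ' := hS.buckets.grow (hF'.arr 14 (by simp))
      (hF'.arr 15 (by simp)) hG'.settled
    have hFσ : Frame [2, 3, 14, 15, 16] [] [6, 20, 21, 22, 23, 24, 25, 26, 28] σ σ' :=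
      hF.trans hF' (by simp) (by simp) (by simp)
    rw [run_ite]
    simp only [Test.Holds, WExpr.eval, hr'.input.arr1, e20, Test.cost, WExpr.cost]
    constructor
    · intro hu
      rw [run_ite]
      simp only [Test.Holds, WExpr.eval, hr'.input.key0, hr'.input.key2, e20, e8, hkey,
        Test.cost, WExpr.cost]
      constructor
      · intro hie
        have hit : i ≤ G.lv lam (G.tgtN e) := (le_min hlv hie).trans hmin
        have heval : WExpr.eval σ' (.get 1 (.reg 20)) = G.tgtN e := by
          simp [hr'.input.arr1, e20]
        refine (run_settle hq' e8 (e := .get 1 (.reg 20)) (by rw [heval]; exact G.tgtN_lt hem)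
          (by rw [heval]; omega) (by rw [heval]; exact hit) (W := W) (by omega) (by omega)
          (by omega)).mono ?_
        rintro t υ ⟨ht, hF'', hQ, hset, hG''⟩
        rw [heval] at hset
        simp only [WExpr.cost] at ht
        refine ⟨_, ⟨R', D', B', hFσ.trans hF'' (by simp) (by simp) (by simp),
          (hG.trans hG').trans hG'', ?_, ?_, hnd', fun y hy => (hR' y hy).2, hBi, by omega, rfl⟩, ?_⟩
        · exact hS.advance (hr'.frame hF'' (by simp) (by simp)) hQ
            ((hF''.reg 8 (by simp)).trans e8) (hb'.grow (hF''.arr 14 (by simp))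
            (hF''.arr 15 (by simp)) hG''.settled) hS.le rfl (hG'.trans hG'')
            ((hF''.reg 7 (by simp)).trans e7) subset_rfl hS.src_mem (.inl hset)
        · rwa [hF''.reg 28 (by simp), e28]
        · unfold edgeCost
          omega
      · intro hie
        have hslot : ∀ k, Λ.IsSlot e k → k = e := by
          intro k hk
          have h1 := hk.1
          have h2 := hk.2
          rw [hΛ.edge_lo e hem] at h1
          rw [hΛ.edge_hi e hem] at h2
          omega
        have hwi : idx lam (Λ.key e) = G.wi lam e := by
          rw [hΛ.edge_key e hem]
          rfl
        -- The weight index is below `i`, while the level of the source is at least `i`.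
        have hlost : lostCount G lam e = 1 := by
          unfold lostCount
          rw [if_pos]
          unfold Instance.Lost
          omega
        refine (run_insert hΛ hlam hr' hb' e20 (by omega) heD ?_ (by omega)).mono ?_
        -- In `hmin` the minimum is the weight index, as it is smaller than the level of the source.
        · intro k hk
          obtain rfl := hslot k hk
          rw [hwi, hΛ.edge_vert k hem]
          omega
        rintro t υ ⟨hF'', ht, B'', hB'', hor⟩
        have hGυ : Grow σ' υ := .of_eq (hF''.arr 3 (by simp)) (hF''.arr 16 (by simp))
          (hF''.reg 6 (by simp))
        -- The edge lands strictly below bucket `i`, so what was established by scanning bucket `i`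
        -- remains valid.
        have hB3 : (∀ j, ∀ x ∈ B'' j, j ≤ i) ∧ B'' i = B' i ∧
            weight (l + 1) (credit Λ G lam) B'' ≤ weight (l + 1) (credit Λ G lam) B' + 2 := by
          rcases hor with rfl | ⟨b, hb1, hb2, rfl⟩
          · exact ⟨hS.le, rfl, by omega⟩
          · obtain rfl := hslot b hb1
            rw [hwi]
            refine ⟨?_, ?_, ?_⟩
            · intro j x hx
              by_cases hj : j = G.wi lam b
              · omega
              · rw [Function.update_of_ne hj] at hx
                exact hS.le j x hx
            · rw [Function.update_of_ne (by omega)]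
            · rw [weight_push _ _ (show G.wi lam b < l + 1 from Nat.lt_succ_of_le (G.wi_le lam b))]
              have := credit_edge_le hΛ hem (G.wi lam b)
              omega
        refine ⟨_, ⟨R', insert e D', B'', hFσ.trans hF'' (by simp) (by simp) (by simp),
          (hG.trans hG').trans hGυ, ?_, ?_, hnd', ?_, hB3.2.1.trans hBi, by omega, rfl⟩, ?_⟩
        · refine hS.advance (hr'.frame hF'' (by simp) (by simp)) (hq'.congr (hF''.arr 2 (by simp))
            (hF''.arr 3 (by simp)) (hF''.arr 16 (by simp)) (hF''.reg 6 (by simp)))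
            ((hF''.reg 8 (by simp)).trans e8) hB'' hB3.1 hB3.2.1 (hG'.trans hGυ)
            ((hF''.reg 7 (by simp)).trans e7) (Set.subset_insert _ _) ?_ (.inr (Set.mem_insert _ _))
          rintro y (rfl | hy) hym
          · exact hse
          · exact hS.src_mem y hy hym
        · rwa [hF''.reg 28 (by simp), e28]
        · intro y hy
          obtain ⟨h1, h2, h3, h4⟩ := hR' y hy
          refine ⟨h2, h3, ?_⟩
          rintro (h5 | h5)
          · exact h1 h5
          · exact h4 h5
        · unfold edgeCost
          rw [hlost]
          omega
    · intro hu
      rw [run_skip]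
      refine ⟨_, ⟨R', D', B', hFσ, hG.trans hG', ?_, ?_, hnd', fun y hy => (hR' y hy).2, hBi,
        by omega, rfl⟩, ?_⟩
      · exact hS.advance hr' hq' e8 hb' hS.le rfl hG' e7 subset_rfl hS.src_mem
          (.inl (by rw [e16] at hu ⊢; omega))
      · rwa [e28]
      · unfold edgeCost
        omega
  · exact ⟨R, D, B, Frame.refl σ, Grow.refl σ, h, hc, hnd, hR, rfl, le_rfl, rfl⟩
  · rintro t τ ⟨hcond, N', ⟨R', D', B', hF, hG, hS, hc, hnd, hR, hBi, hw, rfl⟩, ht⟩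
    simp at hcond ht
    rw [hcond] at hc
    obtain rfl := hc.eq_nil
    simp at hw
    exact ⟨hF, by omega, hG, D', B', hS, hBi, hw⟩

/-- Breadth-first search: scans the lists of the edges that leave the settled vertices. -/
def search : Prog :=
  .loop (.wordLe (.add (.reg 7) (.lit 1)) (.reg 6))
    (.setReg 28 (.get 17 (.get 3 (.reg 7))) ;;
    .setReg 7 (.add (.reg 7) (.lit 1)) ;;
    scanEdges)

/-- The cost of scanning the edges that leave a vertex. -/
noncomputable def vertexCost (Λ : Layout) (G : Instance) {l : ℕ} (lam : Fin (l + 2) → EReal)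
    (u : ℕ) : ℕ :=
  30 + ((Λ.out u).map (edgeCost Λ G lam)).sum

/-- The number of lost edges that leave a vertex. -/
noncomputable def vertexLost (Λ : Layout) (G : Instance) {l : ℕ} (lam : Fin (l + 2) → EReal)
    (u : ℕ) : ℕ :=
  ((Λ.out u).map (lostCount G lam)).sum

theorem sum_sdiff_insert {n u : ℕ} {Z : Finset ℕ} (φ : ℕ → ℕ) (hu : u < n) (hZ : u ∉ Z) :
    ∑ v ∈ Finset.range n \ insert u Z, φ v + φ u = ∑ v ∈ Finset.range n \ Z, φ v := by
  have h1 : u ∈ Finset.range n \ Z := by simp [hu, hZ]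
  rw [← Finset.sum_erase_add _ _ h1]
  congr 2
  ext v
  simp only [Finset.mem_sdiff, Finset.mem_insert, Finset.mem_erase]
  tauto

/-- Costs and lost edges are charged to vertices as they leave the unscanned set. Both inequalities
telescope over all levels. -/
theorem run_search {i W : ℕ} {Z : Finset ℕ} {D : Set ℕ} {B : ℕ → List ℕ} (hΛ : Λ.Valid G lam)
    (hlam : IsThresholds lam) (hi : i ≤ l) (h : Search Λ G lam i Z D B [] σ)
    (hW : Λ.N + Λ.T + G.n + l + 1 ≤ W) :
    Run W search σ fun t τ =>
      Frame [2, 3, 14, 15, 16] [] [6, 7, 20, 21, 22, 23, 24, 25, 26, 28] σ τ ∧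
      Grow σ τ ∧ τ.reg 6 ≤ τ.reg 7 ∧
      ∃ (Z' : Finset ℕ) (D' : Set ℕ) (B' : ℕ → List ℕ), Search Λ G lam i Z' D' B' [] τ ∧
        B' i = B i ∧
        weight (l + 1) (credit Λ G lam) B' +
            2 * ∑ u ∈ Finset.range G.n \ Z', vertexLost Λ G lam u ≤
          weight (l + 1) (credit Λ G lam) B +
            2 * ∑ u ∈ Finset.range G.n \ Z, vertexLost Λ G lam u ∧
        t + ∑ u ∈ Finset.range G.n \ Z', vertexCost Λ G lam u ≤
          ∑ u ∈ Finset.range G.n \ Z, vertexCost Λ G lam u + 5 := by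
  refine (run_loop (fun N τ => ∃ (Z' : Finset ℕ) (D' : Set ℕ) (B' : ℕ → List ℕ),
      Frame [2, 3, 14, 15, 16] [] [6, 7, 20, 21, 22, 23, 24, 25, 26, 28] σ τ ∧ Grow σ τ ∧
      Search Λ G lam i Z' D' B' [] τ ∧ B' i = B i ∧
      weight (l + 1) (credit Λ G lam) B' +
            2 * ∑ u ∈ Finset.range G.n \ Z', vertexLost Λ G lam u ≤
          weight (l + 1) (credit Λ G lam) B +
            2 * ∑ u ∈ Finset.range G.n \ Z, vertexLost Λ G lam u ∧
      N = ∑ u ∈ Finset.range G.n \ Z', vertexCost Λ G lam u)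
      ?_ (N := ∑ u ∈ Finset.range G.n \ Z, vertexCost Λ G lam u) ?_).mono ?_
  · rintro N τ ⟨Z', D', B', hF, hG, hS, hBi, hw, rfl⟩ hcond
    simp at hcond
    generalize hu : τ.arr 3 (τ.reg 7) = u
    have hun : u < G.n := hu ▸ hS.queue.lt _ hcond
    -- The queue has no repetitions, so every vertex is scanned once, and no edge is inserted twice
    -- by the search.
    have huZ : u ∉ Z' := by
      intro hmem
      obtain ⟨j, hj, hju⟩ := (hS.scanned u).1 hmem
      have := hS.queue.inj j (by omega) _ hcond (hju.trans hu.symm)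
      omega
    have hlen := hS.queue.length_le
    have hout := hS.ready.out u
    have hmem := hΛ.out.mem_iff u
    have hhead : τ.arr 17 u ≤ G.m := hout.le fun e he => ((hmem e).1 he).1
    have hmN := hΛ.m_le
    have s1 := sum_sdiff_insert (vertexCost Λ G lam) hun huZ
    have s2 := sum_sdiff_insert (vertexLost Λ G lam) hun huZ
    rw [run_seq, run_setReg, run_seq, run_setReg]
    simp only [WExpr.eval, WExpr.cost, hu, Store.setReg_reg, Function.update_of_ne (show 7 ≠ 28 by decide)]
    refine ⟨by omega, by omega, ?_⟩
    generalize hσ' : (τ.setReg 28 (τ.arr 17 u)).setReg 7 (τ.reg 7 + 1) = σ'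
    have hF' : Frame [] [] [7, 28] τ σ' := by
      rw [← hσ']
      exact ((Frame.refl τ).setReg (by simp) _).setReg (by simp) _
    have e16 : σ'.arr 16 = τ.arr 16 := hF'.arr 16 (by simp)
    have e3 : σ'.arr 3 = τ.arr 3 := hF'.arr 3 (by simp)
    have e6 : σ'.reg 6 = τ.reg 6 := hF'.reg 6 (by simp)
    have e7 : σ'.reg 7 = τ.reg 7 + 1 := by simp [← hσ']
    have e28 : σ'.reg 28 = τ.arr 17 u := by simp [← hσ']
    have e18 : σ'.arr 18 = τ.arr 18 := hF'.arr 18 (by simp)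
    have hG' : Grow τ σ' := .of_eq e3 e16 e6
    have hS' : Search Λ G lam i (insert u Z' : Finset ℕ) D' B' (Λ.out u) σ' := by
      refine ⟨hS.ready.frame hF' (by simp) (by simp), hS.queue.congr (hF'.arr 2 (by simp)) e3 e16 e6,
        (hF'.reg 8 (by simp)).trans hS.level, hS.buckets.grow (hF'.arr 14 (by simp))
        (hF'.arr 15 (by simp)) hG'.settled, hS.le, ?_, ?_, ?_, ?_, hS.blocks, ?_⟩
      · rw [e16]
        exact hS.done
      · omega
      · intro v
        rw [e7, e3, Finset.coe_insert, Set.mem_insert_iff, hS.scanned]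
        constructor
        · rintro (rfl | ⟨j, hj, hjv⟩)
          · exact ⟨_, by omega, hu⟩
          · exact ⟨j, by omega, hjv⟩
        · rintro ⟨j, hj, hjv⟩
          by_cases hj7 : j = τ.reg 7
          · left
            rw [← hjv, hj7, hu]
          · exact .inr ⟨j, by omega, hjv⟩
      · intro e he hem
        rw [Finset.coe_insert]
        exact Set.mem_insert_of_mem _ (hS.src_mem e he hem)
      · intro e he hs
        rw [Finset.coe_insert] at hs
        rw [e16]
        rcases hs with hs | hs
        · exact .inl ((hmem e).2 ⟨he, hs⟩)
        · rcases hS.edges e he hs with h1 | h1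
          · simp at h1
          · exact .inr h1
    refine (run_scanEdges hΛ hlam hi hS' (by rw [e18, e28]; exact hout) (hΛ.out.nodup u) ?_
      hW).mono ?_
    · intro e he
      obtain ⟨h1, h2⟩ := (hmem e).1 he
      refine ⟨h1, by simp [h2], fun heD => huZ ?_⟩
      have := hS.src_mem e heD h1
      rwa [h2] at this
    · rintro t υ ⟨hF'', ht, hG'', D'', B'', hS'', hBi', hw'⟩
      change _ ≤ _ + 2 * vertexLost Λ G lam u at hw'
      refine ⟨_, ⟨insert u Z', D'', B'', ?_, (hG.trans hG').trans hG'', hS'', hBi'.trans hBi,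
        by omega, rfl⟩, ?_⟩
      · exact (hF.trans hF' (by simp) (by simp) (by simp)).trans hF'' (by simp) (by simp) (by simp)
      · have : vertexCost Λ G lam u = 30 + ((Λ.out u).map (edgeCost Λ G lam)).sum := rfl
        simp only [Test.cost, WExpr.cost]
        omega
  · exact ⟨Z, D, B, Frame.refl σ, Grow.refl σ, h, rfl, le_rfl, rfl⟩
  · rintro t τ ⟨hcond, N', ⟨Z', D', B', hF, hG, hS, hBi, hw, rfl⟩, ht⟩
    simp at hcond ht
    exact ⟨hF, hG, by omega, Z', D', B', hS, hBi, hw, by omega⟩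

end

section

variable {Λ : Layout} {G : Instance} {l : ℕ} {lam : Fin (l + 2) → EReal} {σ τ υ : Store}

/-! ### A complete level -/

/-- The level of the vertex in slot `k` lies below `i` but not below `j`. It is therefore counted in
the credit for `i` and not in the credit for `j`. -/
theorem credit_succ_le {i j x k : ℕ} (hk : Λ.IsSlot x k) (hj : j ≤ G.lv lam (Λ.vert k))
    (hi : G.lv lam (Λ.vert k) < i) : credit Λ G lam j x + 1 ≤ credit Λ G lam i x := by
  unfold credit
  generalize hS : (Finset.Ico (Λ.lo x) (Λ.hi x)).image (fun k => G.lv lam (Λ.vert k)) = S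
  have hc : G.lv lam (Λ.vert k) ∈ S := by
    rw [← hS]
    exact Finset.mem_image.2 ⟨k, Finset.mem_Ico.2 hk, rfl⟩
  have : (S.filter (· < j)).card + 1 ≤ (S.filter (· < i)).card := by
    rw [← Finset.card_insert_of_notMem (a := G.lv lam (Λ.vert k)) (by simp; omega)]
    refine Finset.card_le_card fun c hc' => ?_
    simp only [Finset.mem_insert, Finset.mem_filter] at hc' ⊢
    rcases hc' with rfl | hc'
    · exact ⟨hc, hi⟩
    · exact ⟨hc'.1, by omega⟩
  omega

/-- The removed item also leaves the set of live items; its reinsertion puts it back. -/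
theorem Buckets.pop {D : Set ℕ} {B : ℕ → List ℕ} (h : Buckets Λ G lam D B σ) {i x : ℕ}
    {L : List ℕ} (hL : B i = x :: L) (h14 : τ.arr 14 = σ.arr 14)
    (h15 : τ.arr 15 = Function.update (σ.arr 15) i (σ.arr 14 x)) (h16 : τ.arr 16 = σ.arr 16) :
    Buckets Λ G lam (D \ {x}) (Function.update B i L) τ := by
  have hsub : ∀ j y, y ∈ Function.update B i L j → y ∈ B j := by
    intro j y hy
    by_cases hj : j = i
    · subst hj
      rw [Function.update_self] at hy
      rw [hL]
      exact List.mem_cons_of_mem _ hy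
    · rwa [Function.update_of_ne hj] at hy
  have hch := h.chains i
  rw [hL] at hch
  have hnd := h.nodup i
  rw [hL, List.nodup_cons] at hnd
  have hx : ∀ j, x ∉ Function.update B i L j := by
    intro j hj
    obtain rfl : j = i := h.disjoint _ _ x (hsub j x hj) (by simp [hL])
    rw [Function.update_self] at hj
    exact hnd.1 hj
  refine ⟨?_, ?_, fun y hy => h.lt y hy.1, ?_, fun j j' y hy hy' => h.disjoint j j' y (hsub _ _ hy)
    (hsub _ _ hy'), ?_, fun y hy => h.sound y hy.1⟩
  · rw [h14, h15]
    have := h.chains.pop (j := i) (L' := L) (by rw [hch.1]; exact hch.2)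
    rwa [hch.1] at this
  · intro j y hy
    refine ⟨h.mem j y (hsub j y hy), ?_⟩
    rintro rfl
    exact hx j hy
  · intro j
    by_cases hj : j = i
    · subst hj
      rw [Function.update_self]
      exact hnd.2
    · rw [Function.update_of_ne hj]
      exact h.nodup j
  · intro y hy k hk hu
    rw [h16] at hu
    obtain ⟨j, h1, h2⟩ := h.live y hy.1 k hk hu
    refine ⟨j, ?_, h2⟩
    by_cases hj : j = i
    · subst hj
      rw [hL] at h1
      rw [Function.update_self]
      rcases List.mem_cons.1 h1 with rfl | h1
      · exact absurd rfl hy.2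
      · exact h1
    · rwa [Function.update_of_ne hj]

/-- Moves all items of the bucket of the current level to lower buckets. -/
def reinsert : Prog :=
  .loop (.wordLe (.lit 1) (.get 15 (.reg 8)))
    (.setReg 20 (.sub (.get 15 (.reg 8)) (.lit 1)) ;;
    .setArr 15 (.reg 8) (.get 14 (.reg 20)) ;;
    insertItem)

/-- Each item of bucket `i` goes strictly lower or disappears, which costs one unit of credit. So
the bucket empties and its length is paid for by the loss of weight. -/
theorem run_reinsert {i W : ℕ} {D : Set ℕ} {B : ℕ → List ℕ} (hΛ : Λ.Valid G lam)
    (hlam : IsThresholds lam) (hi : i ≤ l) (hσ : Ready Λ G lam σ) (h8 : σ.reg 8 = i)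
    (hB : Buckets Λ G lam D B σ) (hle : ∀ j, ∀ x ∈ B j, j ≤ i)
    (hc : ∀ v < G.n, i ≤ G.lv lam v → σ.arr 16 v ≠ 0) (hW : Λ.N + Λ.T + G.n + l + 1 ≤ W) :
    Run W reinsert σ fun t τ => Frame [14, 15] [] [20, 21, 22, 23, 24, 25] σ τ ∧
      t ≤ 130 * Λ.s * (B i).length + 10 ∧ ∃ B', Buckets Λ G lam D B' τ ∧
      (∀ j, ∀ x ∈ B' j, j < i) ∧
      weight (l + 1) (credit Λ G lam) B' + (B i).length ≤
        weight (l + 1) (credit Λ G lam) B := by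
  have hs := hΛ.one_le_s
  refine (run_loop (fun N τ => ∃ B', Frame [14, 15] [] [20, 21, 22, 23, 24, 25] σ τ ∧
    Buckets Λ G lam D B' τ ∧ (∀ j, ∀ x ∈ B' j, j ≤ i) ∧
    weight (l + 1) (credit Λ G lam) B' + (B i).length ≤
        weight (l + 1) (credit Λ G lam) B + (B' i).length ∧ N = 130 * Λ.s * (B' i).length) ?_
    (N := 130 * Λ.s * (B i).length) ?_).mono ?_
  · rintro N τ ⟨B', hF, hB', hle', hw, rfl⟩ hcond
    have e8 : τ.reg 8 = i := (hF.reg 8 (by simp)).trans h8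
    simp [e8] at hcond
    obtain ⟨L, hL, hcL⟩ := (hB'.chains i).eq_cons hcond
    generalize hx : τ.arr 15 i - 1 = x at *
    have hxD : x ∈ D := hB'.mem i x (by simp [hL])
    have hxN := hB'.lt x hxD
    have hLN : ∀ y ∈ L, y < Λ.N := fun y hy =>
      hB'.lt y (hB'.mem i y (by rw [hL]; exact List.mem_cons_of_mem _ hy))
    have hhead : τ.arr 14 x ≤ Λ.N := hcL.le hLN
    have hwp := weight_pop (credit Λ G lam) (show i < l + 1 by omega) hL
    rw [hL, List.length_cons] at hw
    rw [run_seq, run_setReg, run_seq, run_setArr]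
    simp only [WExpr.eval, WExpr.cost, e8, hx, Store.setReg_reg, Store.setReg_arr,
      Function.update_self, Function.update_of_ne (show 8 ≠ 20 by decide)]
    refine ⟨by omega, by omega, by omega, ?_⟩
    generalize hσ' : (τ.setReg 20 x).setArr 15 i (τ.arr 14 x) = σ'
    have hF' : Frame [15] [] [20] τ σ' := by
      rw [← hσ']
      exact ((Frame.refl τ).setReg (by simp) _).setArr (by simp) _ _
    have hFσ : Frame [14, 15] [] [20, 21, 22, 23, 24, 25] σ σ' :=
      hF.trans hF' (by simp) (by simp) (by simp)
    have e20 : σ'.reg 20 = x := by simp [← hσ']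
    have hb := hB'.pop hL (τ := σ') (hF'.arr 14 (by simp)) (by simp [← hσ']) (hF'.arr 16 (by simp))
    refine (run_insert hΛ hlam (hσ.frame hFσ (by simp) (by simp)) hb e20 hxN (by simp)
      (hB'.sound x hxD) (by omega)).mono ?_
    rintro t υ ⟨hF'', ht, B'', hB'', hor⟩
    rw [Set.insert_sdiff_singleton, Set.insert_eq_of_mem hxD] at hB''
    have hsub : ∀ j, ∀ y ∈ Function.update B' i L j, j ≤ i := by
      intro j y hy
      by_cases hj : j = i
      · omega
      · rw [Function.update_of_ne hj] at hy
        exact hle' j y hy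
    have hB3 : (∀ j, ∀ x ∈ B'' j, j ≤ i) ∧ B'' i = L ∧
        weight (l + 1) (credit Λ G lam) B'' + 1 ≤ weight (l + 1) (credit Λ G lam) B' := by
      rcases hor with rfl | ⟨b, hb1, hb2, rfl⟩
      · refine ⟨hsub, by simp, ?_⟩
        have : 1 ≤ credit Λ G lam i x := by
          unfold credit
          omega
        omega
      -- The levels from `i` on are completely settled, and the slot `b` is unsettled.
      · have hbi : G.lv lam (Λ.vert b) < i := by
          by_contra hcon
          refine hc _ (hΛ.vert_lt x hxN b hb1) (not_lt.1 hcon) ?_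
          rwa [← hFσ.arr 16 (by simp)]
        have hbs := hB'.sound x hxD b hb1
        have hcr := credit_succ_le hb1 hbs hbi
        have hbl := idx_le (lam := lam) (Λ.key b)
        generalize idx lam (Λ.key b) = j at *
        refine ⟨?_, ?_, ?_⟩
        · intro j' y hy
          by_cases hj : j' = j
          · omega
          · rw [Function.update_of_ne hj] at hy
            exact hsub j' y hy
        · rw [Function.update_of_ne (by omega), Function.update_self]
        · rw [weight_push _ _ (show j < l + 1 by omega)]
          omega
    refine ⟨_, ⟨B'', hFσ.trans hF'' (by simp) (by simp) (by simp), hB'', hB3.1, ?_, rfl⟩, ?_⟩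
    · rw [hB3.2.1]
      omega
    · rw [hB3.2.1, hL, List.length_cons, mul_add]
      simp only [Test.cost, WExpr.cost]
      omega
  · exact ⟨B, Frame.refl σ, hB, hle, le_rfl, rfl⟩
  · rintro t τ ⟨hcond, N', ⟨B', hF, hB', hle', hw, rfl⟩, ht⟩
    have e8 : τ.reg 8 = i := (hF.reg 8 (by simp)).trans h8
    simp [e8] at hcond ht
    have hnil := hB'.chains i
    rw [hcond] at hnil
    have hnil := hnil.eq_nil
    rw [hnil, List.length_nil] at hw
    refine ⟨hF, by omega, B', hB', fun j x hx => ?_, by omega⟩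
    refine lt_of_le_of_ne (hle' j x hx) ?_
    rintro rfl
    simp [hnil] at hx

/-- The invariant between the levels: the vertices of the levels `I, …, l` are settled and listed,
and the edges that leave them are scanned. -/
structure Boundary (Λ : Layout) (G : Instance) {l : ℕ} (lam : Fin (l + 2) → EReal) (I : ℕ)
    (Z D : Set ℕ) (B : ℕ → List ℕ) (σ : Store) : Prop where
  ready : Ready Λ G lam σ
  queue : Queue G lam I σ
  complete : ∀ v < G.n, I ≤ G.lv lam v → σ.arr 16 v ≠ 0
  level : σ.reg 8 = I
  buckets : Buckets Λ G lam D B σ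
  lt : ∀ j, ∀ x ∈ B j, j < I
  pos : σ.reg 7 = σ.reg 6
  scanned : ∀ u, u ∈ Z ↔ ∃ j < σ.reg 7, σ.arr 3 j = u
  src_mem : ∀ e ∈ D, e < G.m → G.srcN e ∈ Z
  blocks : ∀ x < Λ.N, G.m ≤ x → x ∈ D
  edges : ∀ e < G.m, G.srcN e ∈ Z → σ.arr 16 (G.tgtN e) ≠ 0 ∨ e ∈ D
  lists : ∀ i, I ≤ i → i ≤ l → σ.arr 5 i ≤ σ.reg 6 ∧
    ∀ j < σ.reg 6, (σ.arr 4 i ≤ j ∧ j < σ.arr 5 i ↔ G.lv lam (σ.arr 3 j) = i)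

/-- Settles the vertices of the next lower level. -/
def processLevel : Prog :=
  .setReg 8 (.sub (.reg 8) (.lit 1)) ;;
  .setArr 4 (.reg 8) (.reg 6) ;;
  scanBucket ;;
  search ;;
  reinsert ;;
  .setArr 5 (.reg 8) (.reg 6)

/-- A bound for the running time that remains. -/
noncomputable def potential (Λ : Layout) (G : Instance) {l : ℕ} (lam : Fin (l + 2) → EReal)
    (Z : Finset ℕ) (B : ℕ → List ℕ) : ℕ :=
  230 * Λ.s * (weight (l + 1) (credit Λ G lam) B +
    2 * ∑ u ∈ Finset.range G.n \ Z, vertexLost Λ G lam u) +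
    ∑ u ∈ Finset.range G.n \ Z, vertexCost Λ G lam u

/-- An item in bucket `i` costs `100 * s` for the scan and `130 * s` for the reinsertion, together
the factor `230 * s` of a unit of credit in `potential`. The term with `vertexLost` reserves the
credit of edge items yet to be created. -/
theorem run_processLevel {i W : ℕ} {Z : Finset ℕ} {D : Set ℕ} {B : ℕ → List ℕ}
    (hΛ : Λ.Valid G lam) (hlam : IsThresholds lam) (hi : i ≤ l)
    (h : Boundary Λ G lam (i + 1) Z D B σ) (hW : Λ.N + Λ.T + G.n + l + 1 ≤ W) :
    Run W processLevel σ fun t τ => ∃ (Z' : Finset ℕ) (D' : Set ℕ) (B' : ℕ → List ℕ),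
      Boundary Λ G lam i Z' D' B' τ ∧ t + potential Λ G lam Z' B' ≤ potential Λ G lam Z B + 50 := by
  have hlen := h.queue.length_le
  rw [processLevel, run_seq, run_setReg, run_seq, run_setArr]
  simp only [WExpr.eval, WExpr.cost, h.level, Nat.add_sub_cancel, Store.setReg_reg,
    Function.update_self, Function.update_of_ne (show 6 ≠ 8 by decide)]
  refine ⟨by omega, by omega, by omega, ?_⟩
  generalize hσ₁ : (σ.setReg 8 i).setArr 4 i (σ.reg 6) = σ₁
  have hF₁ : Frame [4] [] [8] σ σ₁ := by
    rw [← hσ₁]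
    exact ((Frame.refl σ).setReg (by simp) _).setArr (by simp) _ _
  have e16 : σ₁.arr 16 = σ.arr 16 := hF₁.arr 16 (by simp)
  have e3 : σ₁.arr 3 = σ.arr 3 := hF₁.arr 3 (by simp)
  have e6 : σ₁.reg 6 = σ.reg 6 := hF₁.reg 6 (by simp)
  have e7 : σ₁.reg 7 = σ.reg 7 := hF₁.reg 7 (by simp)
  have e8 : σ₁.reg 8 = i := by simp [← hσ₁]
  -- Completeness from level `i + 1` on is exactly the condition `above` for level `i`.
  have hQ₀ : Queue G lam i σ :=
    ⟨h.queue.inj, h.queue.lt, h.queue.settled_iff, h.queue.label,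
      fun v hv => (Nat.le_succ i).trans (h.queue.le_lv v hv), fun v hv hiv => h.complete v hv hiv⟩
  have hQ₁ : Queue G lam i σ₁ := hQ₀.congr (hF₁.arr 2 (by simp)) e3 e16 e6
  have hG₁ : Grow σ σ₁ := .of_eq e3 e16 e6
  have hr₁ : Ready Λ G lam σ₁ := h.ready.frame hF₁ (by simp) (by simp)
  rw [run_seq]
  refine (run_scanBucket hΛ hlam hr₁ hQ₁ e8 hi (h.buckets.grow (hF₁.arr 14 (by simp))
    (hF₁.arr 15 (by simp)) hG₁.settled) hW).mono ?_
  rintro t₂ σ₂ ⟨hF₂, ht₂, hQ₂, hG₂, hB₂, hdone⟩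
  have hG₂' := hG₁.trans hG₂
  have f7 : σ₂.reg 7 = σ.reg 7 := (hF₂.reg 7 (by simp)).trans e7
  have hS : Search Λ G lam i Z D B [] σ₂ := by
    refine ⟨hr₁.frame hF₂ (by simp) (by simp), hQ₂, (hF₂.reg 8 (by simp)).trans e8, hB₂,
      fun j x hx => Nat.le_of_lt_succ (h.lt j x hx), hdone, ?_, ?_, h.src_mem, h.blocks, ?_⟩
    · rw [f7, h.pos]
      exact hG₂'.length_le
    · intro u
      rw [h.scanned, f7]
      refine exists_congr fun j => and_congr_right fun hj => ?_
      rw [hG₂'.queue j (by rwa [← h.pos])]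
    · intro e he hs
      rcases h.edges e he hs with h1 | h1
      · exact .inr (.inl (hG₂'.settled _ h1))
      · exact .inr (.inr h1)
  rw [run_seq]
  refine (run_search hΛ hlam hi hS hW).mono ?_
  rintro t₃ σ₃ ⟨hF₃, hG₃, hpos₃, Z', D', B', hS', hBi, hw, ht₃⟩
  have hcomp : ∀ v < G.n, i ≤ G.lv lam v → σ₃.arr 16 v ≠ 0 := fun v hv hiv =>
    hS'.complete hΛ hlam hi hpos₃ hv hiv
  rw [run_seq]
  refine (run_reinsert hΛ hlam hi hS'.ready hS'.level hS'.buckets hS'.le hcomp hW).mono ?_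
  rintro t₄ σ₄ ⟨hF₄, ht₄, B'', hB'', hlt, hw'⟩
  have g16 : σ₄.arr 16 = σ₃.arr 16 := hF₄.arr 16 (by simp)
  have g3 : σ₄.arr 3 = σ₃.arr 3 := hF₄.arr 3 (by simp)
  have g6 : σ₄.reg 6 = σ₃.reg 6 := hF₄.reg 6 (by simp)
  have g7 : σ₄.reg 7 = σ₃.reg 7 := hF₄.reg 7 (by simp)
  have g8 : σ₄.reg 8 = i := (hF₄.reg 8 (by simp)).trans hS'.level
  have hr₄ : Ready Λ G lam σ₄ := hS'.ready.frame hF₄ (by simp) (by simp)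
  have hQ₄ : Queue G lam i σ₄ := hS'.queue.congr (hF₄.arr 2 (by simp)) g3 g16 g6
  have hG₄ : Grow σ σ₄ := (hG₂'.trans hG₃).trans (.of_eq g3 g16 g6)
  have hlen₄ := hQ₄.length_le
  have g4 : σ₄.arr 4 = Function.update (σ.arr 4) i (σ.reg 6) := by
    rw [hF₄.arr 4 (by simp), hF₃.arr 4 (by simp), hF₂.arr 4 (by simp), ← hσ₁]
    simp
  have g5 : σ₄.arr 5 = σ.arr 5 := by
    rw [hF₄.arr 5 (by simp), hF₃.arr 5 (by simp), hF₂.arr 5 (by simp), hF₁.arr 5 (by simp)]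
  rw [run_setArr]
  simp only [WExpr.eval, WExpr.cost, g8]
  refine ⟨by omega, by omega, Z', D', B'', ?_, ?_⟩
  · have hF₅ : Frame [5] [] [] σ₄ (σ₄.setArr 5 i (σ₄.reg 6)) := (Frame.refl σ₄).setArr (by simp) _ _
    refine ⟨hr₄.frame hF₅ (by simp) (by simp), hQ₄.congr (hF₅.arr 2 (by simp)) (hF₅.arr 3 (by simp))
      (hF₅.arr 16 (by simp)) rfl, ?_, g8, hB''.grow (hF₅.arr 14 (by simp)) (hF₅.arr 15 (by simp))
      (by rw [hF₅.arr 16 (by simp)]; exact fun _ h => h), hlt, ?_, ?_, hS'.src_mem, hS'.blocks, ?_,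
      ?_⟩
    · rw [hF₅.arr 16 (by simp), g16]
      exact hcomp
    · simp only [Store.setArr_reg]
      have := hS'.pos_le
      omega
    · rw [hF₅.arr 3 (by simp), g3, Store.setArr_reg, g7]
      exact hS'.scanned
    · rw [hF₅.arr 16 (by simp), g16]
      intro e he hs
      simpa using hS'.edges e he hs
    · rw [hF₅.arr 3 (by simp), hF₅.arr 4 (by simp), Store.setArr_reg, g4]
      simp only [Store.setArr_arr, Function.update_self, g5]
      have hold : ∀ j < σ.reg 6, i + 1 ≤ G.lv lam (σ₄.arr 3 j) := by
        intro j hj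
        rw [hG₄.queue j hj]
        exact h.queue.le_lv _ ((h.queue.settled_iff _).2 ⟨j, hj, rfl⟩)
      -- A newly listed vertex above level `i` would already occur earlier in the queue. Hence the
      -- level `i` is precisely the segment appended now.
      have hnew : ∀ j, σ.reg 6 ≤ j → j < σ₄.reg 6 → G.lv lam (σ₄.arr 3 j) = i := by
        intro j hj hj'
        refine le_antisymm ?_ (hQ₄.le_lv _ ((hQ₄.settled_iff _).2 ⟨j, hj', rfl⟩))
        by_contra hcon
        obtain ⟨k, hk, hkj⟩ := (h.queue.settled_iff _).1
          (h.complete _ (hQ₄.lt j hj') (by omega : i + 1 ≤ G.lv lam (σ₄.arr 3 j)))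
        rw [← hG₄.queue k hk] at hkj
        have := hQ₄.inj k (by omega) j hj' hkj
        omega
      intro i' hii' hil
      by_cases hne : i' = i
      · subst hne
        simp only [Function.update_self]
        refine ⟨le_rfl, fun j hj => ⟨fun h1 => hnew j h1.1 hj, fun h1 => ⟨?_, hj⟩⟩⟩
        by_contra hcon
        have := hold j (by omega)
        omega
      · simp only [Function.update_of_ne hne]
        obtain ⟨h1, h2⟩ := h.lists i' (by omega) hil
        have := hG₄.length_le
        refine ⟨by omega, fun j hj => ?_⟩
        by_cases hj' : j < σ.reg 6
        · rw [hG₄.queue j hj']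
          exact h2 j hj'
        · have := hnew j (by omega) hj
          omega
  · rw [hBi] at ht₄ hw'
    unfold potential
    generalize weight (l + 1) (credit Λ G lam) B'' = w'' at *
    generalize weight (l + 1) (credit Λ G lam) B' = w' at *
    generalize weight (l + 1) (credit Λ G lam) B = w at *
    generalize ∑ u ∈ Finset.range G.n \ Z', vertexLost Λ G lam u = a' at *
    generalize ∑ u ∈ Finset.range G.n \ Z, vertexLost Λ G lam u = a at *
    -- The search and the reinsertion together lower the credit, including the reserve for lost
    -- edges, by at least the number of items in bucket `i`.
    have hmul : 230 * Λ.s * (w'' + 2 * a' + (B i).length) ≤ 230 * Λ.s * (w + 2 * a) :=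
      Nat.mul_le_mul_left _ (by omega)
    rw [Nat.mul_add _ (w'' + 2 * a')] at hmul
    have hsplit : 230 * Λ.s * (B i).length =
        100 * Λ.s * (B i).length + 130 * Λ.s * (B i).length := by ring
    omega

end

section

variable {Λ : Layout} {G : Instance} {l : ℕ} {lam : Fin (l + 2) → EReal} {σ τ υ : Store}

/-! ### The complete program -/

/-- Inserts all blocks into buckets. -/
def insertBlocks : Prog :=
  .setReg 12 (.reg 1) ;;
  .loop (.wordLe (.add (.reg 12) (.lit 1)) (.reg 5))
    (.setReg 20 (.reg 12) ;;
    insertItem ;;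
    .setReg 12 (.add (.reg 12) (.lit 1)))

/-- One unit is the constant in `credit`, and one is the excess of distinct levels over changes. -/
theorem credit_le (j x : ℕ) :
    credit Λ G lam j x ≤ 2 + changesOn (fun k => G.lv lam (Λ.vert k)) (Λ.lo x) (Λ.hi x) := by
  unfold credit
  have h1 := Finset.card_filter_le
    ((Finset.Ico (Λ.lo x) (Λ.hi x)).image fun k => G.lv lam (Λ.vert k)) (· < j)
  have h2 := card_image_Ico_le (fun k => G.lv lam (Λ.vert k)) (Λ.lo x) (Λ.hi x)
  omega

theorem run_insertBlocks {W : ℕ} (hΛ : Λ.Valid G lam) (hlam : IsThresholds lam)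
    (hbl : Blocks G.m Λ.s Λ.T Λ.N Λ.lo Λ.hi) (hσ : Ready Λ G lam σ) (h5 : σ.reg 5 = Λ.N)
    (h15 : σ.arr 15 = fun _ => 0) (hmT : G.m ≤ Λ.T)
    (hW : Λ.N + Λ.T + l + 1 ≤ W) :
    Run W insertBlocks σ fun t τ => Frame [14, 15] [] [12, 20, 21, 22, 23, 24, 25] σ τ ∧
      t ≤ 130 * Λ.s * (Λ.N - G.m) + 10 ∧ ∃ B, Buckets Λ G lam {x | G.m ≤ x ∧ x < Λ.N} B τ ∧
      (∀ j, ∀ x ∈ B j, j ≤ l) ∧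
      weight (l + 1) (credit Λ G lam) B ≤
        2 * (Λ.N - G.m) + changesOn (fun k => G.lv lam (Λ.vert k)) G.m Λ.T := by
  have hs := hΛ.one_le_s
  have hmN := hΛ.m_le
  rw [insertBlocks, run_seq, run_setReg]
  simp only [WExpr.eval, WExpr.cost, hσ.input.reg1]
  refine ⟨by omega, ?_⟩
  -- The number `q` is the end of the last inserted block. All later blocks start at or after `q`,
  -- so their changes are not yet counted.
  refine (run_loop (fun N τ => ∃ B q, Frame [14, 15] [] [12, 20, 21, 22, 23, 24, 25] σ τ ∧
    G.m ≤ τ.reg 12 ∧ τ.reg 12 ≤ Λ.N ∧ Buckets Λ G lam {x | G.m ≤ x ∧ x < τ.reg 12} B τ ∧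
    (∀ j, ∀ x ∈ B j, j ≤ l) ∧ G.m ≤ q ∧ q ≤ Λ.T ∧ (∀ x, τ.reg 12 ≤ x → x < Λ.N → q ≤ Λ.lo x) ∧
    weight (l + 1) (credit Λ G lam) B ≤
      2 * (τ.reg 12 - G.m) + changesOn (fun k => G.lv lam (Λ.vert k)) G.m q ∧
    N = 130 * Λ.s * (Λ.N - τ.reg 12)) ?_ (N := 130 * Λ.s * (Λ.N - G.m)) ?_).mono ?_
  · rintro N τ ⟨B, q, hF, i1, i2, hB, hBl, hmq, hqT, hql, hw, rfl⟩ hcond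
    have e5 : τ.reg 5 = Λ.N := (hF.reg 5 (by simp)).trans h5
    simp [e5] at hcond
    rw [run_seq, run_setReg]
    simp only [WExpr.eval, WExpr.cost]
    generalize hy : τ.reg 12 = y at *
    refine ⟨by omega, ?_⟩
    have hF' : Frame [] [] [20] τ (τ.setReg 20 y) := (Frame.refl τ).setReg (by simp) _
    have hFσ : Frame [14, 15] [] [12, 20, 21, 22, 23, 24, 25] σ (τ.setReg 20 y) :=
      hF.trans hF' (by simp) (by simp) (by simp)
    have hlo := hbl.le_lo y i1 (by omega)
    have hlh := hbl.lo_le y i1 (by omega)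
    have hqy := hql y le_rfl (by omega)
    rw [run_seq]
    refine (run_insert hΛ hlam (hσ.frame hFσ (by simp) (by simp)) (hB.grow rfl rfl fun _ h => h)
      (x := y) (by simp) (by omega) (by simp) ?_ hW).mono ?_
    · intro k hk
      rw [hΛ.block_key y (by omega) i1 k hk]
      exact G.hi_le_lv hlam (hΛ.vert_lt y (by omega) k hk)
    rintro t υ ⟨hF'', ht, B', hB', hor⟩
    have hF3 := hFσ.trans hF'' (A := [14, 15]) (K := []) (R := [12, 20, 21, 22, 23, 24, 25])
      (by simp) (by simp) (by simp)
    have e12 : υ.reg 12 = y := by rw [hF''.reg 12 (by simp), hF'.reg 12 (by simp), hy]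
    simp only [run_setReg, WExpr.eval, WExpr.cost, e12]
    refine ⟨by omega, _, ⟨B', Λ.hi y, hF3.setReg (by simp) _, ?_, ?_, ?_, ?_, by omega,
      hbl.hi_le_top y i1 (by omega), ?_, ?_, rfl⟩, ?_⟩
    · simp
      omega
    · simp
      omega
    · have hset : {x | G.m ≤ x ∧ x < ((υ.setReg 12 (y + 1)).reg 12)} =
          insert y {x | G.m ≤ x ∧ x < y} := by
        ext x
        simp
        omega
      rw [hset]
      exact hB'.grow rfl rfl fun _ h => h
    · rcases hor with rfl | ⟨b, hb1, hb2, rfl⟩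
      · exact hBl
      · intro j x hx
        by_cases hj : j = idx lam (Λ.key b)
        · rw [hj]
          exact idx_le _
        · rw [Function.update_of_ne hj] at hx
          exact hBl j x hx
    · intro x hx hxN
      simp at hx
      exact hbl.hi_le_lo y x i1 (by omega) hxN
    · have c1 := changesOn_add_le (fun k => G.lv lam (Λ.vert k)) hmq hqy
      have c2 := changesOn_add_le (fun k => G.lv lam (Λ.vert k)) hlo hlh
      simp only [Store.setReg_reg, Function.update_self]
      rcases hor with rfl | ⟨b, hb1, hb2, rfl⟩
      · omega
      · rw [weight_push _ _ (show idx lam (Λ.key b) < l + 1 from Nat.lt_succ_of_le (idx_le _))]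
        have := credit_le (Λ := Λ) (G := G) (lam := lam) (idx lam (Λ.key b)) y
        omega
    · simp only [Store.setReg_reg, Function.update_self, Test.cost, WExpr.cost]
      rw [show Λ.N - y = Λ.N - (y + 1) + 1 by omega, mul_add]
      omega
  · refine ⟨fun _ => [], G.m, (Frame.refl σ).setReg (by simp) _, by simp, by simpa using hmN, ?_,
      by simp, le_rfl, hmT, ?_, by simp [weight_nil], by simp⟩
    · refine ⟨?_, by simp, ?_, by simp, by simp, ?_, ?_⟩
      · intro j
        simp [h15, Chain]
      all_goals
        intro x hx
        simp at hx
        omega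
    · intro x hx hxN
      exact hbl.le_lo x (by simpa using hx) hxN
  · rintro t τ ⟨hcond, N', ⟨B, q, hF, i1, i2, hB, hBl, hmq, hqT, hql, hw, rfl⟩, ht⟩
    have e5 : τ.reg 5 = Λ.N := (hF.reg 5 (by simp)).trans h5
    simp [e5] at hcond ht
    have hN : τ.reg 12 = Λ.N := by omega
    rw [hN] at hB hw
    have c1 := changesOn_add_le (fun k => G.lv lam (Λ.vert k)) hmq hqT
    exact ⟨hF, by omega, B, hB, hBl, by omega⟩

/-- The split algorithm. -/
def split : Prog :=
  bitLength ;;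
  buildLists ;;
  walk ;;
  cutBlocks ;;
  insertBlocks ;;
  .setReg 8 (.add (.reg 2) (.lit 1)) ;;
  .loop (.wordLe (.lit 1) (.reg 8)) processLevel

/-- The number of lost edges. -/
noncomputable def totalLost (G : Instance) {l : ℕ} (lam : Fin (l + 2) → EReal) : ℕ :=
  ∑ e ∈ Finset.range G.m, lostCount G lam e

/-- An edge between different levels is lost, and it has two half-edges. -/
theorem sum_hchange_le (k : ℕ) :
    ∑ h ∈ Finset.range (2 * k), hchange G (G.lv lam) h ≤
      2 * ∑ e ∈ Finset.range k, lostCount G lam e := by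
  induction k with
  | zero => simp
  | succ k ih =>
    rw [show 2 * (k + 1) = k + k + 1 + 1 by omega, Finset.sum_range_succ, Finset.sum_range_succ,
      Finset.sum_range_succ, ← two_mul]
    have h1 : hchange G (G.lv lam) (k + k) ≤ lostCount G lam k := by
      unfold hchange lostCount Instance.Lost
      rw [Instance.hsrc_even, Instance.htgt_even]
      split_ifs <;> omega
    have h2 : hchange G (G.lv lam) (k + k + 1) ≤ lostCount G lam k := by
      unfold hchange lostCount Instance.Lost
      rw [Instance.hsrc_odd, Instance.htgt_odd]
      split_ifs <;> omega
    rw [← two_mul] at h1 h2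
    omega

/-- The summand `60 * (l + 1)` is the overhead per level; it is affordable because `l ≤ m`. -/
theorem run_levels {W : ℕ} {Z : Finset ℕ} {D : Set ℕ} {B : ℕ → List ℕ}
    (hΛ : Λ.Valid G lam) (hlam : IsThresholds lam)
    (h : Boundary Λ G lam (l + 1) Z D B σ) (hW : Λ.N + Λ.T + G.n + l + 1 ≤ W) :
    Run W (.loop (.wordLe (.lit 1) (.reg 8)) processLevel) σ fun t τ => IsSplit G lam τ ∧
      t ≤ potential Λ G lam Z B + 60 * (l + 1) + 3 := by
  refine (run_loop (fun N τ => ∃ (I : ℕ) (Z : Finset ℕ) (D : Set ℕ) (B : ℕ → List ℕ), I ≤ l + 1 ∧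
    Boundary Λ G lam I Z D B τ ∧ N = potential Λ G lam Z B + 60 * I) ?_
    (N := potential Λ G lam Z B + 60 * (l + 1)) ?_).mono ?_
  · rintro N τ ⟨I, Z, D, B, hI, hb, rfl⟩ hcond
    simp [hb.level] at hcond
    obtain ⟨i, rfl⟩ : ∃ i, I = i + 1 := ⟨I - 1, by omega⟩
    refine (run_processLevel hΛ hlam (by omega) hb hW).mono ?_
    rintro t υ ⟨Z', D', B', hb', ht⟩
    refine ⟨_, ⟨i, Z', D', B', by omega, hb', rfl⟩, ?_⟩
    simp only [Test.cost, WExpr.cost]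
    omega
  · exact ⟨l + 1, Z, D, B, le_rfl, h, rfl⟩
  · rintro t τ ⟨hcond, N', ⟨I, Z, D, B, hI, hb, rfl⟩, ht⟩
    simp [hb.level] at hcond ht
    subst hcond
    refine ⟨⟨?_, ?_⟩, by omega⟩
    · intro v i
      rw [G.mem_level_iff hlam, hb.queue.label v (hb.complete v v.2 (Nat.zero_le _))]
    · intro i
      obtain ⟨h1, h2⟩ := hb.lists i (Nat.zero_le _) (by omega)
      refine ⟨?_, ?_, ?_⟩
      · intro j hj
        have hj' : j < τ.reg 6 := lt_of_lt_of_le hj.2 h1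
        have hlt := hb.queue.lt j hj'
        refine ⟨⟨τ.arr 3 j, hlt⟩, ?_, rfl⟩
        rw [G.mem_level_iff hlam]
        exact (h2 j hj').1 hj
      · intro j hj k hk
        exact hb.queue.inj j (lt_of_lt_of_le hj.2 h1) k (lt_of_lt_of_le hk.2 h1)
      · rintro _ ⟨v, hv, rfl⟩
        rw [G.mem_level_iff hlam] at hv
        obtain ⟨j, hj, hjv⟩ := (hb.queue.settled_iff v).1 (hb.complete v v.2 (Nat.zero_le _))
        refine ⟨j, (h2 j hj).2 ?_, hjv⟩
        rw [hjv, hv]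

/-- All vertices occur among the at most `4 * m + 1` entries of the walk. Hence steps and words of
size `O(n)` are also `O(m)`. -/
theorem WalkBuilt.card_le {c : ℕ → ℕ} (h : WalkBuilt G c τ) : G.n ≤ 4 * G.m + 1 := by
  have hsub : Finset.range G.n ⊆ (Finset.Ico G.m (τ.reg 4)).image (τ.arr 11) := by
    intro v hv
    obtain ⟨i, h1, h2, h3⟩ := h.exists_vert v (by simpa using hv)
    exact Finset.mem_image.2 ⟨i, Finset.mem_Ico.2 ⟨h1, h2⟩, h3⟩
  have h1 := Finset.card_le_card hsub
  have h2 := Finset.card_image_le (s := Finset.Ico G.m (τ.reg 4)) (f := τ.arr 11)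
  have h3 := h.length_le
  simp at h1 h2
  omega

theorem run_split {W : ℕ} (hG : G.WeaklyConnected) (hl : 1 ≤ l) (hlm : l ≤ G.m)
    (hlam : IsThresholds lam) (hW : 20 * (G.n + G.m + l) ≤ W) :
    Run W split (inputStore G lam) fun t τ => IsSplit G lam τ ∧
      ∃ s, 2 ^ s ≤ 2 * l ∧ t ≤ 6000 * G.m + 2000 * (s * totalLost G lam) := by
  have hn : 0 < G.n := by
    obtain ⟨v⟩ := hG.nonempty
    exact v.pos
  generalize hσ₀ : inputStore G lam = σ₀
  have hin₀ : Input G lam σ₀ := hσ₀ ▸ input_inputStore G lam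
  have hz : ∀ a, 2 ≤ a → σ₀.arr a = fun _ => 0 := by
    intro a ha
    obtain ⟨b, rfl⟩ := Nat.exists_eq_add_of_le' ha
    rw [← hσ₀]
    rfl
  have hzr : ∀ a, 3 ≤ a → σ₀.reg a = 0 := by
    intro a ha
    obtain ⟨b, rfl⟩ := Nat.exists_eq_add_of_le' ha
    rw [← hσ₀]
    rfl
  rw [split, run_seq]
  refine (run_bitLength (by rw [hin₀.reg2]; exact hl) (hzr 3 le_rfl)
    (by rw [hin₀.reg2]; omega)).mono ?_
  rintro t₁ σ₁ ⟨hF₁, hlt, hpow, ht₁⟩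
  rw [hin₀.reg2] at hlt hpow ht₁
  have hin₁ := hin₀.frame hF₁ (by simp) (by simp) (by simp)
  rw [run_seq]
  refine (run_buildLists hin₁ (by rw [hF₁.arr 7 (by simp), hz 7 (by omega)])
    (by rw [hF₁.arr 17 (by simp), hz 17 (by omega)]) (by omega)).mono ?_
  rintro t₂ σ₂ ⟨hF₂, hlists, ht₂⟩
  have hin₂ := hin₁.frame hF₂ (by simp) (by simp) (by simp)
  rw [run_seq]
  refine (run_walk hin₂ hG hlists (by rw [hF₂.arr 9 (by simp), hF₁.arr 9 (by simp),
    hz 9 (by omega)]) (by omega) (G.lv lam)).mono ?_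
  rintro t₃ σ₃ ⟨hF₃, hvert₃, hkey₃, hwalk, ht₃⟩
  have hin₃ := hin₂.frame hF₃ (by simp) (by simp) (by simp)
  have hs3 : σ₃.reg 3 = σ₁.reg 3 := by rw [hF₃.reg 3 (by simp), hF₂.reg 3 (by simp)]
  generalize hs : σ₁.reg 3 = s at *
  have hsl := two_mul_two_pow_le hpow
  have hs1 : 1 ≤ s := by
    by_contra hcon
    obtain rfl : s = 0 := by omega
    simp at hlt
    omega
  have hT := hwalk.length_le
  have hmT := hwalk.le
  have hcard := hwalk.card_le
  rw [run_seq]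
  refine (run_cutBlocks (m := G.m) (s := s) (T := σ₃.reg 4) hin₃.reg1 hs3 rfl hs1 hmT
    (by omega)).mono ?_
  rintro t₄ σ₄ ⟨hF₄, hmN, hNT, hNs, hlo₄, hhi₄, hbl, hcov, ht₄⟩
  have hin₄ := hin₃.frame hF₄ (by simp) (by simp) (by simp)
  obtain ⟨O, hO, hOf⟩ := hlists.out
  have e11 : σ₄.arr 11 = σ₃.arr 11 := hF₄.arr 11 (by simp)
  have k3 : σ₄.key 3 = σ₃.key 3 := hF₄.key 3 (by simp)
  have hlo : ∀ e < G.m, σ₄.arr 12 e = e := fun e he => by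
    rw [hlo₄ e he, hF₃.arr 12 (by simp), hlists.lo e he]
  have hhi : ∀ e < G.m, σ₄.arr 13 e = e + 1 := fun e he => by
    rw [hhi₄ e he, hF₃.arr 13 (by simp), hlists.hi e he]
  have hvert : ∀ e < G.m, σ₄.arr 11 e = G.tgtN e := fun e he => by
    rw [e11, hvert₃ e he, hlists.vert e he]
  -- From here on the slots, the items and the lists of leaving edges are never modified.
  let Λ : Layout := ⟨s, σ₃.reg 4, σ₄.reg 5, σ₄.arr 11, σ₄.arr 12, σ₄.arr 13, σ₄.key 3, O⟩
  have hslot : ∀ x < σ₄.reg 5, G.m ≤ x → ∀ k, Λ.IsSlot x k → G.m ≤ k ∧ k < σ₃.reg 4 := by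
    intro x hx hmx k hk
    have h1 := hbl.le_lo x hmx hx
    have h2 := hbl.hi_le_top x hmx hx
    have h3 : σ₄.arr 12 x ≤ k := hk.1
    have h4 : k < σ₄.arr 13 x := hk.2
    omega
  have hΛ : Λ.Valid G lam := by
    refine ⟨hs1, hlt, hmN, ?_, ?_, ?_, ?_, hlo, hhi, hvert, ?_, ?_, ?_, hOf⟩
    · intro x hx
      by_cases hmx : G.m ≤ x
      · exact hbl.lo_le x hmx hx
      · have h1 := hlo x (by omega)
        have h2 := hhi x (by omega)
        change σ₄.arr 12 x ≤ σ₄.arr 13 x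
        omega
    · intro x hx
      by_cases hmx : G.m ≤ x
      · exact hbl.hi_le x hmx hx
      · have h1 := hlo x (by omega)
        have h2 := hhi x (by omega)
        change σ₄.arr 13 x ≤ σ₄.arr 12 x + s
        omega
    · intro x hx
      by_cases hmx : G.m ≤ x
      · exact hbl.hi_le_top x hmx hx
      · have h2 := hhi x (by omega)
        change σ₄.arr 13 x ≤ σ₃.reg 4
        omega
    · intro x hx k hk
      change σ₄.arr 11 k < G.n
      by_cases hmx : G.m ≤ x
      · obtain ⟨h1, h2⟩ := hslot x hx hmx k hk
        rw [e11]
        exact hwalk.vert_lt k h1 h2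
      · have h1 := hlo x (by omega)
        have h2 := hhi x (by omega)
        have h3 : σ₄.arr 12 x ≤ k := hk.1
        have h4 : k < σ₄.arr 13 x := hk.2
        rw [hvert k (by omega)]
        exact G.tgtN_lt (by omega)
    · intro e he
      change σ₄.key 3 e = _
      rw [k3, hkey₃ e he, hlists.key e he]
    · intro x hx hmx k hk
      obtain ⟨h1, h2⟩ := hslot x hx hmx k hk
      change σ₄.key 3 k = padded ⊥ G.h (σ₄.arr 11 k)
      rw [k3, e11]
      exact hwalk.key k h1 h2
    · intro v hv
      obtain ⟨k, h1, h2, h3⟩ := hwalk.exists_vert v hv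
      obtain ⟨x, h4, h5, h6, h7⟩ := hcov k h1 h2
      refine ⟨x, h5, h4, k, ⟨h6, h7⟩, ?_⟩
      change σ₄.arr 11 k = v
      rw [e11, h3]
  have hr₄ : Ready Λ G lam σ₄ := by
    refine ⟨hin₄, rfl, rfl, rfl, rfl, ?_⟩
    rw [hF₄.arr 18 (by simp), hF₄.arr 17 (by simp), hF₃.arr 18 (by simp), hF₃.arr 17 (by simp)]
    exact hO
  have hz₄ : ∀ a ∈ [2, 3, 14, 15, 16], σ₄.arr a = fun _ => 0 := by
    intro a ha
    simp at ha
    rw [hF₄.arr a (by simp; omega), hF₃.arr a (by simp; omega), hF₂.arr a (by simp; omega),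
      hF₁.arr a (by simp), hz a (by omega)]
  have hz₄' : ∀ a ∈ [6, 7], σ₄.reg a = 0 := by
    intro a ha
    simp at ha
    rw [hF₄.reg a (by simp; omega), hF₃.reg a (by simp; omega), hF₂.reg a (by simp; omega),
      hF₁.reg a (by simp; omega), hzr a (by omega)]
  have hchg : changesOn (fun k => G.lv lam (σ₄.arr 11 k)) G.m (σ₃.reg 4) ≤ 4 * totalLost G lam := by
    have h1 := hwalk.changes_le
    have h2 := sum_hchange_le (G := G) (lam := lam) G.m
    rw [e11]
    unfold totalLost
    omega
  rw [run_seq]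
  refine (run_insertBlocks hΛ hlam hbl hr₄ rfl (hz₄ 15 (by simp)) hmT
    (by change σ₄.reg 5 + σ₃.reg 4 + l + 1 ≤ W; omega)).mono ?_
  rintro t₅ σ₅ ⟨hF₅, ht₅, B, hB, hBl, hw⟩
  change t₅ ≤ 130 * s * (σ₄.reg 5 - G.m) + 10 at ht₅
  change _ ≤ 2 * (σ₄.reg 5 - G.m) + changesOn (fun k => G.lv lam (σ₄.arr 11 k)) G.m (σ₃.reg 4) at hw
  have hr₅ : Ready Λ G lam σ₅ := hr₄.frame hF₅ (by simp) (by simp)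
  rw [run_seq, run_setReg]
  simp only [WExpr.eval, WExpr.cost, hr₅.input.reg2]
  refine ⟨by omega, ?_⟩
  have hF₆ : Frame [] [] [8] σ₅ (σ₅.setReg 8 (l + 1)) := (Frame.refl σ₅).setReg (by simp) _
  have e16 : σ₅.arr 16 = fun _ => 0 := by rw [hF₅.arr 16 (by simp), hz₄ 16 (by simp)]
  have e6 : σ₅.reg 6 = 0 := by rw [hF₅.reg 6 (by simp), hz₄' 6 (by simp)]
  have e7 : σ₅.reg 7 = 0 := by rw [hF₅.reg 7 (by simp), hz₄' 7 (by simp)]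
  have hlv := G.lv_le lam
  have hbd : Boundary Λ G lam (l + 1) (∅ : Finset ℕ) {x | G.m ≤ x ∧ x < σ₄.reg 5} B
      (σ₅.setReg 8 (l + 1)) := by
    refine ⟨hr₅.frame hF₆ (by simp) (by simp), ?_, ?_, by simp, hB.grow rfl rfl fun _ h => h,
      fun j x hx => Nat.lt_succ_of_le (hBl j x hx), by simp [e6, e7], by simp [e7], ?_,
      fun x hx hmx => ⟨hmx, hx⟩, by simp, fun i h1 h2 => by omega⟩
    · constructor
      · simp [e6]
      · simp [e6]
      · simp [e6, e16]
      · simp [e16]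
      · simp [e16]
      · intro v _ h
        have := hlv v
        omega
    · intro v _ h
      have := hlv v
      omega
    · intro e he hem
      have := he.1
      omega
  refine (run_levels hΛ hlam hbd (by change σ₄.reg 5 + σ₃.reg 4 + G.n + l + 1 ≤ W; omega)).mono ?_
  rintro t₆ σ₆ ⟨hsplit, ht₆⟩
  refine ⟨hsplit, s, hpow, ?_⟩
  -- The lists of leaving edges partition the edges, so the sum over vertices becomes a sum over
  -- edges.
  have hcost : ∑ u ∈ Finset.range G.n \ ∅, vertexCost Λ G lam u =
      30 * G.n + (60 * G.m + 110 * s * totalLost G lam) := by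
    have h1 := hOf.weight_eq fun _ e => edgeCost Λ G lam e
    unfold weight edgeCost at h1
    rw [Finset.sum_add_distrib, ← Finset.mul_sum] at h1
    simp only [Finset.sum_const, Finset.card_range, smul_eq_mul] at h1
    rw [Finset.sdiff_empty]
    unfold vertexCost
    rw [Finset.sum_add_distrib]
    simp only [Finset.sum_const, Finset.card_range, smul_eq_mul]
    unfold edgeCost
    rw [h1, mul_comm G.n, mul_comm G.m]
    rfl
  have hlost : ∑ u ∈ Finset.range G.n \ ∅, vertexLost Λ G lam u = totalLost G lam := by
    rw [Finset.sdiff_empty]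
    exact hOf.weight_eq fun _ e => lostCount G lam e
  unfold potential at ht₆
  rw [hcost, hlost] at ht₆
  change t₆ ≤ 230 * s * (_ + _) + _ + _ + _ at ht₆
  -- Of the 6 lost-edge units, 4 come from the changes along the walk and 2 from the reserve for
  -- edge items. The number of blocks times `s` is `O(m)` by `hNs`, since `s ≤ l ≤ m`.
  have hmul : 230 * s * (weight (l + 1) (credit Λ G lam) B + 2 * totalLost G lam) ≤
      230 * s * (2 * (σ₄.reg 5 - G.m) + 6 * totalLost G lam) :=
    Nat.mul_le_mul_left _ (by omega)
  have h1 : 230 * s * (2 * (σ₄.reg 5 - G.m) + 6 * totalLost G lam) =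
      460 * ((σ₄.reg 5 - G.m) * s) + 1380 * (s * totalLost G lam) := by ring
  have h2 : 110 * s * totalLost G lam = 110 * (s * totalLost G lam) := by ring
  have h3 : 130 * s * (σ₄.reg 5 - G.m) = 130 * ((σ₄.reg 5 - G.m) * s) := by ring
  omega

end

end BottleneckSplit

/-! ### The bound in terms of the real logarithm. -/

theorem mainTheorem3 :
    ∃ (P : BottleneckSplit.Prog) (C : ℕ),
      ∀ (G : BottleneckSplit.Instance) (k l : ℕ) (lam : Fin (l + 2) → EReal),
        G.WeaklyConnected → 1 ≤ l → l ≤ k → l ≤ G.m →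
        BottleneckSplit.IsThresholds lam →
        ∃ (t : ℕ) (τ : BottleneckSplit.Store),
          BottleneckSplit.Exec (C * (G.n + G.m + l))
            P (BottleneckSplit.inputStore G lam) t τ ∧
          BottleneckSplit.IsSplit G lam τ ∧
          (t : ℝ) ≤ C * (G.m + BottleneckSplit.lostEdges G lam * Real.log k) := by
  refine ⟨BottleneckSplit.split, 8000, fun G k l lam hG hl hlk hlm hlam => ?_⟩
  obtain ⟨t, τ, hex, hsplit, s, hs, ht⟩ := BottleneckSplit.run_split hG hl hlm hlam
    (W := 8000 * (G.n + G.m + l)) (by omega)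
  refine ⟨t, τ, hex, hsplit, ?_⟩
  have hr : BottleneckSplit.lostEdges G lam = BottleneckSplit.totalLost G lam :=
    G.lostEdges_eq hlam
  have hrm : BottleneckSplit.totalLost G lam ≤ G.m := by
    refine (Finset.sum_le_card_nsmul _ _ 1 fun e _ => ?_).trans (by simp)
    unfold BottleneckSplit.lostCount
    split_ifs <;> omega
  rw [hr]
  generalize BottleneckSplit.totalLost G lam = r at *
  -- From `2 ^ s ≤ 2 * l ≤ 2 * k` and `log 2 > 1 / 2`.
  have hlog : (s : ℝ) ≤ 1 + 2 * Real.log k := by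
    have h1 : (2 : ℝ) ^ s ≤ 2 * k := by exact_mod_cast hs.trans (by omega)
    have hk : (0 : ℝ) < k := by exact_mod_cast (by omega : 0 < k)
    have h2 := Real.log_le_log (by positivity) h1
    rw [Real.log_pow, Real.log_mul (by norm_num) hk.ne'] at h2
    have h3 := Real.log_two_gt_d9
    have h4 : 0 ≤ Real.log k := Real.log_natCast_nonneg k
    by_contra hcon
    push Not at hcon
    nlinarith
  have ht' : (t : ℝ) ≤ 6000 * G.m + 2000 * (s * r) := by exact_mod_cast ht
  have hrm' : (r : ℝ) ≤ G.m := by exact_mod_cast hrm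
  have hr0 : (0 : ℝ) ≤ r := Nat.cast_nonneg r
  have hk0 : 0 ≤ Real.log k := Real.log_natCast_nonneg k
  -- The summand `r` is absorbed by `m`: this gives `6000 + 2000` for `m` and `4000` for `r log k`,
  -- and is the reason why `k = 1` causes no problem.
  have h5 : (s : ℝ) * r ≤ r + 2 * (r * Real.log k) := by nlinarith
  have h6 : 0 ≤ (r : ℝ) * Real.log k := by positivity
  push_cast
  nlinarith
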